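/- Let $d\ge 1$ be an integer, $\mathbb N_0=\{0,1,2,\dots\}$, $\mathbb R^d_+=(0,\infty)^d$, $\overline{\mathbb R^d_+}=[0,\infty)^d$, and $|n|=n_1+\dots+n_d$ for $n\in\mathbb N_0^d$. All functions are complex valued. Let $\mathcal S(\mathbb R^d_+)$ be the space of all $f\in C^\infty(\mathbb R^d_+)$ all of whose partial derivatives $\partial^p f$ ($p\in\mathbb N_0^d$) extend continuously to $\overline{\mathbb R^d_+}$ and satisfy $\sup_{x\in\mathbb R^d_+}x^k|\partial^pf(x)|<\infty$ for all $p,k\in\mathbb N_0^d$; such an $f$ is identified with its continuous extension to $\overline{\mathbb R^d_+}$. Let $$E=-\sum_{j=1}^d\Big(\frac{\partial}{\partial x_j}\Big(x_j\frac{\partial}{\partial x_j}\Big)-\frac{x_j}{4}+\frac12\Big)$$ be the Laguerre operator. For $\alpha,h>0$ let $\mathbf G^{\alpha,h}_{\alpha,h}(\mathbb R^d_+)$ be the space of all $f\in\mathcal S(\mathbb R^d_+)$ with $$\eta^\alpha_h(f)=\sup_{N\in\mathbb N_0}\frac{\|E^Nf\|_{L^2(\mathbb R^d_+)}}{h^N\,N!^{\alpha}}<\infty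 ,$$ normed by $\eta_h^\alpha$, and let $\mathbf G^\alpha_\alpha(\mathbb R^d_+)=\bigcup_{h>0}\mathbf G^{\alpha,h}_{\alpha,h}(\mathbb R^d_+)$ with the locally convex inductive limit topology. For $\beta>0$ let $\ell_\beta(\mathbb N_0^d)$ be the union over $h>0$ of the Banach spaces of complex sequences $(a_n)_{n\in\mathbb N_0^d}$ with norm $\sup_n|a_n|e^{h|n|^{1/(2\beta)}}<\infty$, with the locally convex inductive limit topology. Let $h_n(x)=\prod_{k=1}^d h_{n_k}(x_k)$, $n\in\mathbb N_0^d$, be the Hermite functions on $\mathbb R^d$, where $h_m(t)=(2^m m!\sqrt\pi)^{-1/2}e^{-t^2/2}H_m(t)$ and $H_m(t)=(-1)^me^{t^2}\frac{d^m}{dt^m}e^{-t^2}$. The Pilipović space $\mathcal H_\beta(\mathbb R^d)$ is the space of all functions $\sum_{n}a_nh_n$ with $(a_n)\in\ell_\beta(\mathbb N_0^d)$, with the topology carried over from $\ell_\beta(\mathbb N^d_0)$ by the bijection $(a_n)\mapsto\sum_n a_nh_n$. Let $\mathcal H_{\beta,even}(\mathbb R^d)$ be the subspace of those $\psi\in\mathcal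 H_\beta(\mathbb R^d)$ that are even in each of the variables $x_1,\dots,x_d$, with the subspace topology. Let $v:\mathbb R^d\to\overline{\mathbb R^d_+}$, $v(x)=(x_1^2,\dots,x_d^2)$, and $w:\overline{\mathbb R^d_+}\to\overline{\mathbb R^d_+}$, $w(x)=(\sqrt{x_1},\dots,\sqrt{x_d})$. **Statement.** For every $\alpha>0$, the map $f\mapsto f\circ v$ is a topological isomorphism (a linear bijection, continuous in both directions) from $\mathbf G^\alpha_\alpha(\mathbb R^d_+)$ onto $\mathcal H_{\alpha/2,even}(\mathbb R^d)$. Its inverse is $\psi\mapsto\psi|_{\overline{\mathbb R^d_+}}\circ w$. -/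

import Mathlib

namespace Pilipovic
noncomputable section

open Filter Topology MeasureTheory
open scoped ContDiff Nat

/-- Hermite polynomials in one variable (Rodrigues formula). -/
def hermitePoly (n : ℕ) (x : ℝ) : ℝ :=
  (-1) ^ n * Real.exp (x ^ 2) * iteratedDeriv n (fun t : ℝ => Real.exp (-t ^ 2)) x

/-- Normalized Hermite functions in one variable. -/
def hermiteFun₁ (n : ℕ) (x : ℝ) : ℝ :=
  (Real.sqrt (2 ^ n * n ! * Real.sqrt Real.pi))⁻¹ * Real.exp (-x ^ 2 / 2) * hermitePoly n x

/-- Hermite functions on `ℝ^d`. -/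
def hermiteFun {d : ℕ} (n : Fin d → ℕ) (x : Fin d → ℝ) : ℝ :=
  ∏ i, hermiteFun₁ (n i) (x i)

theorem contDiff_gauss : ContDiff ℝ ∞ (fun t : ℝ => Real.exp (-t ^ 2)) := by fun_prop

theorem hasDerivAt_iteratedDeriv_gauss (n : ℕ) (x : ℝ) :
    HasDerivAt (iteratedDeriv n (fun t : ℝ => Real.exp (-t ^ 2)))
      (iteratedDeriv (n + 1) (fun t : ℝ => Real.exp (-t ^ 2)) x) x := by
  rw [iteratedDeriv_succ]
  have : Differentiable ℝ (iteratedDeriv n (fun t : ℝ => Real.exp (-t ^ 2))) :=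
    contDiff_gauss.differentiable_iteratedDeriv n (by exact_mod_cast WithTop.coe_lt_top _)
  exact (this x).hasDerivAt

theorem iteratedDeriv_gauss_rec (n : ℕ) :
    ∀ x : ℝ, iteratedDeriv (n + 2) (fun t : ℝ => Real.exp (-t ^ 2)) x =
      -2 * x * iteratedDeriv (n + 1) (fun t : ℝ => Real.exp (-t ^ 2)) x
        - 2 * (n + 1) * iteratedDeriv n (fun t : ℝ => Real.exp (-t ^ 2)) x := by
  have h1 : ∀ x : ℝ, iteratedDeriv 1 (fun t : ℝ => Real.exp (-t ^ 2)) x =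
      -2 * x * iteratedDeriv 0 (fun t : ℝ => Real.exp (-t ^ 2)) x := by
    intro x
    have h := hasDerivAt_iteratedDeriv_gauss 0 x
    rw [iteratedDeriv_zero] at h ⊢
    have h2 : HasDerivAt (fun t : ℝ => Real.exp (-t ^ 2))
        (Real.exp (-x ^ 2) * (-(2 * x))) x := by
      have := ((hasDerivAt_pow 2 x).neg).exp
      simpa using this
    rw [zero_add] at h
    rw [h.unique h2]; ring
  induction n with
  | zero =>
    intro x
    have h := hasDerivAt_iteratedDeriv_gauss 1 x
    have e : iteratedDeriv 1 (fun t : ℝ => Real.exp (-t ^ 2)) =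
      fun x => -2 * x * iteratedDeriv 0 (fun t : ℝ => Real.exp (-t ^ 2)) x := funext h1
    have h2 := ((hasDerivAt_id x).const_mul (-2)).mul (hasDerivAt_iteratedDeriv_gauss 0 x)
    have := h.unique (h2.congr_of_eventuallyEq (Eventually.of_forall fun y => congrFun e y))
    simp only [zero_add, id] at this ⊢
    rw [show (1 + 1 : ℕ) = 2 from rfl] at this
    rw [this]; push_cast; ring
  | succ n ih =>
    intro x
    have h := hasDerivAt_iteratedDeriv_gauss (n + 2) x
    have h2 := (((hasDerivAt_id x).const_mul (-2)).mul
      (hasDerivAt_iteratedDeriv_gauss (n + 1) x)).sub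
      ((hasDerivAt_iteratedDeriv_gauss n x).const_mul (2 * ((n : ℝ) + 1)))
    have := h.unique (h2.congr_of_eventuallyEq (Eventually.of_forall ih))
    simp only [id] at this ⊢
    rw [show n + 1 + 2 = n + 2 + 1 from rfl, this]; push_cast; ring

/-- Unnormalized Hermite functions, used only to bound the normalized ones. -/
def hermiteAux (n : ℕ) (x : ℝ) : ℝ := Real.exp (-x ^ 2 / 2) * hermitePoly n x

theorem hermiteAux_rec (n : ℕ) (x : ℝ) :
    hermiteAux (n + 2) x = 2 * x * hermiteAux (n + 1) x - 2 * (n + 1) * hermiteAux n x := by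
  unfold hermiteAux hermitePoly
  rw [iteratedDeriv_gauss_rec n x]; ring

theorem hasDerivAt_hermiteAux (n : ℕ) (x : ℝ) :
    HasDerivAt (hermiteAux n) (x * hermiteAux n x - hermiteAux (n + 1) x) x := by
  have h1 : HasDerivAt (fun x : ℝ => Real.exp (-x ^ 2 / 2)) (Real.exp (-x ^ 2 / 2) * (-x)) x := by
    refine (((hasDerivAt_pow 2 x).neg).div_const 2).exp.congr_deriv ?_
    simp only [Pi.neg_apply]; push_cast; ring
  have h2 : HasDerivAt (fun x : ℝ => Real.exp (x ^ 2)) (Real.exp (x ^ 2) * (2 * x)) x := by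
    have := (hasDerivAt_pow 2 x).exp
    simpa using this
  have h3 := h1.mul ((h2.const_mul ((-1) ^ n)).mul (hasDerivAt_iteratedDeriv_gauss n x))
  refine h3.congr_deriv ?_
  simp only [hermiteAux, hermitePoly, pow_succ, Pi.mul_apply]; ring

theorem hermiteAux_zero_sq_le (n : ℕ) :
    hermiteAux n 0 ^ 2 ≤ 2 ^ n * n ! * Real.sqrt Real.pi ∧
    hermiteAux (n + 1) 0 ^ 2 ≤ 2 ^ (n + 1) * (n + 1)! * Real.sqrt Real.pi := by
  have hpi : 1 ≤ Real.sqrt Real.pi := by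
    rw [Real.one_le_sqrt]; linarith [Real.pi_gt_three]
  induction n with
  | zero =>
    have h0 : hermiteAux 0 0 = 1 := by simp [hermiteAux, hermitePoly]
    have h1 : hermiteAux 1 0 = 0 := by
      have h2 : HasDerivAt (fun t : ℝ => Real.exp (-t ^ 2)) 0 0 := by
        have := ((hasDerivAt_pow 2 (0 : ℝ)).neg).exp
        simpa using this
      simp [hermiteAux, hermitePoly, h2.deriv]
    simp only [zero_add, h0, h1]
    constructor
    · simpa using hpi
    · simp only [ne_eq, OfNat.ofNat_ne_zero, not_false_eq_true, zero_pow]; positivity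
  | succ n ih =>
    refine ⟨ih.2, ?_⟩
    have e : hermiteAux (n + 1 + 1) 0 = - 2 * (n + 1) * hermiteAux n 0 := by
      rw [show n + 1 + 1 = n + 2 from rfl, hermiteAux_rec]; ring
    rw [e, mul_pow]
    calc (-2 * ((n : ℝ) + 1)) ^ 2 * hermiteAux n 0 ^ 2
        ≤ (-2 * ((n : ℝ) + 1)) ^ 2 * (2 ^ n * n ! * Real.sqrt Real.pi) := by
          gcongr; exact ih.1
      _ ≤ _ := by
          rw [Nat.factorial_succ (n + 1), Nat.factorial_succ n]
          push_cast
          have : 0 ≤ (2 : ℝ) ^ n * n ! * Real.sqrt Real.pi * (n + 1) := by positivity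
          have e2 : (2 : ℝ) ^ (n + 1 + 1) = 4 * 2 ^ n := by ring
          rw [e2]
          nlinarith

theorem hermiteAux_energy (n : ℕ) (x : ℝ) :
    (2 * n + 1 - x ^ 2) * hermiteAux n x ^ 2 ≤
      hermiteAux (n + 1) 0 ^ 2 + (2 * n + 1) * hermiteAux n 0 ^ 2 := by
  set F : ℝ → ℝ := fun x => hermiteAux (n + 1) x ^ 2
    - 2 * (x * (hermiteAux n x * hermiteAux (n + 1) x)) + (2 * n + 1) * hermiteAux n x ^ 2 with hF
  have hd : ∀ x, HasDerivAt F (-2 * x * hermiteAux n x ^ 2) x := by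
    intro x
    have h0 := hasDerivAt_hermiteAux n x
    have h1 := hasDerivAt_hermiteAux (n + 1) x
    have := ((h1.pow 2).sub (((hasDerivAt_id x).mul (h0.mul h1)).const_mul 2)).add
      ((h0.pow 2).const_mul (2 * (n : ℝ) + 1))
    refine this.congr_deriv ?_
    have e := hermiteAux_rec n x
    simp only [id, Pi.mul_apply]
    rw [show n + 1 + 1 = n + 2 from rfl, e]; push_cast; ring
  have hc : Continuous F := continuous_iff_continuousAt.2 fun x => (hd x).continuousAt
  have hF0 : F x ≤ F 0 := by
    rcases le_total 0 x with hx | hx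
    · refine antitoneOn_of_deriv_nonpos (convex_Ici 0) hc.continuousOn
        (fun y _ => (hd y).differentiableAt.differentiableWithinAt) ?_ (by simp) (by simpa) hx
      intro y hy
      rw [interior_Ici] at hy
      rw [(hd y).deriv]
      nlinarith [sq_nonneg (hermiteAux n y), hy.out, mul_nonneg hy.out.le (sq_nonneg (hermiteAux n y))]
    · refine monotoneOn_of_deriv_nonneg (convex_Iic 0) hc.continuousOn
        (fun y _ => (hd y).differentiableAt.differentiableWithinAt) ?_ (by simpa) (by simp) hx
      intro y hy
      rw [interior_Iic] at hy
      rw [(hd y).deriv]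
      nlinarith [sq_nonneg (hermiteAux n y), hy.out,
        mul_nonneg (neg_nonneg.2 hy.out.le) (sq_nonneg (hermiteAux n y))]
  simp only [hF] at hF0
  nlinarith [sq_nonneg (x * hermiteAux n x - hermiteAux (n + 1) x)]

theorem abs_hermiteFun₁_le_two (n : ℕ) (x : ℝ) (hx : x ^ 2 ≤ n) : |hermiteFun₁ n x| ≤ 2 := by
  have hc : 0 < (2 : ℝ) ^ n * n ! * Real.sqrt Real.pi := by positivity
  have hE := hermiteAux_energy n x
  have h0 := hermiteAux_zero_sq_le n
  have hsq : hermiteFun₁ n x ^ 2 = hermiteAux n x ^ 2 / (2 ^ n * n ! * Real.sqrt Real.pi) := by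
    rw [hermiteFun₁, mul_assoc, mul_pow, inv_pow, Real.sq_sqrt hc.le, hermiteAux]; ring
  refine abs_le_of_sq_le_sq (?_ : hermiteFun₁ n x ^ 2 ≤ 2 ^ 2) (by norm_num)
  rw [hsq, div_le_iff₀ hc]
  have h1 := h0.2
  rw [Nat.factorial_succ, pow_succ] at h1
  push_cast at h1
  set c := (2 : ℝ) ^ n * n ! * Real.sqrt Real.pi
  have h1' : hermiteAux (n + 1) 0 ^ 2 ≤ 2 * (n + 1) * c := by
    refine h1.trans (le_of_eq ?_); simp only [c]; ring
  have h2 : ((n : ℝ) + 1) * hermiteAux n x ^ 2 ≤ (n + 1) * (2 ^ 2 * c) := by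
    have : ((n : ℝ) + 1) * hermiteAux n x ^ 2 ≤ (2 * n + 1 - x ^ 2) * hermiteAux n x ^ 2 := by
      gcongr; linarith
    have h3 : (2 * (n : ℝ) + 1) * hermiteAux n 0 ^ 2 ≤ (2 * n + 1) * c := by
      gcongr; exact h0.1
    nlinarith
  exact le_of_mul_le_mul_left h2 (by positivity)

theorem exists_bound_hermiteFun {d : ℕ} (x : Fin d → ℝ) :
    ∃ K : ℝ, ∀ n : Fin d → ℕ, ‖(hermiteFun n x : ℂ)‖ ≤ K := by
  have h1 : ∀ t : ℝ, ∃ K : ℝ, ∀ m : ℕ, |hermiteFun₁ m t| ≤ K := by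
    intro t
    obtain ⟨M, hM⟩ := exists_nat_ge (t ^ 2)
    refine ⟨2 + ∑ i ∈ Finset.range M, |hermiteFun₁ i t|, fun m => ?_⟩
    have hS : 0 ≤ ∑ i ∈ Finset.range M, |hermiteFun₁ i t| :=
      Finset.sum_nonneg fun i _ => abs_nonneg _
    rcases lt_or_ge m M with h | h
    · have := Finset.single_le_sum (f := fun i => |hermiteFun₁ i t|)
        (fun i _ => abs_nonneg _) (Finset.mem_range.2 h)
      linarith
    · have := abs_hermiteFun₁_le_two m t (hM.trans (by exact_mod_cast h))
      linarith
  choose K hK using fun i => h1 (x i)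
  refine ⟨∏ i, K i, fun n => ?_⟩
  rw [Complex.norm_real, Real.norm_eq_abs, hermiteFun, Finset.abs_prod]
  exact Finset.prod_le_prod (fun i _ => abs_nonneg _) fun i _ => hK i (n i)

theorem summable_exp_neg {d : ℕ} {h s : ℝ} (hh : 0 < h) (hs : 0 < s) :
    Summable fun n : Fin d → ℕ => Real.exp (-(h * ((∑ i, n i : ℕ) : ℝ) ^ s)) := by
  obtain ⟨C, hC⟩ : ∃ C : ℝ, ∀ m : ℕ, (1 + (m : ℝ)) ^ (2 * d) * Real.exp (-(h * (m : ℝ) ^ s)) ≤ C := by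
    have ht : Tendsto (fun m : ℕ => ((m : ℝ) ^ s) ^ ((2 * d : ℕ) / s : ℝ) *
        Real.exp (-h * (m : ℝ) ^ s)) atTop (𝓝 0) :=
      (tendsto_rpow_mul_exp_neg_mul_atTop_nhds_zero _ h hh).comp
        ((tendsto_rpow_atTop hs).comp tendsto_natCast_atTop_atTop)
    obtain ⟨B, hB⟩ := ht.bddAbove_range
    refine ⟨max 1 (2 ^ (2 * d) * B), fun m => ?_⟩
    rcases Nat.eq_zero_or_pos m with rfl | hm
    · refine le_max_of_le_left ?_
      simp [Real.zero_rpow hs.ne']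
    · refine le_max_of_le_right ?_
      have hB' := hB ⟨m, rfl⟩
      simp only at hB'
      rw [← Real.rpow_mul (Nat.cast_nonneg m), mul_div_cancel₀ _ hs.ne', Real.rpow_natCast,
        neg_mul] at hB'
      have hm' : (1 : ℝ) ≤ m := by exact_mod_cast hm
      calc (1 + (m : ℝ)) ^ (2 * d) * Real.exp (-(h * (m : ℝ) ^ s))
          ≤ (2 * (m : ℝ)) ^ (2 * d) * Real.exp (-(h * (m : ℝ) ^ s)) := by
            gcongr; linarith
        _ = 2 ^ (2 * d) * ((m : ℝ) ^ (2 * d) * Real.exp (-(h * (m : ℝ) ^ s))) := by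
            rw [mul_pow]; ring
        _ ≤ _ := by gcongr
  have hC0 : 0 ≤ C := le_trans (by positivity) (hC 0)
  have hq : Summable fun k : ℕ => ((1 + (k : ℝ)) ^ 2)⁻¹ := by
    have := (summable_nat_add_iff 1).2 (Real.summable_nat_pow_inv.2 (by norm_num : 1 < 2))
    refine this.congr fun k => ?_
    push_cast; rw [add_comm]
  have hprod : Summable fun n : Fin d → ℕ => ∏ i, ((1 + (n i : ℝ)) ^ 2)⁻¹ := by
    refine summable_of_sum_le (c := ∏ _i : Fin d, ∑' k : ℕ, ((1 + (k : ℝ)) ^ 2)⁻¹)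
      (fun n => Finset.prod_nonneg fun i _ => by positivity) fun u => ?_
    obtain ⟨M, hM⟩ : ∃ M, ∀ n ∈ u, ∀ i, n i < M := by
      refine ⟨(u.sup fun n => ∑ i, n i) + 1, fun n hn i => Nat.lt_succ_of_le ?_⟩
      exact (Finset.single_le_sum (fun _ _ => Nat.zero_le _) (Finset.mem_univ i)).trans
        (Finset.le_sup (f := fun n : Fin d → ℕ => ∑ i, n i) hn)
    calc _ ≤ ∑ n ∈ Fintype.piFinset fun _ : Fin d => Finset.range M,
          ∏ i, ((1 + (n i : ℝ)) ^ 2)⁻¹ := by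
          refine Finset.sum_le_sum_of_subset_of_nonneg (fun n hn => ?_)
            (fun n _ _ => Finset.prod_nonneg fun i _ => by positivity)
          rw [Fintype.mem_piFinset]
          exact fun i => Finset.mem_range.2 (hM n hn i)
      _ = ∏ _i : Fin d, ∑ k ∈ Finset.range M, ((1 + (k : ℝ)) ^ 2)⁻¹ :=
          (Finset.prod_univ_sum (fun _ : Fin d => Finset.range M)
            (fun _ k => ((1 + (k : ℝ)) ^ 2)⁻¹)).symm
      _ ≤ _ := Finset.prod_le_prod (fun i _ => Finset.sum_nonneg fun k _ => by positivity)
          fun i _ => hq.sum_le_tsum _ fun k _ => by positivity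
  refine Summable.of_nonneg_of_le (fun n => (Real.exp_pos _).le) (fun n => ?_) (hprod.mul_left C)
  have h1 : ∏ i, (1 + (n i : ℝ)) ^ 2 ≤ (1 + ((∑ i, n i : ℕ) : ℝ)) ^ (2 * d) := by
    calc ∏ i, (1 + (n i : ℝ)) ^ 2 ≤ ∏ _i : Fin d, (1 + ((∑ i, n i : ℕ) : ℝ)) ^ 2 := by
          refine Finset.prod_le_prod (fun i _ => by positivity) fun i _ => ?_
          have : (n i : ℝ) ≤ ((∑ i, n i : ℕ) : ℝ) := by
            exact_mod_cast Finset.single_le_sum (fun _ _ => Nat.zero_le _) (Finset.mem_univ i)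
          gcongr
      _ = _ := by simp [pow_mul]
  rw [Finset.prod_inv_distrib, ← div_eq_mul_inv,
    le_div_iff₀ (Finset.prod_pos fun i _ => by positivity)]
  calc _ ≤ Real.exp (-(h * ((∑ i, n i : ℕ) : ℝ) ^ s)) * (1 + ((∑ i, n i : ℕ) : ℝ)) ^ (2 * d) := by
        gcongr
    _ ≤ C := by rw [mul_comm]; exact hC _


/-! ### Locally convex inductive limits -/

/-- The locally convex inductive limit topology on `V` for linear maps `j i : F i → V` (inclusions
in the applications) out of seminormed spaces: the finest locally convex vector space topology on
`V` for which all `j i` are continuous. In Mathlib's order on topologies the infimum of a set of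
topologies is the coarsest topology finer than all of them, and it is again in the set here. -/
abbrev indLimTopology {V : Type*} [AddCommGroup V] [Module ℂ V] {ι : Type*} {F : ι → Type*}
    [∀ i, SeminormedAddCommGroup (F i)] [∀ i, NormedSpace ℂ (F i)] (j : ∀ i, F i →ₗ[ℂ] V) :
    TopologicalSpace V :=
  sInf {t : TopologicalSpace V | @IsTopologicalAddGroup V t _ ∧ @ContinuousSMul ℂ V _ _ t ∧
    @LocallyConvexSpace ℝ V _ _ _ _ t ∧ ∀ i, @Continuous _ _ _ t (j i)}

/-- The index set of the steps: real numbers `h > 0`. -/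
abbrev PosReal : Type := {h : ℝ // 0 < h}

/-! ### The sequence spaces -/

section Sequences
variable {d : ℕ}

/-- The weight `exp (h |n| ^ (1 / (2 β)))`, where `|n| = n₁ + ⋯ + n_d`. -/
def weight (β h : ℝ) (n : Fin d → ℕ) : ℝ :=
  Real.exp (h * ((∑ i, n i : ℕ) : ℝ) ^ (1 / (2 * β)))

variable (d) in
/-- The weighted `ℓ^∞` space of all `a` with `sup_n |a_n| exp (h |n| ^ (1 / (2 β))) < ∞`, as a
space of sequences. -/
def seqStepSubmodule (β h : ℝ) : Submodule ℂ ((Fin d → ℕ) → ℂ) where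
  carrier := {a | BddAbove (Set.range fun n => ‖a n‖ * weight β h n)}
  zero_mem' := ⟨0, by rintro _ ⟨n, rfl⟩; simp⟩
  add_mem' := by
    rintro a b ⟨A, hA⟩ ⟨B, hB⟩
    refine ⟨A + B, ?_⟩
    rintro _ ⟨n, rfl⟩
    have h1 := hA ⟨n, rfl⟩
    have h2 := hB ⟨n, rfl⟩
    have hw : 0 ≤ weight β h n := (Real.exp_pos _).le
    calc ‖(a + b) n‖ * weight β h n ≤ (‖a n‖ + ‖b n‖) * weight β h n := by
          gcongr; exact norm_add_le _ _
      _ ≤ A + B := by rw [add_mul]; exact add_le_add h1 h2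
  smul_mem' := by
    rintro c a ⟨A, hA⟩
    refine ⟨‖c‖ * A, ?_⟩
    rintro _ ⟨n, rfl⟩
    have h1 := hA ⟨n, rfl⟩
    simp only [Pi.smul_apply, smul_eq_mul, norm_mul, mul_assoc]
    exact mul_le_mul_of_nonneg_left h1 (norm_nonneg c)

variable (d) in
/-- The Banach space `ℓ^∞_{[ϑ_{h,β}]}(ℕ₀^d)`. -/
def SeqStep (β h : ℝ) : Type := ↥(seqStepSubmodule d β h)

instance (β h : ℝ) : AddCommGroup (SeqStep d β h) :=
  inferInstanceAs (AddCommGroup ↥(seqStepSubmodule d β h))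

instance (β h : ℝ) : Module ℂ (SeqStep d β h) :=
  inferInstanceAs (Module ℂ ↥(seqStepSubmodule d β h))

instance (β h : ℝ) : Norm (SeqStep d β h) := ⟨fun a => ⨆ n, ‖a.1 n‖ * weight β h n⟩

theorem SeqStep.norm_def {β h : ℝ} (a : SeqStep d β h) :
    ‖a‖ = ⨆ n, ‖a.1 n‖ * weight β h n := rfl

theorem SeqStep.core (β h : ℝ) : NormedSpace.Core ℂ (SeqStep d β h) where
  norm_nonneg a := Real.iSup_nonneg fun n => mul_nonneg (norm_nonneg _) (Real.exp_pos _).le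
  norm_smul c a := by
    rw [SeqStep.norm_def, SeqStep.norm_def, Real.mul_iSup_of_nonneg (norm_nonneg c)]
    congr 1; funext n
    rw [← mul_assoc, ← norm_mul]; rfl
  norm_triangle a b := by
    refine ciSup_le fun n => ?_
    have h1 := le_ciSup a.2 n
    have h2 := le_ciSup b.2 n
    have hw : 0 ≤ weight β h n := (Real.exp_pos _).le
    calc ‖(a + b).1 n‖ * weight β h n ≤ (‖a.1 n‖ + ‖b.1 n‖) * weight β h n := by
          gcongr; exact norm_add_le _ _
      _ ≤ ‖a‖ + ‖b‖ := by rw [add_mul]; exact add_le_add h1 h2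
  norm_eq_zero_iff a := by
    constructor
    · intro h0
      refine Subtype.ext (funext fun n => ?_)
      have h1 : ‖a.1 n‖ * weight β h n ≤ ‖a‖ := le_ciSup a.2 n
      rw [h0] at h1
      have hw : 0 < weight β h n := Real.exp_pos _
      have : ‖a.1 n‖ ≤ 0 := by
        by_contra hc
        exact absurd h1 (not_le.2 (mul_pos (not_le.1 hc) hw))
      exact norm_le_zero_iff.1 this
    · rintro rfl
      rw [SeqStep.norm_def]
      have : ∀ n, ‖(0 : SeqStep d β h).1 n‖ * weight β h n = 0 := fun n => by
        change ‖(0 : ℂ)‖ * _ = 0; simp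
      simp [this]

instance (β h : ℝ) : NormedAddCommGroup (SeqStep d β h) := NormedAddCommGroup.ofCore (SeqStep.core β h)

instance (β h : ℝ) : NormedSpace ℂ (SeqStep d β h) :=
  NormedSpace.ofCore (SeqStep.core β h)

theorem seqStepSubmodule_anti (β : ℝ) {h k : ℝ} (hk : h ≤ k) :
    seqStepSubmodule d β k ≤ seqStepSubmodule d β h := by
  rintro a ⟨A, hA⟩
  refine ⟨A, ?_⟩
  rintro _ ⟨n, rfl⟩
  refine le_trans ?_ (hA ⟨n, rfl⟩)
  simp only [weight]
  gcongr

variable (d) in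
/-- `ℓ_β(ℕ₀^d)`, the union of the spaces `ℓ^∞_{[ϑ_{h,β}]}(ℕ₀^d)` over `h > 0`, as a space of
sequences. -/
def seqSubmodule (β : ℝ) : Submodule ℂ ((Fin d → ℕ) → ℂ) where
  carrier := {a | ∃ h : PosReal, a ∈ seqStepSubmodule d β h}
  zero_mem' := ⟨⟨1, one_pos⟩, zero_mem _⟩
  add_mem' := by
    rintro a b ⟨h, ha⟩ ⟨k, hb⟩
    exact ⟨⟨min h k, lt_min h.2 k.2⟩, add_mem (seqStepSubmodule_anti β (min_le_left _ _) ha)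
      (seqStepSubmodule_anti β (min_le_right _ _) hb)⟩
  smul_mem' := fun c a ⟨h, ha⟩ => ⟨h, Submodule.smul_mem _ c ha⟩

variable (d) in
/-- The space `ℓ_β(ℕ₀^d)`. -/
def SeqSpace (β : ℝ) : Type := ↥(seqSubmodule d β)

instance (β : ℝ) : AddCommGroup (SeqSpace d β) :=
  inferInstanceAs (AddCommGroup ↥(seqSubmodule d β))

instance (β : ℝ) : Module ℂ (SeqSpace d β) :=
  inferInstanceAs (Module ℂ ↥(seqSubmodule d β))

variable (d) in
/-- The inclusion `ℓ^∞_{[ϑ_{h,β}]}(ℕ₀^d) → ℓ_β(ℕ₀^d)`. -/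
def SeqStep.incl (β : ℝ) (h : PosReal) : SeqStep d β h →ₗ[ℂ] SeqSpace d β :=
  Submodule.inclusion (p := seqStepSubmodule d β h) (p' := seqSubmodule d β)
    fun _ ha => ⟨h, ha⟩

/-- `ℓ_β(ℕ₀^d)` carries the locally convex inductive limit topology. -/
instance (β : ℝ) : TopologicalSpace (SeqSpace d β) := indLimTopology (SeqStep.incl d β)

/-! ### Pilipović spaces on `ℝ^d` -/

theorem summable_hermite {β : ℝ} (hβ : 0 < β) (a : SeqSpace d β) (x : Fin d → ℝ) :
    Summable fun n => a.1 n * (hermiteFun n x : ℂ) := by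
  obtain ⟨h, C, hC⟩ := a.2
  obtain ⟨K, hK⟩ := exists_bound_hermiteFun x
  refine Summable.of_norm_bounded
    ((summable_exp_neg (d := d) h.2 (s := 1 / (2 * β)) (by positivity)).mul_left (C * K))
    fun n => ?_
  have h1 : ‖a.1 n‖ * weight β h n ≤ C := hC ⟨n, rfl⟩
  rw [weight] at h1
  rw [norm_mul, Real.exp_neg, ← div_eq_mul_inv, le_div_iff₀ (Real.exp_pos _)]
  have hC0 : 0 ≤ C := le_trans (by positivity) h1
  calc _ = (‖a.1 n‖ * Real.exp (h * ((∑ i, n i : ℕ) : ℝ) ^ (1 / (2 * β)))) *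
        ‖(hermiteFun n x : ℂ)‖ := by ring
    _ ≤ C * K := mul_le_mul h1 (hK n) (norm_nonneg _) hC0

variable (d) in
/-- The linear map sending `a ∈ ℓ_β(ℕ₀^d)` to the function `∑ a_n h_n` on `ℝ^d`. -/
def hermiteSeries (β : ℝ) (hβ : 0 < β) : SeqSpace d β →ₗ[ℂ] ((Fin d → ℝ) → ℂ) where
  toFun a x := ∑' n, a.1 n * (hermiteFun n x : ℂ)
  map_add' a b := by
    funext x
    rw [Pi.add_apply, ← (summable_hermite hβ a x).tsum_add (summable_hermite hβ b x)]
    refine tsum_congr fun n => ?_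
    rw [← add_mul]; rfl
  map_smul' c a := by
    funext x
    rw [RingHom.id_apply, Pi.smul_apply, smul_eq_mul, ← tsum_mul_left]
    refine tsum_congr fun n => ?_
    rw [← mul_assoc]; rfl

variable (d) in
/-- The Pilipović space `H_β(ℝ^d)`: all functions `∑ a_n h_n` with `(a_n) ∈ ℓ_β(ℕ₀^d)`. -/
def HermiteSpace (β : ℝ) (hβ : 0 < β) : Type := ↥(LinearMap.range (hermiteSeries d β hβ))

instance (β : ℝ) (hβ : 0 < β) : AddCommGroup (HermiteSpace d β hβ) :=
  inferInstanceAs (AddCommGroup ↥(LinearMap.range (hermiteSeries d β hβ)))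

instance (β : ℝ) (hβ : 0 < β) : Module ℂ (HermiteSpace d β hβ) :=
  inferInstanceAs (Module ℂ ↥(LinearMap.range (hermiteSeries d β hβ)))

instance (β : ℝ) (hβ : 0 < β) : CoeFun (HermiteSpace d β hβ) fun _ => (Fin d → ℝ) → ℂ :=
  ⟨fun ψ => ψ.1⟩

/-- The topology of `ℓ_β(ℕ₀^d)`, transported to `H_β(ℝ^d)` by the bijection
`(a_n) ↦ ∑ a_n h_n`. -/
instance (β : ℝ) (hβ : 0 < β) : TopologicalSpace (HermiteSpace d β hβ) :=
  TopologicalSpace.coinduced (hermiteSeries d β hβ).rangeRestrict inferInstance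

variable (d) in
/-- `H_{β,even}(ℝ^d)`: the functions in `H_β(ℝ^d)` that are even in each variable, with the
subspace topology. -/
def hermiteEven (β : ℝ) (hβ : 0 < β) : Submodule ℂ (HermiteSpace d β hβ) where
  carrier := {ψ | ∀ (x : Fin d → ℝ) (j : Fin d), ψ (Function.update x j (-x j)) = ψ x}
  zero_mem' := fun _ _ => rfl
  add_mem' := fun ha hb x j => congrArg₂ (· + ·) (ha x j) (hb x j)
  smul_mem' := fun c _ ha x j => congrArg (c * ·) (ha x j)

end Sequences

/-! ### Orthants, derivatives, the Laguerre operator -/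

section Orthant
variable {d : ℕ}

variable (d) in
/-- The open orthant `ℝ^d_+ = (0,∞)^d`. -/
def openOrthant : Set (Fin d → ℝ) := {x | ∀ i, 0 < x i}

variable (d) in
/-- The closed orthant `[0,∞)^d`. -/
def closedOrthant : Set (Fin d → ℝ) := {x | ∀ i, 0 ≤ x i}

theorem isOpen_openOrthant : IsOpen (openOrthant d) := by
  have : openOrthant d = ⋂ i, {x | 0 < x i} := by ext; simp [openOrthant]
  rw [this]
  exact isOpen_iInter_of_finite fun i => isOpen_lt continuous_const (continuous_apply i)

theorem dense_openOrthant_subtype :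
    Dense {x : closedOrthant d | x.1 ∈ openOrthant d} := by
  intro x
  have ht : Tendsto (fun ε : ℝ => (fun i => x.1 i + ε)) (𝓝[>] 0) (𝓝 x.1) := by
    have hc : Continuous (fun ε : ℝ => (fun i => x.1 i + ε)) := by fun_prop
    have := (hc.tendsto 0).mono_left (nhdsWithin_le_nhds (s := Set.Ioi (0 : ℝ)))
    simpa using this
  rw [closure_subtype]
  refine mem_closure_of_tendsto ht ?_
  filter_upwards [self_mem_nhdsWithin] with ε hε
  have h1 : ∀ i, 0 < x.1 i + ε := fun i => add_pos_of_nonneg_of_pos (x.2 i) hε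
  exact ⟨⟨_, fun i => (h1 i).le⟩, h1, rfl⟩

/-- Partial derivative in the direction of the `j`-th coordinate. -/
def pderiv (j : Fin d) (F : (Fin d → ℝ) → ℂ) (x : Fin d → ℝ) : ℂ :=
  fderiv ℝ F x (Pi.single j 1)

/-- `∂^p` for a multi-index `p`. -/
def multiDeriv (p : Fin d → ℕ) (F : (Fin d → ℝ) → ℂ) : (Fin d → ℝ) → ℂ :=
  (List.finRange d).foldr (fun j G => (pderiv j)^[p j] G) F

/-- The Laguerre operator `E = -∑_j (∂_j (x_j ∂_j) - x_j / 4 + 1 / 2)`. -/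
def laguerreOp (F : (Fin d → ℝ) → ℂ) (x : Fin d → ℝ) : ℂ :=
  -∑ j, (pderiv j (fun y => (y j : ℂ) * pderiv j F y) x - (x j : ℂ) / 4 * F x + 1 / 2 * F x)

/-- Extension by zero of a function on the closed orthant. Only the values on the open orthant of
its derivatives are ever used. -/
def extendZero (f : closedOrthant d → ℂ) : (Fin d → ℝ) → ℂ := Function.extend Subtype.val f 0

theorem extendZero_apply (f : closedOrthant d → ℂ) (x : closedOrthant d) :
    extendZero f x.1 = f x := Subtype.val_injective.extend_apply f 0 x

theorem extendZero_add (f g : closedOrthant d → ℂ) :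
    extendZero (f + g) = extendZero f + extendZero g := by
  funext x
  by_cases hx : x ∈ closedOrthant d
  · have := extendZero_apply (f + g) ⟨x, hx⟩
    have h1 := extendZero_apply f ⟨x, hx⟩
    have h2 := extendZero_apply g ⟨x, hx⟩
    simp only at this h1 h2
    rw [this, Pi.add_apply, Pi.add_apply, h1, h2]
  · have h : ¬ ∃ a : closedOrthant d, a.1 = x := by rintro ⟨a, rfl⟩; exact hx a.2
    simp [extendZero, Function.extend_apply' _ _ _ h]

theorem extendZero_smul (c : ℂ) (f : closedOrthant d → ℂ) :
    extendZero (c • f) = c • extendZero f := by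
  funext x
  by_cases hx : x ∈ closedOrthant d
  · have := extendZero_apply (c • f) ⟨x, hx⟩
    have h1 := extendZero_apply f ⟨x, hx⟩
    simp only at this h1
    rw [this, Pi.smul_apply, Pi.smul_apply, h1]
  · have h : ¬ ∃ a : closedOrthant d, a.1 = x := by rintro ⟨a, rfl⟩; exact hx a.2
    simp [extendZero, Function.extend_apply' _ _ _ h]

/-- Smoothness on the open orthant. -/
def SmoothOrthant (F : (Fin d → ℝ) → ℂ) : Prop := ContDiffOn ℝ ∞ F (openOrthant d)

/-- Operators that act linearly, modulo values outside the open orthant, on the functions that are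
smooth on the open orthant. -/
structure IsSmoothOp (D : ((Fin d → ℝ) → ℂ) → ((Fin d → ℝ) → ℂ)) : Prop where
  smooth : ∀ {F}, SmoothOrthant F → SmoothOrthant (D F)
  congr : ∀ {F G}, Set.EqOn F G (openOrthant d) → Set.EqOn (D F) (D G) (openOrthant d)
  add : ∀ {F G}, SmoothOrthant F → SmoothOrthant G →
    Set.EqOn (D (F + G)) (D F + D G) (openOrthant d)
  smul : ∀ (c : ℂ) {F}, SmoothOrthant F → Set.EqOn (D (c • F)) (c • D F) (openOrthant d)

namespace IsSmoothOp

theorem id : IsSmoothOp (d := d) id where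
  smooth h := h
  congr h := h
  add _ _ := fun _ _ => rfl
  smul _ _ _ := fun _ _ => rfl

theorem comp {D₁ D₂ : ((Fin d → ℝ) → ℂ) → ((Fin d → ℝ) → ℂ)} (h₁ : IsSmoothOp D₁)
    (h₂ : IsSmoothOp D₂) : IsSmoothOp (D₁ ∘ D₂) where
  smooth h := h₁.smooth (h₂.smooth h)
  congr h := h₁.congr (h₂.congr h)
  add hF hG := (h₁.congr (h₂.add hF hG)).trans (h₁.add (h₂.smooth hF) (h₂.smooth hG))
  smul c _ hF := (h₁.congr (h₂.smul c hF)).trans (h₁.smul c (h₂.smooth hF))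

theorem iterate {D : ((Fin d → ℝ) → ℂ) → ((Fin d → ℝ) → ℂ)} (h : IsSmoothOp D) (N : ℕ) :
    IsSmoothOp (D^[N]) := by
  induction N with
  | zero => exact id
  | succ N ih => rw [Function.iterate_succ]; exact ih.comp h

theorem pderiv (j : Fin d) : IsSmoothOp (pderiv j) where
  smooth {F} h := by
    have h1 : ContDiffOn ℝ ∞ (fderiv ℝ F) (openOrthant d) :=
      h.fderiv_of_isOpen isOpen_openOrthant (by simp)
    exact h1.clm_apply contDiffOn_const
  congr {F G} h x hx := by
    have : F =ᶠ[𝓝 x] G := h.eventuallyEq_of_mem (isOpen_openOrthant.mem_nhds hx)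
    simp only [Pilipovic.pderiv, this.fderiv_eq]
  add {F G} hF hG x hx := by
    have h1 : DifferentiableAt ℝ F x :=
      (hF.contDiffAt (isOpen_openOrthant.mem_nhds hx)).differentiableAt (by simp)
    have h2 : DifferentiableAt ℝ G x :=
      (hG.contDiffAt (isOpen_openOrthant.mem_nhds hx)).differentiableAt (by simp)
    simp only [Pilipovic.pderiv, Pi.add_apply, fderiv_add h1 h2]; rfl
  smul c F hF x hx := by
    have h1 : DifferentiableAt ℝ F x :=
      (hF.contDiffAt (isOpen_openOrthant.mem_nhds hx)).differentiableAt (by simp)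
    simp only [Pilipovic.pderiv, Pi.smul_apply, fderiv_const_smul h1]; rfl

theorem mulLeft (g : (Fin d → ℝ) → ℂ) (hg : ContDiff ℝ ∞ g) :
    IsSmoothOp (fun F y => g y * F y) where
  smooth h := hg.contDiffOn.mul h
  congr h x hx := by simp only [h hx]
  add _ _ x _ := by simp only [Pi.add_apply]; ring
  smul c _ _ x _ := by simp only [Pi.smul_apply, smul_eq_mul]; ring

theorem add' {D₁ D₂ : ((Fin d → ℝ) → ℂ) → ((Fin d → ℝ) → ℂ)} (h₁ : IsSmoothOp D₁)
    (h₂ : IsSmoothOp D₂) : IsSmoothOp (fun F x => D₁ F x + D₂ F x) where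
  smooth h := (h₁.smooth h).add (h₂.smooth h)
  congr h x hx := by simp only [h₁.congr h hx, h₂.congr h hx]
  add hF hG x hx := by
    simp only [h₁.add hF hG hx, h₂.add hF hG hx, Pi.add_apply]; ring
  smul c _ hF x hx := by
    simp only [h₁.smul c hF hx, h₂.smul c hF hx, Pi.smul_apply, smul_eq_mul]; ring

theorem sum {ι : Type*} (s : Finset ι) {D : ι → ((Fin d → ℝ) → ℂ) → ((Fin d → ℝ) → ℂ)}
    (h : ∀ i, IsSmoothOp (D i)) : IsSmoothOp (fun F x => ∑ i ∈ s, D i F x) where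
  smooth hF := ContDiffOn.sum fun i _ => (h i).smooth hF
  congr hF x hx := Finset.sum_congr rfl fun i _ => (h i).congr hF hx
  add hF hG x hx := by
    simp only [Pi.add_apply, ← Finset.sum_add_distrib]
    exact Finset.sum_congr rfl fun i _ => (h i).add hF hG hx
  smul c _ hF x hx := by
    simp only [Pi.smul_apply, smul_eq_mul, Finset.mul_sum]
    exact Finset.sum_congr rfl fun i _ => (h i).smul c hF hx

theorem multiDeriv (p : Fin d → ℕ) : IsSmoothOp (multiDeriv p) := by
  have : ∀ l : List (Fin d), IsSmoothOp fun F => l.foldr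
      (fun j G => (Pilipovic.pderiv j)^[p j] G) F := by
    intro l
    induction l with
    | nil => exact id
    | cons j l ih => exact ((pderiv j).iterate (p j)).comp ih
  exact this _

theorem laguerreOp : IsSmoothOp (d := d) laguerreOp := by
  have hc : ∀ j : Fin d, ContDiff ℝ ∞ fun y : Fin d → ℝ => (y j : ℂ) := fun j =>
    Complex.ofRealCLM.contDiff.comp (contDiff_apply ℝ ℝ j)
  have h1 : IsSmoothOp (d := d) fun F x => (-1 : ℂ) * ∑ j, ((Pilipovic.pderiv j
      (fun y => (y j : ℂ) * Pilipovic.pderiv j F y) x + (-(x j : ℂ) / 4) * F x) + 1 / 2 * F x) := by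
    refine (mulLeft (fun _ => -1) contDiff_const).comp (sum Finset.univ fun j => ?_)
    refine add' (add' ?_ (mulLeft _ ((hc j).neg.div_const 4))) (mulLeft _ contDiff_const)
    exact (pderiv j).comp ((mulLeft _ (hc j)).comp (pderiv j))
  convert h1 using 3 with F x
  rw [Pilipovic.laguerreOp, neg_one_mul]
  congr 1
  exact Finset.sum_congr rfl fun j _ => by ring

end IsSmoothOp

/-! ### Pilipović spaces on the orthant -/

variable (d) in
/-- The space `𝒮(ℝ^d_+)`. Its elements are represented by their continuous extensions to the
closed orthant. -/
def schwartzOrthant : Submodule ℂ C(closedOrthant d, ℂ) where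
  carrier := {f | SmoothOrthant (extendZero f) ∧
    (∀ p : Fin d → ℕ, ∃ g : C(closedOrthant d, ℂ), ∀ x : closedOrthant d, x.1 ∈ openOrthant d →
      g x = multiDeriv p (extendZero f) x) ∧
    ∀ p k : Fin d → ℕ, ∃ C : ℝ, ∀ x ∈ openOrthant d,
      (∏ i, x i ^ k i) * ‖multiDeriv p (extendZero f) x‖ ≤ C}
  zero_mem' := by
    have h0 : extendZero (d := d) ⇑(0 : C(closedOrthant d, ℂ)) = 0 := by
      have := extendZero_smul (d := d) 0 0
      simpa using this
    have hs : SmoothOrthant (d := d) 0 := contDiffOn_const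
    have h1 : ∀ p : Fin d → ℕ, ∀ x ∈ openOrthant d, multiDeriv p 0 x = 0 := fun p x hx => by
      have := (IsSmoothOp.multiDeriv p).smul 0 hs hx
      simpa using this
    rw [Set.mem_ofPred_eq, h0]
    exact ⟨hs, fun p => ⟨0, fun x hx => (h1 p _ hx).symm⟩, fun p k => ⟨0, fun x hx => by
      simp [h1 p x hx]⟩⟩
  add_mem' := by
    rintro f g ⟨hf, hf', hf''⟩ ⟨hg, hg', hg''⟩
    have h0 : extendZero ⇑(f + g) = extendZero f + extendZero g := extendZero_add f g
    rw [Set.mem_ofPred_eq, h0]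
    refine ⟨hf.add hg, fun p => ?_, fun p k => ?_⟩
    · obtain ⟨u, hu⟩ := hf' p
      obtain ⟨v, hv⟩ := hg' p
      refine ⟨u + v, fun x hx => ?_⟩
      rw [(IsSmoothOp.multiDeriv p).add hf hg hx, Pi.add_apply, ← hu x hx, ← hv x hx]; rfl
    · obtain ⟨A, hA⟩ := hf'' p k
      obtain ⟨B, hB⟩ := hg'' p k
      refine ⟨A + B, fun x hx => ?_⟩
      have hx0 : 0 ≤ ∏ i, x i ^ k i := Finset.prod_nonneg fun i _ => pow_nonneg (hx i).le _
      rw [(IsSmoothOp.multiDeriv p).add hf hg hx, Pi.add_apply]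
      exact (mul_le_mul_of_nonneg_left (norm_add_le _ _) hx0).trans
        (by rw [mul_add]; exact add_le_add (hA x hx) (hB x hx))
  smul_mem' := by
    rintro c f ⟨hf, hf', hf''⟩
    have h0 : extendZero ⇑(c • f) = c • extendZero f := extendZero_smul c f
    rw [Set.mem_ofPred_eq, h0]
    refine ⟨hf.const_smul c, fun p => ?_, fun p k => ?_⟩
    · obtain ⟨u, hu⟩ := hf' p
      refine ⟨c • u, fun x hx => ?_⟩
      rw [(IsSmoothOp.multiDeriv p).smul c hf hx, Pi.smul_apply, ← hu x hx]; rfl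
    · obtain ⟨A, hA⟩ := hf'' p k
      refine ⟨‖c‖ * A, fun x hx => ?_⟩
      rw [(IsSmoothOp.multiDeriv p).smul c hf hx, Pi.smul_apply, norm_smul, mul_left_comm]
      exact mul_le_mul_of_nonneg_left (hA x hx) (norm_nonneg c)

/-- `E^N f` on the open orthant. -/
def laguerrePow (N : ℕ) (f : C(closedOrthant d, ℂ)) : (Fin d → ℝ) → ℂ :=
  laguerreOp^[N] (extendZero f)

/-- The norm of `L²(ℝ^d_+)`. -/
def l2Norm (F : (Fin d → ℝ) → ℂ) : ℝ := (eLpNorm F 2 (volume.restrict (openOrthant d))).toReal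

theorem l2Norm_nonneg (F : (Fin d → ℝ) → ℂ) : 0 ≤ l2Norm F := ENNReal.toReal_nonneg

theorem laguerrePow_zero (N : ℕ) :
    laguerrePow N (0 : C(closedOrthant d, ℂ)) =ᵐ[volume.restrict (openOrthant d)] 0 := by
  have h0 : extendZero (d := d) ⇑(0 : C(closedOrthant d, ℂ)) = 0 := by
    have := extendZero_smul (d := d) 0 0
    simpa using this
  have hs : SmoothOrthant (d := d) 0 := contDiffOn_const
  refine ae_restrict_of_forall_mem isOpen_openOrthant.measurableSet fun x hx => ?_
  have := (IsSmoothOp.laguerreOp.iterate N).smul 0 hs hx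
  rw [laguerrePow, h0]
  simpa using this

theorem laguerrePow_add (N : ℕ) {f g : C(closedOrthant d, ℂ)} (hf : f ∈ schwartzOrthant d)
    (hg : g ∈ schwartzOrthant d) : laguerrePow N (f + g)
      =ᵐ[volume.restrict (openOrthant d)] laguerrePow N f + laguerrePow N g := by
  refine ae_restrict_of_forall_mem isOpen_openOrthant.measurableSet fun x hx => ?_
  have h0 : extendZero ⇑(f + g) = extendZero f + extendZero g := extendZero_add f g
  rw [laguerrePow, h0]
  exact (IsSmoothOp.laguerreOp.iterate N).add hf.1 hg.1 hx

theorem laguerrePow_smul (N : ℕ) (c : ℂ) {f : C(closedOrthant d, ℂ)}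
    (hf : f ∈ schwartzOrthant d) : laguerrePow N (c • f)
      =ᵐ[volume.restrict (openOrthant d)] c • laguerrePow N f := by
  refine ae_restrict_of_forall_mem isOpen_openOrthant.measurableSet fun x hx => ?_
  have h0 : extendZero ⇑(c • f) = c • extendZero f := extendZero_smul c f
  rw [laguerrePow, h0]
  exact (IsSmoothOp.laguerreOp.iterate N).smul c hf.1 hx

theorem l2Norm_laguerrePow_add (N : ℕ) {f g : C(closedOrthant d, ℂ)}
    (hf : f ∈ schwartzOrthant d) (hg : g ∈ schwartzOrthant d)
    (hf' : MemLp (laguerrePow N f) 2 (volume.restrict (openOrthant d)))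
    (hg' : MemLp (laguerrePow N g) 2 (volume.restrict (openOrthant d))) :
    l2Norm (laguerrePow N (f + g)) ≤ l2Norm (laguerrePow N f) + l2Norm (laguerrePow N g) := by
  rw [l2Norm, eLpNorm_congr_ae (laguerrePow_add N hf hg), l2Norm, l2Norm,
    ← ENNReal.toReal_add hf'.eLpNorm_ne_top hg'.eLpNorm_ne_top]
  exact ENNReal.toReal_mono (ENNReal.add_ne_top.2 ⟨hf'.eLpNorm_ne_top, hg'.eLpNorm_ne_top⟩)
    (eLpNorm_add_le hf'.1 hg'.1 (by norm_num))

theorem l2Norm_laguerrePow_smul (N : ℕ) (c : ℂ) {f : C(closedOrthant d, ℂ)}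
    (hf : f ∈ schwartzOrthant d) :
    l2Norm (laguerrePow N (c • f)) = ‖c‖ * l2Norm (laguerrePow N f) := by
  rw [l2Norm, eLpNorm_congr_ae (laguerrePow_smul N c hf), eLpNorm_const_smul, l2Norm,
    ENNReal.toReal_mul, toReal_enorm]

/-- The quantity `‖E^N f‖_{L²(ℝ^d_+)} / (h^N N!^α)`. -/
def etaTerm (α : ℝ) (h : PosReal) (f : C(closedOrthant d, ℂ)) (N : ℕ) : ℝ :=
  l2Norm (laguerrePow N f) / ((h : ℝ) ^ N * (N ! : ℝ) ^ α)

theorem etaDenom_pos (α : ℝ) (h : PosReal) (N : ℕ) : 0 < (h : ℝ) ^ N * (N ! : ℝ) ^ α :=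
  mul_pos (pow_pos h.2 N) (Real.rpow_pos_of_pos (by positivity) α)

variable (d) in
/-- The space of all `f ∈ 𝒮(ℝ^d_+)` with `sup_N ‖E^N f‖_{L²(ℝ^d_+)} / (h^N N!^α) < ∞`, the
supremum being over `N = 0, 1, 2, …`. -/
def pStepSubmodule (α : ℝ) (h : PosReal) : Submodule ℂ C(closedOrthant d, ℂ) where
  carrier := {f | f ∈ schwartzOrthant d ∧
    (∀ N, MemLp (laguerrePow N f) 2 (volume.restrict (openOrthant d))) ∧
    BddAbove (Set.range (etaTerm α h f))}
  zero_mem' := by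
    refine ⟨zero_mem _, fun N => (memLp_congr_ae (laguerrePow_zero N)).2 MemLp.zero', 0, ?_⟩
    rintro _ ⟨N, rfl⟩
    rw [etaTerm, l2Norm, eLpNorm_congr_ae (laguerrePow_zero N)]
    simp
  add_mem' := by
    rintro f g ⟨hf, hf', A, hA⟩ ⟨hg, hg', B, hB⟩
    refine ⟨add_mem hf hg, fun N => (memLp_congr_ae (laguerrePow_add N hf hg)).2
      ((hf' N).add (hg' N)), A + B, ?_⟩
    rintro _ ⟨N, rfl⟩
    refine le_trans ?_ (add_le_add (hA ⟨N, rfl⟩) (hB ⟨N, rfl⟩))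
    rw [etaTerm, etaTerm, etaTerm, ← add_div]
    exact div_le_div_of_nonneg_right (l2Norm_laguerrePow_add N hf hg (hf' N) (hg' N))
      (etaDenom_pos α h N).le
  smul_mem' := by
    rintro c f ⟨hf, hf', A, hA⟩
    refine ⟨Submodule.smul_mem _ c hf, fun N => (memLp_congr_ae (laguerrePow_smul N c hf)).2
      ((hf' N).const_smul c), ‖c‖ * A, ?_⟩
    rintro _ ⟨N, rfl⟩
    rw [etaTerm, l2Norm_laguerrePow_smul N c hf, mul_div_assoc]
    exact mul_le_mul_of_nonneg_left (hA ⟨N, rfl⟩) (norm_nonneg c)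

variable (d) in
/-- The normed space `𝐆^{α,h}_{α,h}(ℝ^d_+)` with norm `sup_N ‖E^N f‖_{L²(ℝ^d_+)} / (h^N N!^α)`. -/
def PStep (α : ℝ) (h : PosReal) : Type := ↥(pStepSubmodule d α h)

instance (α : ℝ) (h : PosReal) : AddCommGroup (PStep d α h) :=
  inferInstanceAs (AddCommGroup ↥(pStepSubmodule d α h))

instance (α : ℝ) (h : PosReal) : Module ℂ (PStep d α h) :=
  inferInstanceAs (Module ℂ ↥(pStepSubmodule d α h))

instance (α : ℝ) (h : PosReal) : Norm (PStep d α h) := ⟨fun f => ⨆ N, etaTerm α h f.1 N⟩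

theorem PStep.norm_def {α : ℝ} {h : PosReal} (f : PStep d α h) :
    ‖f‖ = ⨆ N, etaTerm α h f.1 N := rfl

theorem PStep.core (α : ℝ) (h : PosReal) : NormedSpace.Core ℂ (PStep d α h) where
  norm_nonneg f := Real.iSup_nonneg fun N => div_nonneg (l2Norm_nonneg _) (etaDenom_pos α h N).le
  norm_smul c f := by
    rw [PStep.norm_def, PStep.norm_def, Real.mul_iSup_of_nonneg (norm_nonneg c)]
    congr 1; funext N
    rw [etaTerm, etaTerm, ← mul_div_assoc, ← l2Norm_laguerrePow_smul N c f.2.1]; rfl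
  norm_triangle f g := by
    refine ciSup_le fun N => ?_
    refine le_trans ?_ (add_le_add (le_ciSup f.2.2.2 N) (le_ciSup g.2.2.2 N))
    rw [etaTerm, etaTerm, etaTerm, ← add_div]
    exact div_le_div_of_nonneg_right
      (l2Norm_laguerrePow_add N f.2.1 g.2.1 (f.2.2.1 N) (g.2.2.1 N)) (etaDenom_pos α h N).le
  norm_eq_zero_iff f := by
    constructor
    · intro h0
      have h1 : etaTerm α h f.1 0 ≤ ‖f‖ := le_ciSup f.2.2.2 0
      rw [h0, etaTerm] at h1
      simp only [pow_zero, Nat.factorial_zero, Nat.cast_one, Real.one_rpow, mul_one, div_one] at h1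
      have h2 : eLpNorm (laguerrePow 0 f.1) 2 (volume.restrict (openOrthant d)) = 0 := by
        have := le_antisymm h1 (l2Norm_nonneg _)
        rw [l2Norm, ENNReal.toReal_eq_zero_iff] at this
        exact this.resolve_right (f.2.2.1 0).eLpNorm_ne_top
      rw [eLpNorm_eq_zero_iff (f.2.2.1 0).1 (by norm_num)] at h2
      have h3 : Set.EqOn (extendZero f.1) 0 (openOrthant d) :=
        Measure.eqOn_of_ae_eq h2 f.2.1.1.continuousOn continuousOn_const
          (by rw [isOpen_openOrthant.interior_eq]; exact subset_closure)
      refine Subtype.ext (ContinuousMap.ext fun x => ?_)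
      have h4 := Continuous.ext_on dense_openOrthant_subtype f.1.continuous
        (continuous_const (y := (0 : ℂ))) fun y hy => by
          rw [← extendZero_apply f.1 y]; exact h3 hy
      exact congrFun h4 x
    · rintro rfl
      rw [PStep.norm_def]
      have : ∀ N, etaTerm α h (0 : PStep d α h).1 N = 0 := fun N => by
        change etaTerm α h (0 : C(closedOrthant d, ℂ)) N = 0
        rw [etaTerm, l2Norm, eLpNorm_congr_ae (laguerrePow_zero N)]
        simp
      simp [this]

instance (α : ℝ) (h : PosReal) : NormedAddCommGroup (PStep d α h) :=
  NormedAddCommGroup.ofCore (PStep.core α h)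

instance (α : ℝ) (h : PosReal) : NormedSpace ℂ (PStep d α h) :=
  NormedSpace.ofCore (PStep.core α h)

theorem pStepSubmodule_mono (α : ℝ) {h k : PosReal} (hk : h ≤ k) :
    pStepSubmodule d α h ≤ pStepSubmodule d α k := by
  rintro f ⟨hf, hf', A, hA⟩
  refine ⟨hf, hf', A, ?_⟩
  rintro _ ⟨N, rfl⟩
  refine le_trans ?_ (hA ⟨N, rfl⟩)
  have hk' : (h : ℝ) ≤ k := hk
  have := h.2
  exact div_le_div_of_nonneg_left (l2Norm_nonneg _) (etaDenom_pos α h N) (by gcongr)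

variable (d) in
/-- `𝐆^α_α(ℝ^d_+)`, the union of the spaces `𝐆^{α,h}_{α,h}(ℝ^d_+)` over `h > 0`, as a space of
functions. -/
def pSubmodule (α : ℝ) : Submodule ℂ C(closedOrthant d, ℂ) where
  carrier := {f | ∃ h : PosReal, f ∈ pStepSubmodule d α h}
  zero_mem' := ⟨⟨1, one_pos⟩, zero_mem _⟩
  add_mem' := by
    rintro f g ⟨h, hf⟩ ⟨k, hg⟩
    exact ⟨max h k, add_mem (pStepSubmodule_mono α (le_max_left _ _) hf)
      (pStepSubmodule_mono α (le_max_right _ _) hg)⟩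
  smul_mem' := fun c _ ⟨h, hf⟩ => ⟨h, Submodule.smul_mem _ c hf⟩

variable (d) in
/-- The space `𝐆^α_α(ℝ^d_+)`. -/
def PSpace (α : ℝ) : Type := ↥(pSubmodule d α)

instance (α : ℝ) : AddCommGroup (PSpace d α) := inferInstanceAs (AddCommGroup ↥(pSubmodule d α))

instance (α : ℝ) : Module ℂ (PSpace d α) := inferInstanceAs (Module ℂ ↥(pSubmodule d α))

instance (α : ℝ) : CoeFun (PSpace d α) fun _ => closedOrthant d → ℂ := ⟨fun f => f.1⟩

variable (d) in
/-- The inclusion `𝐆^{α,h}_{α,h}(ℝ^d_+) → 𝐆^α_α(ℝ^d_+)`. -/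
def PStep.incl (α : ℝ) (h : PosReal) : PStep d α h →ₗ[ℂ] PSpace d α :=
  Submodule.inclusion (p := pStepSubmodule d α h) (p' := pSubmodule d α) fun _ hf => ⟨h, hf⟩

/-- `𝐆^α_α(ℝ^d_+)` carries the locally convex inductive limit topology. -/
instance (α : ℝ) : TopologicalSpace (PSpace d α) := indLimTopology (PStep.incl d α)

/-- `v(x) = (x_1², …, x_d²)`. -/
def vMap (x : Fin d → ℝ) : closedOrthant d := ⟨fun i => x i ^ 2, fun i => sq_nonneg (x i)⟩

/-- `w(x) = (√x_1, …, √x_d)`. -/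
def wMap (x : closedOrthant d) : closedOrthant d :=
  ⟨fun i => Real.sqrt (x.1 i), fun i => Real.sqrt_nonneg (x.1 i)⟩

end Orthant

end
end Pilipovic

namespace Pilipovic
noncomputable section
open Filter Topology MeasureTheory
open scoped ContDiff Nat

/-! Both spaces are described by coefficients, and the two descriptions are linked by an explicit
change of basis between Laguerre and even Hermite functions.

The Laguerre functions `lagFun 0 n`, products of `L_{n_i}(x_i) e^{-x_i/2}`, form a complete
orthonormal system on the orthant, and `E` acts on them by multiplication with `|n|`. Green's
identity, whose boundary terms vanish because of the factor `x_j` in `E`, moves `E^N` from `f` to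
`lagFun 0 n`. Cauchy–Schwarz then gives `|a_n| |n|^N ≤ ‖E^N f‖` for the Laguerre coefficients `a_n`
of `f` (`norm_lagCoef_mul_le`). If the right-hand side is at most `C h^N N!^α` for all `N`, then
`|a_n|` is bounded by a constant times `exp(-c |n|^{1/α})` (`le_exp_of_mul_pow_le`), which is the
weight of `ℓ_{α/2}`. Conversely, a series with such coefficients may be differentiated termwise,
lies in the Schwartz space, and satisfies the bounds on `E^N` (`lagCont_mem_pStepSubmodule`).
Completeness (`eqOn_zero_of_integral_lagFun_eq_zero`) identifies `f` with its Laguerre series. It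
comes from the generating function: a function orthogonal to all Laguerre functions is, up to the
factor `e^{-Σ x_i/2}`, orthogonal to all `e^{-k·x}`, and these span an algebra that separates
points.

Up to normalization, `h_{2n}(t)` is the Laguerre function of parameter `-1/2` at `t²`, while the
Laguerre functions above have parameter `0`. The generating functions differ by the factor
`(1-z)^{1/2}`, so each family is a finite triangular combination of the other
(`lagD_sq_eq_sum_hermite`, `hermiteFun₁_two_mul_eq_sum`), with coefficients that are Taylor
coefficients of `(1-z)^{∓1/2}` times normalizing factors of at most linear growth. On coefficient
sequences this becomes `b_m = ∑_k a_{m+k} A(m,k)`, which preserves decay of type `exp(-h |n|^{1/α})`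
up to a smaller `h`, because `|m+k|` dominates both `|m|` and `|k|`. Substitution into the series
(`tsum_upperSum_mul`) gives `f ∘ v = ∑ b_m h_{2m}`, and likewise in the other direction.

Each of these maps sends a step of one inductive limit boundedly into a step of the other, hence is
continuous (`continuous_indLimTopology`). Uniqueness of Hermite coefficients is not needed: a
sequence whose Hermite series vanishes is sent to `0` by `fromHermite`, so the inverse map descends
to functions. -/

/-! ### Laguerre polynomials and Laguerre functions of one variable -/

open Polynomial in
/-- The Laguerre polynomials. -/
def lagPoly (n : ℕ) : ℝ[X] :=
  ∑ k ∈ Finset.range (n + 1), monomial k ((-1) ^ k * (n.choose k : ℝ) / k !)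

theorem coeff_lagPoly (n k : ℕ) :
    (lagPoly n).coeff k = (-1) ^ k * (n.choose k : ℝ) / k ! := by
  simp only [lagPoly, Polynomial.finsetSum_coeff, Polynomial.coeff_monomial,
    Finset.sum_ite_eq', Finset.mem_range]
  split_ifs with h
  · rfl
  · rw [Nat.choose_eq_zero_of_lt (by omega)]; simp

theorem lagPoly_zero : lagPoly 0 = 1 := by
  simp [lagPoly]

theorem derivative_lagPoly_succ (n : ℕ) :
    (lagPoly (n + 1)).derivative = (lagPoly n).derivative - lagPoly n := by
  ext k
  rw [Polynomial.coeff_sub, Polynomial.coeff_derivative, Polynomial.coeff_derivative,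
    coeff_lagPoly, coeff_lagPoly, coeff_lagPoly, Nat.choose_succ_succ, Nat.factorial_succ]
  push_cast
  field_simp
  ring

theorem X_mul_derivative_lagPoly_succ (n : ℕ) :
    Polynomial.X * (lagPoly (n + 1)).derivative =
      Polynomial.C ((n : ℝ) + 1) * (lagPoly (n + 1) - lagPoly n) := by
  ext k
  rw [Polynomial.coeff_C_mul, Polynomial.coeff_sub, coeff_lagPoly, coeff_lagPoly]
  cases k with
  | zero => simp
  | succ k =>
    rw [Polynomial.coeff_X_mul, Polynomial.coeff_derivative, coeff_lagPoly]
    have h := Nat.add_one_mul_choose_eq n k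
    have h2 := Nat.choose_succ_succ n k
    have h' : ((n : ℝ) + 1) * (n.choose k) = ((n + 1).choose (k + 1)) * (k + 1) := by
      exact_mod_cast h
    have h2' : ((n + 1).choose (k + 1) : ℝ) = n.choose k + n.choose (k + 1) := by
      exact_mod_cast h2
    have e : ((n + 1).choose (k + 1) : ℝ) - n.choose (k + 1) = n.choose k := by
      rw [h2']; ring
    calc _ = (-1) ^ (k + 1) / (k + 1)! * (((n + 1).choose (k + 1)) * ((k : ℝ) + 1)) := by ring
      _ = (-1) ^ (k + 1) / (k + 1)! * (((n : ℝ) + 1) *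
          (((n + 1).choose (k + 1) : ℝ) - n.choose (k + 1))) := by rw [← h', e]
      _ = _ := by ring

/-- Differentiation stays in the span of the Laguerre polynomials of lower degree. This is what
makes the recursive form of `lagD` possible, and it reduces all estimates of derivatives to
estimates of order zero. -/
theorem derivative_lagPoly (n : ℕ) :
    (lagPoly n).derivative = -∑ i ∈ Finset.range n, lagPoly i := by
  induction n with
  | zero => simp [lagPoly_zero]
  | succ n ih => rw [derivative_lagPoly_succ, ih, Finset.sum_range_succ]; ring

theorem lagPoly_three_term (n : ℕ) :
    Polynomial.C ((n : ℝ) + 2) * lagPoly (n + 2) =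
      (Polynomial.C (2 * (n : ℝ) + 3) - Polynomial.X) * lagPoly (n + 1)
        - Polynomial.C ((n : ℝ) + 1) * lagPoly n := by
  have h1 := X_mul_derivative_lagPoly_succ n
  have h2 := X_mul_derivative_lagPoly_succ (n + 1)
  rw [derivative_lagPoly_succ (n + 1), mul_sub, h1] at h2
  have e1 : Polynomial.C (((n + 1 : ℕ) : ℝ) + 1) = Polynomial.C ((n : ℝ) + 2) := by
    congr 1; push_cast; ring
  have e2 : Polynomial.C (2 * (n : ℝ) + 3) =
      Polynomial.C ((n : ℝ) + 1) + Polynomial.C ((n : ℝ) + 2) := by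
    rw [← Polynomial.C_add]; congr 1; ring
  rw [e1] at h2
  rw [e2]
  linear_combination -h2

/-- Differentiate the relation for `X L'_{n+1}` and remove `L'_n` with `derivative_lagPoly_succ`. -/
theorem lagPoly_ode (n : ℕ) :
    Polynomial.X * (lagPoly n).derivative.derivative + (lagPoly n).derivative =
      Polynomial.X * (lagPoly n).derivative - Polynomial.C (n : ℝ) * lagPoly n := by
  cases n with
  | zero => simp [lagPoly_zero]
  | succ n =>
    have h1 := X_mul_derivative_lagPoly_succ n
    have h2 := congrArg Polynomial.derivative h1
    rw [Polynomial.derivative_mul, Polynomial.derivative_X, Polynomial.derivative_C_mul,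
      Polynomial.derivative_sub, derivative_lagPoly_succ n] at h2
    have h3 := derivative_lagPoly_succ n
    push_cast
    rw [← h3] at h2
    linear_combination h2 - h1 + Polynomial.C ((n : ℝ) + 1) * h3

/-- The Laguerre functions `L_n(x) e^{-x/2}` and their derivatives: `lagD p n` is the `p`-th
derivative of the `n`-th function. -/
def lagD : ℕ → ℕ → ℝ → ℝ
  | 0, n, x => (lagPoly n).eval x * Real.exp (-x / 2)
  | p + 1, n, x => -lagD p n x / 2 - ∑ i ∈ Finset.range n, lagD p i x

theorem hasDerivAt_exp_neg_half (x : ℝ) :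
    HasDerivAt (fun x : ℝ => Real.exp (-x / 2)) (-Real.exp (-x / 2) / 2) x := by
  refine ((hasDerivAt_id x).neg.div_const 2).exp.congr_deriv ?_
  simp only [Pi.neg_apply, id]; ring

theorem hasDerivAt_lagD (p : ℕ) : ∀ (n : ℕ) (x : ℝ), HasDerivAt (lagD p n) (lagD (p + 1) n x) x := by
  induction p with
  | zero =>
    intro n x
    refine (((lagPoly n).hasDerivAt x).mul (hasDerivAt_exp_neg_half x)).congr_deriv ?_
    rw [derivative_lagPoly, Polynomial.eval_neg, Polynomial.eval_finsetSum]
    simp only [lagD, ← Finset.sum_mul]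
    ring
  | succ p ih =>
    intro n x
    exact ((ih n x).neg.div_const 2).sub (HasDerivAt.fun_sum fun i _ => ih i x)

theorem lagD_one (n : ℕ) (x : ℝ) : lagD 1 n x =
    ((lagPoly n).derivative.eval x - (lagPoly n).eval x / 2) * Real.exp (-x / 2) := by
  refine (hasDerivAt_lagD 0 n x).unique ?_
  refine (((lagPoly n).hasDerivAt x).mul (hasDerivAt_exp_neg_half x)).congr_deriv ?_
  ring

theorem lagD_two (n : ℕ) (x : ℝ) : lagD 2 n x =
    ((lagPoly n).derivative.derivative.eval x - (lagPoly n).derivative.eval x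
      + (lagPoly n).eval x / 4) * Real.exp (-x / 2) := by
  have h := hasDerivAt_lagD 1 n x
  rw [show lagD 1 n = fun x => ((lagPoly n).derivative.eval x - (lagPoly n).eval x / 2) *
    Real.exp (-x / 2) from funext (lagD_one n)] at h
  refine h.unique (((((lagPoly n).derivative.hasDerivAt x).sub
    (((lagPoly n).hasDerivAt x).div_const 2)).mul (hasDerivAt_exp_neg_half x)).congr_deriv ?_)
  simp only [Pi.sub_apply]
  ring

/-- This is the eigenvalue equation for the one-dimensional Laguerre operator, with eigenvalue `n`.
-/
theorem lagD_ode (n : ℕ) (x : ℝ) :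
    x * lagD 2 n x + lagD 1 n x = (x / 4 - 1 / 2 - n) * lagD 0 n x := by
  have h := congrArg (Polynomial.eval x) (lagPoly_ode n)
  simp only [Polynomial.eval_add, Polynomial.eval_mul, Polynomial.eval_X, Polynomial.eval_sub,
    Polynomial.eval_C] at h
  rw [lagD_one, lagD_two, lagD]
  linear_combination Real.exp (-x / 2) * h

theorem lagD_three_term (n : ℕ) (x : ℝ) :
    (n + 2) * lagD 0 (n + 2) x = (2 * n + 3 - x) * lagD 0 (n + 1) x - (n + 1) * lagD 0 n x := by
  have h := congrArg (Polynomial.eval x) (lagPoly_three_term n)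
  simp only [Polynomial.eval_mul, Polynomial.eval_X, Polynomial.eval_sub,
    Polynomial.eval_C] at h
  simp only [lagD]
  linear_combination Real.exp (-x / 2) * h

theorem lagD_zero_zero (x : ℝ) : lagD 0 0 x = Real.exp (-x / 2) := by
  simp [lagD, lagPoly_zero]

theorem lagD_zero_one (x : ℝ) : lagD 0 1 x = (1 - x) * lagD 0 0 x := by
  simp [lagD, lagPoly, Finset.sum_range_succ]; ring

/-! ### Bounds for the Laguerre functions and their generating function -/

theorem tendsto_polynomial_mul_exp_neg (p : Polynomial ℝ) :
    Tendsto (fun x => p.eval x * Real.exp (-x)) atTop (𝓝 0) := by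
  refine p.tendsto_div_exp_atTop.congr fun x => ?_
  rw [Real.exp_neg, div_eq_mul_inv]

theorem eval_lagPoly_zero (n : ℕ) : (lagPoly n).eval 0 = 1 := by
  rw [← Polynomial.coeff_zero_eq_eval_zero, coeff_lagPoly]; simp

/-- An energy argument. Write `ℓ` for the function. By the differential equation, `F = x ℓ'² + (n +
1/2 - x/4) ℓ²` has derivative `-ℓ'² - ℓ²/4`, so `F ≤ F 0 = n + 1/2` for `x ≥ 0`. The function `G =
2F - ℓ²` has derivative `-(2ℓ' + ℓ)²/2` and, being a polynomial times `e^{-x}`, tends to `0` at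
infinity; hence `G ≥ 0` and `ℓ² ≤ 2F ≤ 2n + 1`. The bound is not sharp, but polynomial growth in `n`
is enough. -/
theorem lagD_zero_sq_le (n : ℕ) {x : ℝ} (hx : 0 ≤ x) : lagD 0 n x ^ 2 ≤ 2 * n + 1 := by
  set F : ℝ → ℝ := fun x => x * lagD 1 n x ^ 2 + (n + 1 / 2 - x / 4) * lagD 0 n x ^ 2 with hF
  set G : ℝ → ℝ := fun x => 2 * F x - lagD 0 n x ^ 2 with hG
  have dF : ∀ x, HasDerivAt F (-lagD 1 n x ^ 2 - lagD 0 n x ^ 2 / 4) x := by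
    intro x
    have h0 := hasDerivAt_lagD 0 n x
    have h1 := hasDerivAt_lagD 1 n x
    refine (((hasDerivAt_id x).mul (h1.pow 2)).add
      ((((hasDerivAt_id x).div_const 4).const_sub ((n : ℝ) + 1 / 2)).mul (h0.pow 2))).congr_deriv ?_
    have h := lagD_ode n x
    simp only [id, Pi.pow_apply, zero_add]
    norm_num
    linear_combination 2 * lagD 1 n x * h
  have dG : ∀ x, HasDerivAt G (-2 * lagD 1 n x ^ 2 - lagD 0 n x ^ 2 / 2
      - 2 * lagD 0 n x * lagD 1 n x) x := by
    intro x
    refine (((dF x).const_mul 2).sub ((hasDerivAt_lagD 0 n x).pow 2)).congr_deriv ?_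
    norm_num; ring
  have aF : Antitone F := antitone_of_deriv_nonpos (fun x => (dF x).differentiableAt) fun x => by
    rw [(dF x).deriv]; nlinarith [sq_nonneg (lagD 1 n x), sq_nonneg (lagD 0 n x)]
  have aG : Antitone G := antitone_of_deriv_nonpos (fun x => (dG x).differentiableAt) fun x => by
    rw [(dG x).deriv]; nlinarith [sq_nonneg (2 * lagD 1 n x + lagD 0 n x)]
  have tG : Tendsto G atTop (𝓝 0) := by
    refine (tendsto_polynomial_mul_exp_neg (2 * (Polynomial.X * ((lagPoly n).derivative
      - Polynomial.C (1 / 2) * lagPoly n) ^ 2 + (Polynomial.C ((n : ℝ) + 1 / 2)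
      - Polynomial.C (1 / 4) * Polynomial.X) * lagPoly n ^ 2) - lagPoly n ^ 2)).congr fun x => ?_
    have e : Real.exp (-x) = Real.exp (-x / 2) ^ 2 := by
      rw [← Real.exp_nat_mul]; congr 1; push_cast; ring
    have e0 : lagD 0 n x = (lagPoly n).eval x * Real.exp (-x / 2) := rfl
    simp only [hG, hF, lagD_one, e0, e, Polynomial.eval_sub, Polynomial.eval_mul,
      Polynomial.eval_add, Polynomial.eval_pow, Polynomial.eval_X, Polynomial.eval_C,
      Polynomial.eval_ofNat]
    ring
  have h1 : 0 ≤ G x := aG.le_of_tendsto tG x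
  have h2 : F x ≤ F 0 := aF hx
  have h3 : F 0 = n + 1 / 2 := by
    simp [hF, lagD, eval_lagPoly_zero]
  simp only [hG] at h1
  linarith

theorem abs_lagD_zero_le (n : ℕ) {x : ℝ} (hx : 0 ≤ x) : |lagD 0 n x| ≤ 2 * (1 + n) := by
  refine abs_le_of_sq_le_sq ?_ (by positivity)
  have := lagD_zero_sq_le n hx
  nlinarith [(Nat.cast_nonneg n : (0 : ℝ) ≤ n)]

/-- By the three-term recurrence, multiplication by `1 + x` produces the neighbours `n - 1`, `n`, `n
+ 1` with coefficients linear in `n`. Each power of `1 + x` therefore costs one power of `1 + n`. -/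
theorem exists_bound_lagD_zero (k : ℕ) : ∃ C : ℝ, 0 ≤ C ∧ ∃ m : ℕ, ∀ (n : ℕ) (x : ℝ), 0 ≤ x →
    (1 + x) ^ k * |lagD 0 n x| ≤ C * (1 + n) ^ m := by
  induction k with
  | zero => exact ⟨2, by norm_num, 1, fun n x hx => by simpa using abs_lagD_zero_le n hx⟩
  | succ k ih =>
    obtain ⟨C, hC, m, h⟩ := ih
    refine ⟨2 ^ m * 6 * C, by positivity, m + 1, fun n x hx => ?_⟩
    have h1 : (1 + x) * |lagD 0 n x| ≤ (1 + n) * |lagD 0 (n + 1) x| + (2 * n + 2) * |lagD 0 n x|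
        + n * |lagD 0 (n - 1) x| := by
      -- For `n = 0` the truncated index `n - 1` is harmless, since its coefficient is `n = 0`.
      have e : (1 + x) * lagD 0 n x = -((1 + n) * lagD 0 (n + 1) x) + (2 * n + 2) * lagD 0 n x
        - n * lagD 0 (n - 1) x := by
        cases n with
        | zero => simp [lagD_zero_one]; ring
        | succ n =>
          have := lagD_three_term n x
          simp only [Nat.add_sub_cancel]; push_cast
          rw [show n + 1 + 1 = n + 2 from rfl]
          linear_combination this
      have e' : (1 + x) * |lagD 0 n x| = |(1 + x) * lagD 0 n x| := by
        rw [abs_mul, abs_of_nonneg (by linarith : 0 ≤ 1 + x)]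
      rw [e', e]
      refine (abs_sub _ _).trans (add_le_add ((abs_add_le _ _).trans (add_le_add ?_ ?_)) ?_)
      · rw [abs_neg, abs_mul, abs_of_nonneg (by positivity : (0 : ℝ) ≤ 1 + n)]
      · rw [abs_mul, abs_of_nonneg (by positivity : (0 : ℝ) ≤ 2 * n + 2)]
      · rw [abs_mul, abs_of_nonneg (by positivity : (0 : ℝ) ≤ n)]
    -- The index `n + 1` gives `1 + j ≤ 2 (1 + n)`, whence the factor `2 ^ m`.
    have b : ∀ j : ℕ, j ≤ n + 1 → (1 + x) ^ k * |lagD 0 j x| ≤ C * (2 ^ m * (1 + n) ^ m) := by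
      intro j hj
      refine (h j x hx).trans ?_
      rw [← mul_pow]
      have : (j : ℝ) ≤ n + 1 := by exact_mod_cast hj
      gcongr
      linarith [(Nat.cast_nonneg n : (0 : ℝ) ≤ n)]
    set Q := C * (2 ^ m * (1 + (n : ℝ)) ^ m)
    have hQ : 0 ≤ Q := by positivity
    calc (1 + x) ^ (k + 1) * |lagD 0 n x| = (1 + x) ^ k * ((1 + x) * |lagD 0 n x|) := by ring
      _ ≤ (1 + x) ^ k * ((1 + n) * |lagD 0 (n + 1) x| + (2 * n + 2) * |lagD 0 n x|
        + n * |lagD 0 (n - 1) x|) := by gcongr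
      _ = (1 + n) * ((1 + x) ^ k * |lagD 0 (n + 1) x|) + (2 * n + 2) *
        ((1 + x) ^ k * |lagD 0 n x|) + n * ((1 + x) ^ k * |lagD 0 (n - 1) x|) := by ring
      _ ≤ (1 + n) * Q + (2 * n + 2) * Q + n * Q := by
        gcongr <;> exact b _ (by omega)
      _ ≤ 6 * (1 + n) * Q := by nlinarith [(Nat.cast_nonneg n : (0 : ℝ) ≤ n)]
      _ = _ := by simp only [Q]; ring

/-- A derivative replaces `lagD p n` by a sum over the indices up to `n`, which costs one more power
of `1 + n`. -/
theorem exists_bound_lagD (k p : ℕ) : ∃ C : ℝ, 0 ≤ C ∧ ∃ m : ℕ, ∀ (n : ℕ) (x : ℝ), 0 ≤ x →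
    (1 + x) ^ k * |lagD p n x| ≤ C * (1 + n) ^ m := by
  induction p with
  | zero => exact exists_bound_lagD_zero k
  | succ p ih =>
    obtain ⟨C, hC, m, h⟩ := ih
    refine ⟨C, by positivity, m + 1, fun n x hx => ?_⟩
    have h1 : |lagD (p + 1) n x| ≤ |lagD p n x| / 2 + ∑ i ∈ Finset.range n, |lagD p i x| := by
      rw [lagD]
      refine (abs_sub _ _).trans (add_le_add ?_ (Finset.abs_sum_le_sum_abs _ _))
      rw [abs_div, abs_neg]; simp
    have b : ∀ i ∈ Finset.range n, (1 + x) ^ k * |lagD p i x| ≤ C * (1 + n) ^ m := by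
      intro i hi
      refine (h i x hx).trans ?_
      have : (i : ℝ) ≤ n := by exact_mod_cast (Finset.mem_range.1 hi).le
      gcongr
    calc (1 + x) ^ k * |lagD (p + 1) n x|
        ≤ (1 + x) ^ k * (|lagD p n x| / 2 + ∑ i ∈ Finset.range n, |lagD p i x|) := by gcongr
      _ = (1 + x) ^ k * |lagD p n x| / 2 + ∑ i ∈ Finset.range n, (1 + x) ^ k * |lagD p i x| := by
        rw [mul_add, Finset.mul_sum]; ring
      _ ≤ C * (1 + n) ^ m / 2 + ∑ i ∈ Finset.range n, C * (1 + n) ^ m := by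
        exact add_le_add (div_le_div_of_nonneg_right (h n x hx) (by norm_num))
          (Finset.sum_le_sum b)
      _ = C * (1 + n) ^ m * (1 / 2 + n) := by
        rw [Finset.sum_const, Finset.card_range, nsmul_eq_mul]; ring
      _ ≤ C * (1 + n) ^ m * (1 + n) := by gcongr; norm_num
      _ = _ := by ring

/-- Evaluate the double series of `C(n,k) t^n (-x)^k / k!` in both orders: over `n` it gives `t^k /
(1-t)^{k+1}` and then an exponential series in `k`, over `k` it gives `t^n L_n(x)`. As `t ≥ 0`,
absolute convergence is the same computation with `|x|`. The formula writes exponentials as Laguerre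
series, which is the source of completeness. -/
theorem hasSum_lagD_generating (x : ℝ) {t : ℝ} (ht0 : 0 ≤ t) (ht : t < 1) :
    HasSum (fun n => t ^ n * lagD 0 n x)
      ((1 - t)⁻¹ * Real.exp (-x * (t / (1 - t))) * Real.exp (-x / 2)) := by
  have h1t : 0 < 1 - t := by linarith
  have hc : ∀ k : ℕ, HasSum (fun n : ℕ => (n.choose k : ℝ) * t ^ n) (t ^ k / (1 - t) ^ (k + 1)) := by
    intro k
    have h := hasSum_choose_mul_geometric_of_norm_lt_one k (𝕜 := ℝ) (r := t)
      (by rw [Real.norm_eq_abs, abs_lt]; constructor <;> linarith)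
    rw [← hasSum_nat_add_iff' k]
    have h0 : ∑ i ∈ Finset.range k, (i.choose k : ℝ) * t ^ i = 0 :=
      Finset.sum_eq_zero fun i hi => by
        rw [Nat.choose_eq_zero_of_lt (Finset.mem_range.1 hi)]; simp
    rw [h0, sub_zero]
    convert! h.mul_left (t ^ k) using 1
    · funext n; rw [pow_add]; ring
    · rw [mul_one_div]
  set f : ℕ × ℕ → ℝ := fun q => (q.2.choose q.1 : ℝ) * t ^ q.2 * ((-x) ^ q.1 / q.1 !) with hf
  have hrow : ∀ y : ℝ, ∀ k : ℕ, HasSum (fun n : ℕ => (n.choose k : ℝ) * t ^ n * (y ^ k / k !))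
      ((1 - t)⁻¹ * ((y * (t / (1 - t))) ^ k / k !)) := by
    intro y k
    convert! (hc k).mul_right (y ^ k / k !) using 1
    rw [mul_pow, div_pow, pow_succ]
    field_simp
  have hexp : ∀ y : ℝ, HasSum (fun k : ℕ => (1 - t)⁻¹ * ((y * (t / (1 - t))) ^ k / k !))
      ((1 - t)⁻¹ * Real.exp (y * (t / (1 - t)))) := fun y => by
    have := NormedSpace.expSeries_div_hasSum_exp (y * (t / (1 - t)))
    rw [← Real.exp_eq_exp_ℝ] at this
    exact this.mul_left _
  have hs : Summable f := by
    rw [← summable_norm_iff]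
    have e : ∀ q : ℕ × ℕ, ‖f q‖ = (q.2.choose q.1 : ℝ) * t ^ q.2 * (|x| ^ q.1 / q.1 !) := by
      intro q
      simp only [hf, norm_mul, norm_div, norm_pow, Real.norm_eq_abs, abs_neg, Nat.abs_cast,
        abs_of_nonneg ht0]
    refine (summable_prod_of_nonneg fun q => norm_nonneg _).2 ⟨fun k => ?_, ?_⟩
    · simp only [e]; exact (hrow |x| k).summable
    · simp only [e]
      refine (hexp |x|).summable.congr fun k => ?_
      rw [(hrow |x| k).tsum_eq]
  have h1 : HasSum f ((1 - t)⁻¹ * Real.exp (-x * (t / (1 - t)))) := by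
    have := hs.hasSum.prod_fiberwise fun k => hrow (-x) k
    rw [← this.unique (hexp (-x))]
    exact hs.hasSum
  have h2 := ((Equiv.prodComm ℕ ℕ).hasSum_iff (f := f)).2 h1
  have h3 := h2.prod_fiberwise (g := fun n => t ^ n * (lagPoly n).eval x) fun n => by
    have h : HasSum (fun k => (f ∘ ⇑(Equiv.prodComm ℕ ℕ)) (n, k))
        (∑ k ∈ Finset.range (n + 1), (f ∘ ⇑(Equiv.prodComm ℕ ℕ)) (n, k)) :=
      hasSum_sum_of_ne_finset_zero fun k hk => by
        have hk' : n < k := by simpa using hk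
        simp only [hf, Function.comp, Equiv.prodComm_apply, Prod.swap]
        rw [Nat.choose_eq_zero_of_lt hk']; simp
    have e : ∑ k ∈ Finset.range (n + 1), (f ∘ ⇑(Equiv.prodComm ℕ ℕ)) (n, k) =
        t ^ n * (lagPoly n).eval x := by
      rw [lagPoly, Polynomial.eval_finsetSum, Finset.mul_sum]
      refine Finset.sum_congr rfl fun k _ => ?_
      simp only [hf, Function.comp, Equiv.prodComm_apply, Prod.swap, Polynomial.eval_monomial]
      rw [neg_pow]; ring
    rw [← e]; exact h
  have e : (fun n => t ^ n * lagD 0 n x) =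
      fun n => t ^ n * (lagPoly n).eval x * Real.exp (-x / 2) := by
    funext n; rw [lagD]; ring
  rw [e]
  exact h3.mul_right _

/-! ### Laguerre series on the orthant with rapidly decreasing coefficients -/

section Series
variable {d : ℕ}

/-- The total degree `|n|` of a multi-index. -/
abbrev tot (n : Fin d → ℕ) : ℕ := ∑ i, n i

/-- Derivatives of the Laguerre functions of several variables. -/
def lagFun (p n : Fin d → ℕ) (x : Fin d → ℝ) : ℝ := ∏ i, lagD (p i) (n i) (x i)

/-- The weight `∏ (1 + x_i)`. -/
def growth (x : Fin d → ℝ) : ℝ := ∏ i, (1 + x i)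

theorem openOrthant_subset_closedOrthant : openOrthant d ⊆ closedOrthant d := fun _ hx i => (hx i).le

theorem one_le_growth {x : Fin d → ℝ} (hx : x ∈ closedOrthant d) : 1 ≤ growth x :=
  Finset.one_le_prod fun i => by simpa using hx i

theorem exists_bound_lagFun (k : ℕ) (p : Fin d → ℕ) : ∃ C : ℝ, 0 ≤ C ∧ ∃ m : ℕ,
    ∀ (n : Fin d → ℕ), ∀ x ∈ closedOrthant d,
      growth x ^ k * |lagFun p n x| ≤ C * (1 + (tot n : ℝ)) ^ m := by
  choose C hC m h using fun i : Fin d => exists_bound_lagD k (p i)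
  refine ⟨∏ i, C i, Finset.prod_nonneg fun i _ => hC i, ∑ i, m i, fun n x hx => ?_⟩
  rw [growth, lagFun, Finset.abs_prod, ← Finset.prod_pow, ← Finset.prod_mul_distrib,
    ← Finset.prod_pow_eq_pow_sum, ← Finset.prod_mul_distrib]
  refine Finset.prod_le_prod (fun i _ => ?_) fun i _ => (h i (n i) (x i) (hx i)).trans ?_
  · have := hx i
    positivity
  · have : (n i : ℝ) ≤ (tot n : ℕ) := by
      exact_mod_cast Finset.single_le_sum (fun _ _ => Nat.zero_le _) (Finset.mem_univ i)
    have := hC i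
    gcongr

/-- Rapidly decreasing families. -/
def Rapid (a : (Fin d → ℕ) → ℂ) : Prop :=
  ∀ k : ℕ, Summable fun n => ‖a n‖ * (1 + (tot n : ℝ)) ^ k

/-- The series `∑ a_n ∂^p ℓ_n`. -/
def lagSeries (p : Fin d → ℕ) (a : (Fin d → ℕ) → ℂ) (x : Fin d → ℝ) : ℂ :=
  ∑' n, a n * (lagFun p n x : ℂ)

theorem norm_term_le {p : Fin d → ℕ} {C : ℝ} {m : ℕ} {n : Fin d → ℕ} {x : Fin d → ℝ} (c : ℂ)
    (h : |lagFun p n x| ≤ C * (1 + (tot n : ℝ)) ^ m) :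
    ‖c * (lagFun p n x : ℂ)‖ ≤ C * (‖c‖ * (1 + (tot n : ℝ)) ^ m) := by
  rw [norm_mul, Complex.norm_real, Real.norm_eq_abs, mul_left_comm]
  gcongr

theorem exists_bound_lagFun' (p : Fin d → ℕ) : ∃ C : ℝ, 0 ≤ C ∧ ∃ m : ℕ,
    ∀ (n : Fin d → ℕ), ∀ x ∈ closedOrthant d, |lagFun p n x| ≤ C * (1 + (tot n : ℝ)) ^ m := by
  obtain ⟨C, hC, m, h⟩ := exists_bound_lagFun 0 p
  exact ⟨C, hC, m, fun n x hx => by simpa using h n x hx⟩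

theorem summable_lagSeries (p : Fin d → ℕ) {a : (Fin d → ℕ) → ℂ} (ha : Rapid a) {x : Fin d → ℝ}
    (hx : x ∈ closedOrthant d) : Summable fun n => a n * (lagFun p n x : ℂ) := by
  obtain ⟨C, hC, m, h⟩ := exists_bound_lagFun' p
  exact Summable.of_norm_bounded ((ha m).mul_left C) fun n => norm_term_le _ (h n x hx)

theorem exists_bound_lagSeries (k : ℕ) (p : Fin d → ℕ) : ∃ C : ℝ, 0 ≤ C ∧ ∃ m : ℕ,
    ∀ (a : (Fin d → ℕ) → ℂ), Rapid a → ∀ x ∈ closedOrthant d,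
      growth x ^ k * ‖lagSeries p a x‖ ≤ C * ∑' n, ‖a n‖ * (1 + (tot n : ℝ)) ^ m := by
  obtain ⟨C, hC, m, h⟩ := exists_bound_lagFun k p
  refine ⟨C, hC, m, fun a ha x hx => ?_⟩
  have hg : 0 < growth x ^ k := pow_pos (zero_lt_one.trans_le (one_le_growth hx)) k
  rw [← le_div_iff₀' hg, mul_div_right_comm, ← tsum_mul_left]
  refine tsum_of_norm_bounded ((ha m).mul_left (C / growth x ^ k)).hasSum fun n => ?_
  refine norm_term_le _ ?_
  rw [div_mul_eq_mul_div, le_div_iff₀' hg]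
  exact h n x hx

theorem continuousOn_lagSeries (p : Fin d → ℕ) {a : (Fin d → ℕ) → ℂ} (ha : Rapid a) :
    ContinuousOn (lagSeries p a) (closedOrthant d) := by
  obtain ⟨C, hC, m, h⟩ := exists_bound_lagFun' p
  refine continuousOn_tsum (fun n => ?_) ((ha m).mul_left C) fun n x hx => norm_term_le _ (h n x hx)
  have hc : Continuous fun x : Fin d → ℝ => lagFun p n x := by
    refine continuous_finsetProd _ fun i _ => ?_
    have : Continuous (lagD (p i) (n i)) :=
      continuous_iff_continuousAt.2 fun t => (hasDerivAt_lagD _ _ t).continuousAt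
    exact this.comp (continuous_apply i)
  exact (continuous_const.mul (Complex.continuous_ofReal.comp hc)).continuousOn

/-- The coordinate projections as complex-valued maps. -/
def projC (j : Fin d) : (Fin d → ℝ) →L[ℝ] ℂ :=
  Complex.ofRealCLM.comp (ContinuousLinearMap.proj j)

theorem projC_apply (j : Fin d) (x : Fin d → ℝ) : projC j x = (x j : ℂ) := rfl

theorem norm_projC_le (j : Fin d) : ‖projC j‖ ≤ 1 := by
  refine ContinuousLinearMap.opNorm_le_bound _ zero_le_one fun x => ?_
  rw [projC_apply, Complex.norm_real, one_mul]
  exact norm_le_pi_norm x j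

theorem prod_erase_mul_lagD (p n : Fin d → ℕ) (x : Fin d → ℝ) (j : Fin d) (q : ℕ) :
    lagFun (p + Pi.single j q) n x =
      (∏ i ∈ Finset.univ.erase j, lagD (p i) (n i) (x i)) * lagD (p j + q) (n j) (x j) := by
  rw [lagFun, ← Finset.prod_erase_mul _ _ (Finset.mem_univ j)]
  congr 1
  · refine Finset.prod_congr rfl fun i hi => ?_
    rw [Pi.add_apply, Pi.single_eq_of_ne (Finset.ne_of_mem_erase hi), add_zero]
  · simp

theorem hasFDerivAt_lagFun (p n : Fin d → ℕ) (c : ℂ) (x : Fin d → ℝ) :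
    HasFDerivAt (fun y => c * (lagFun p n y : ℂ))
      (∑ j, (c * (lagFun (p + Pi.single j 1) n x : ℂ)) • projC j) x := by
  have h1 : HasFDerivAt (lagFun p n) (∑ j, lagFun (p + Pi.single j 1) n x •
      (ContinuousLinearMap.proj j : (Fin d → ℝ) →L[ℝ] ℝ)) x := by
    have := HasFDerivAt.finsetProd (u := Finset.univ) (x := x)
      (g := fun (i : Fin d) (y : Fin d → ℝ) => lagD (p i) (n i) (y i))
      (g' := fun i => lagD (p i + 1) (n i) (x i) •
        (ContinuousLinearMap.proj i : (Fin d → ℝ) →L[ℝ] ℝ)) fun i _ =>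
      (hasDerivAt_lagD (p i) (n i) (x i)).comp_hasFDerivAt x
        (ContinuousLinearMap.proj i : (Fin d → ℝ) →L[ℝ] ℝ).hasFDerivAt
    refine this.congr_fderiv (Finset.sum_congr rfl fun j _ => ?_)
    rw [prod_erase_mul_lagD, smul_smul]
  have h2 := (Complex.ofRealCLM.hasFDerivAt.comp x h1).const_mul c
  refine h2.congr_fderiv ?_
  ext v
  simp [Finset.mul_sum, projC_apply, mul_assoc]

theorem isPreconnected_openOrthant : IsPreconnected (openOrthant d) := by
  have : openOrthant d = Set.univ.pi fun _ => Set.Ioi 0 := by ext; simp [openOrthant]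
  rw [this]
  exact (convex_pi fun _ _ => convex_Ioi 0).isPreconnected

/-- Termwise differentiation on the connected open orthant: the derivatives of the terms are bounded
there by a summable sequence, because `lagFun` grows at most polynomially in the index. -/
theorem hasFDerivAt_lagSeries (p : Fin d → ℕ) {a : (Fin d → ℕ) → ℂ} (ha : Rapid a)
    {x : Fin d → ℝ} (hx : x ∈ openOrthant d) :
    HasFDerivAt (lagSeries p a) (∑ j, lagSeries (p + Pi.single j 1) a x • projC j) x := by
  have hxc := openOrthant_subset_closedOrthant hx
  choose C hC m h using fun j : Fin d => exists_bound_lagFun' (p + Pi.single j 1)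
  have hs : Summable fun n => ∑ j, C j * (‖a n‖ * (1 + (tot n : ℝ)) ^ m j) :=
    summable_sum fun j _ => (ha (m j)).mul_left (C j)
  refine (hasFDerivAt_tsum_of_isPreconnected hs isOpen_openOrthant isPreconnected_openOrthant
    (fun n y _ => hasFDerivAt_lagFun p n (a n) y) (fun n y hy => ?_) hx
    (summable_lagSeries p ha hxc) hx).congr_fderiv ?_
  · refine (norm_sum_le _ _).trans (Finset.sum_le_sum fun j _ => ?_)
    rw [norm_smul]
    refine (mul_le_of_le_one_right (norm_nonneg _) (norm_projC_le j)).trans ?_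
    exact norm_term_le _ (h j n y (openOrthant_subset_closedOrthant hy))
  · rw [Summable.tsum_finsetSum fun j _ => (summable_lagSeries _ ha hxc).smul_const _]
    exact Finset.sum_congr rfl fun j _ => (summable_lagSeries _ ha hxc).tsum_smul_const _

theorem pderiv_lagSeries (p : Fin d → ℕ) {a : (Fin d → ℕ) → ℂ} (ha : Rapid a) (j : Fin d) :
    Set.EqOn (pderiv j (lagSeries p a)) (lagSeries (p + Pi.single j 1) a) (openOrthant d) := by
  intro x hx
  rw [pderiv, (hasFDerivAt_lagSeries p ha hx).fderiv, _root_.sum_apply]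
  rw [Finset.sum_eq_single j]
  · simp [projC_apply]
  · intro i _ hi
    simp [projC_apply, hi]
  · simp

/-- The induction on the order of smoothness runs over all `p` at once, since the gradient of
`lagSeries p a` consists of series of the same kind with `p` raised by one. -/
theorem smoothOrthant_lagSeries (p : Fin d → ℕ) {a : (Fin d → ℕ) → ℂ} (ha : Rapid a) :
    SmoothOrthant (lagSeries p a) := by
  have : ∀ N : ℕ, ∀ p : Fin d → ℕ, ContDiffOn ℝ N (lagSeries p a) (openOrthant d) := by
    intro N
    induction N with
    | zero =>
      intro p
      exact contDiffOn_zero.2 ((continuousOn_lagSeries p ha).mono openOrthant_subset_closedOrthant)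
    | succ N ih =>
      intro p
      push_cast
      rw [contDiffOn_succ_iff_fderiv_of_isOpen isOpen_openOrthant]
      refine ⟨fun x hx => (hasFDerivAt_lagSeries p ha hx).differentiableAt.differentiableWithinAt,
        by simp, ?_⟩
      refine ContDiffOn.congr (f := fun x => ∑ j, lagSeries (p + Pi.single j 1) a x • projC j) ?_
        fun x hx => (hasFDerivAt_lagSeries p ha hx).fderiv
      exact ContDiffOn.sum fun j _ => (ih _).smul contDiffOn_const
  exact contDiffOn_infty.2 fun N => this N p

theorem iterate_pderiv_lagSeries (p : Fin d → ℕ) {a : (Fin d → ℕ) → ℂ} (ha : Rapid a) (j : Fin d)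
    (q : ℕ) : Set.EqOn ((pderiv j)^[q] (lagSeries p a)) (lagSeries (p + Pi.single j q) a)
      (openOrthant d) := by
  induction q with
  | zero =>
    rw [Pi.single_zero, add_zero]
    exact fun x _ => rfl
  | succ q ih =>
    rw [Function.iterate_succ_apply']
    refine ((IsSmoothOp.pderiv j).congr ih).trans ?_
    rw [Pi.single_add, ← add_assoc]
    exact pderiv_lagSeries _ ha j

theorem multiDeriv_lagSeries (q : Fin d → ℕ) {a : (Fin d → ℕ) → ℂ} (ha : Rapid a) :
    Set.EqOn (multiDeriv q (lagSeries 0 a)) (lagSeries q a) (openOrthant d) := by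
  have : ∀ l : List (Fin d), Set.EqOn (l.foldr (fun j G => (pderiv j)^[q j] G) (lagSeries 0 a))
      (lagSeries (l.map fun j => Pi.single j (q j)).sum a) (openOrthant d) := by
    intro l
    induction l with
    | nil => exact fun x _ => rfl
    | cons j l ih =>
      refine (((IsSmoothOp.pderiv j).iterate (q j)).congr ih).trans ?_
      rw [List.map_cons, List.sum_cons, add_comm]
      exact iterate_pderiv_lagSeries _ ha j (q j)
  have h := this (List.finRange d)
  have e : ((List.finRange d).map fun j => (Pi.single j (q j) : Fin d → ℕ)).sum = q := by
    rw [← List.ofFn_eq_map, List.sum_ofFn, Finset.univ_sum_single]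
  rw [e] at h
  exact h

theorem pderiv_coord_mul (i j : Fin d) {G : (Fin d → ℝ) → ℂ} {x : Fin d → ℝ}
    (hG : DifferentiableAt ℝ G x) : pderiv i (fun y => (y j : ℂ) * G y) x =
      (if i = j then G x else 0) + (x j : ℂ) * pderiv i G x := by
  have h := (projC j).hasFDerivAt (x := x) |>.mul hG.hasFDerivAt
  have h' : HasFDerivAt (fun y : Fin d → ℝ => (y j : ℂ) * G y) _ x := h
  rw [pderiv, h'.fderiv, pderiv]
  split_ifs with hij
  · subst hij; simp [projC_apply]; ring
  · simp [projC_apply, Ne.symm hij]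

/-- Only the `j`-th factor of the product is affected, so this is `lagD_ode` times the remaining
factors. -/
theorem lagFun_ode (n : Fin d → ℕ) (x : Fin d → ℝ) (j : Fin d) :
    lagFun (0 + Pi.single j 1) n x + x j * lagFun (0 + Pi.single j 2) n x =
      (x j / 4 - 1 / 2 - n j) * lagFun 0 n x := by
  have h0 := prod_erase_mul_lagD 0 n x j 0
  rw [Pi.single_zero, add_zero] at h0
  rw [prod_erase_mul_lagD, prod_erase_mul_lagD, h0]
  have := lagD_ode (n j) (x j)
  simp only [Pi.zero_apply, zero_add]
  linear_combination (∏ i ∈ Finset.univ.erase j, lagD 0 (n i) (x i)) * this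

theorem Rapid.mul_of_le {a : (Fin d → ℕ) → ℂ} (ha : Rapid a) {b : (Fin d → ℕ) → ℂ} {k : ℕ}
    (h : ∀ n, ‖b n‖ ≤ ‖a n‖ * (1 + (tot n : ℝ)) ^ k) : Rapid b := fun m =>
  Summable.of_nonneg_of_le (fun n => by positivity) (fun n => by
    rw [pow_add, ← mul_assoc]
    gcongr
    exact h n) (ha (k + m))

theorem Rapid.tot_pow_mul {a : (Fin d → ℕ) → ℂ} (ha : Rapid a) (N : ℕ) :
    Rapid fun n => (tot n : ℂ) ^ N * a n := by
  refine ha.mul_of_le (k := N) fun n => ?_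
  rw [norm_mul, norm_pow, Complex.norm_natCast, mul_comm]
  gcongr
  linarith

/-- One summand of the Laguerre operator, up to sign. -/
def laguerreTerm (j : Fin d) (F : (Fin d → ℝ) → ℂ) (x : Fin d → ℝ) : ℂ :=
  pderiv j (fun y => (y j : ℂ) * pderiv j F y) x - (x j : ℂ) / 4 * F x + 1 / 2 * F x

theorem laguerreOp_eq_sum (F : (Fin d → ℝ) → ℂ) (x : Fin d → ℝ) :
    laguerreOp F x = -∑ j, laguerreTerm j F x := rfl

theorem SmoothOrthant.differentiableAt {F : (Fin d → ℝ) → ℂ} (hF : SmoothOrthant F)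
    {x : Fin d → ℝ} (hx : x ∈ openOrthant d) : DifferentiableAt ℝ F x :=
  (ContDiffOn.contDiffAt hF (isOpen_openOrthant.mem_nhds hx)).differentiableAt (by simp)

theorem laguerreTerm_eq (j : Fin d) {F : (Fin d → ℝ) → ℂ} (hF : SmoothOrthant F)
    {x : Fin d → ℝ} (hx : x ∈ openOrthant d) : laguerreTerm j F x =
      pderiv j F x + (x j : ℂ) * pderiv j (pderiv j F) x - (x j : ℂ) / 4 * F x + 1 / 2 * F x := by
  rw [laguerreTerm, pderiv_coord_mul j j
    (((IsSmoothOp.pderiv j).smooth hF).differentiableAt hx), if_pos rfl]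

theorem laguerreTerm_lagSeries {a : (Fin d → ℕ) → ℂ} (ha : Rapid a) (j : Fin d) {x : Fin d → ℝ}
    (hx : x ∈ openOrthant d) :
    laguerreTerm j (lagSeries 0 a) x = ∑' n, -(n j : ℂ) * (a n * (lagFun 0 n x : ℂ)) := by
  have hxc := openOrthant_subset_closedOrthant hx
  have h2 := iterate_pderiv_lagSeries 0 ha j 2 hx
  rw [laguerreTerm_eq j (smoothOrthant_lagSeries 0 ha) hx, pderiv_lagSeries 0 ha j hx]
  have h2' : pderiv j (pderiv j (lagSeries 0 a)) x = lagSeries (0 + Pi.single j 2) a x := h2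
  rw [h2']
  have s0 := (summable_lagSeries 0 ha hxc).hasSum
  have s1 := (summable_lagSeries (0 + Pi.single j 1) ha hxc).hasSum
  have s2 := (summable_lagSeries (0 + Pi.single j 2) ha hxc).hasSum
  have h := ((s1.add (s2.mul_left (x j : ℂ))).sub (s0.mul_left ((x j : ℂ) / 4))).add
    (s0.mul_left (1 / 2))
  refine Eq.trans h.tsum_eq.symm (tsum_congr fun n => ?_)
  have e := congrArg (fun t : ℝ => (t : ℂ)) (lagFun_ode n x j)
  push_cast at e
  linear_combination a n * e

theorem laguerreOp_lagSeries {a : (Fin d → ℕ) → ℂ} (ha : Rapid a) :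
    Set.EqOn (laguerreOp (lagSeries 0 a)) (lagSeries 0 fun n => (tot n : ℂ) * a n)
      (openOrthant d) := by
  intro x hx
  have hxc := openOrthant_subset_closedOrthant hx
  have hb : ∀ j : Fin d, Summable fun n : Fin d → ℕ => -(n j : ℂ) * (a n * (lagFun 0 n x : ℂ)) := by
    intro j
    have : Rapid fun n => -(n j : ℂ) * a n := ha.mul_of_le (k := 1) fun n => by
      rw [norm_mul, norm_neg, Complex.norm_natCast, mul_comm, pow_one]
      have : (n j : ℝ) ≤ (tot n : ℕ) := by
        exact_mod_cast Finset.single_le_sum (fun _ _ => Nat.zero_le _) (Finset.mem_univ j)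
      gcongr
      linarith
    exact (summable_lagSeries 0 this hxc).congr fun n => by ring
  rw [laguerreOp_eq_sum, Finset.sum_congr rfl fun j _ => laguerreTerm_lagSeries ha j hx,
    ← Summable.tsum_finsetSum fun j _ => hb j, ← tsum_neg]
  refine tsum_congr fun n => ?_
  rw [← Finset.sum_mul]
  push_cast
  rw [Finset.sum_neg_distrib]; ring

/-- `E` is diagonal on Laguerre series. The factor `|n|^N` keeps the coefficients rapidly
decreasing, which allows the iteration. -/
theorem iterate_laguerreOp_lagSeries {a : (Fin d → ℕ) → ℂ} (ha : Rapid a) (N : ℕ) :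
    Set.EqOn (laguerreOp^[N] (lagSeries 0 a)) (lagSeries 0 fun n => (tot n : ℂ) ^ N * a n)
      (openOrthant d) := by
  induction N with
  | zero =>
    simp only [pow_zero, one_mul]
    exact fun x _ => rfl
  | succ N ih =>
    rw [Function.iterate_succ_apply']
    refine (IsSmoothOp.laguerreOp.congr ih).trans ((laguerreOp_lagSeries (ha.tot_pow_mul N)).trans ?_)
    refine fun x _ => tsum_congr fun n => ?_
    ring

/-- The series `∑ a_n ∂^p ℓ_n` as a continuous function on the closed orthant. -/
def lagCont (p : Fin d → ℕ) (a : (Fin d → ℕ) → ℂ) (ha : Rapid a) : C(closedOrthant d, ℂ) :=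
  ⟨fun x => lagSeries p a x.1, continuousOn_iff_continuous_domRestrict.1 (continuousOn_lagSeries p ha)⟩

theorem extendZero_eqOn_of_forall {f : closedOrthant d → ℂ} {G : (Fin d → ℝ) → ℂ}
    (h : ∀ x : closedOrthant d, f x = G x.1) : Set.EqOn (extendZero f) G (openOrthant d) := by
  intro x hx
  have := extendZero_apply f ⟨x, openOrthant_subset_closedOrthant hx⟩
  rw [h] at this
  exact this

theorem extendZero_lagCont (p : Fin d → ℕ) {a : (Fin d → ℕ) → ℂ} (ha : Rapid a) :
    Set.EqOn (extendZero (lagCont p a ha)) (lagSeries p a) (openOrthant d) :=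
  extendZero_eqOn_of_forall fun _ => rfl

theorem pow_le_growth {x : Fin d → ℝ} (hx : x ∈ closedOrthant d) (k : Fin d → ℕ) :
    ∏ i, x i ^ k i ≤ growth x ^ tot k := by
  rw [growth, ← Finset.prod_pow]
  refine Finset.prod_le_prod (fun i _ => pow_nonneg (hx i) _) fun i _ => ?_
  calc x i ^ k i ≤ (1 + x i) ^ k i := pow_le_pow_left₀ (hx i) (by linarith [hx i]) _
    _ ≤ (1 + x i) ^ tot k := pow_le_pow_right₀ (by linarith [hx i])
      (Finset.single_le_sum (fun _ _ => Nat.zero_le _) (Finset.mem_univ i))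

theorem lagCont_mem_schwartzOrthant {a : (Fin d → ℕ) → ℂ} (ha : Rapid a) :
    lagCont 0 a ha ∈ schwartzOrthant d := by
  have e := extendZero_lagCont 0 ha
  have em : ∀ p, Set.EqOn (multiDeriv p (extendZero (lagCont 0 a ha))) (lagSeries p a)
    (openOrthant d) := fun p => ((IsSmoothOp.multiDeriv p).congr e).trans (multiDeriv_lagSeries p ha)
  refine ⟨(smoothOrthant_lagSeries 0 ha).congr e, fun p => ⟨lagCont p a ha, fun x hx => (em p hx).symm⟩,
    fun p k => ?_⟩
  obtain ⟨C, hC, m, h⟩ := exists_bound_lagSeries (tot k) p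
  refine ⟨_, fun x hx => le_trans ?_ (h a ha x (openOrthant_subset_closedOrthant hx))⟩
  rw [em p hx]
  gcongr
  exact pow_le_growth (openOrthant_subset_closedOrthant hx) k

theorem laguerrePow_lagCont {a : (Fin d → ℕ) → ℂ} (ha : Rapid a) (N : ℕ) :
    Set.EqOn (laguerrePow N (lagCont 0 a ha)) (lagSeries 0 fun n => (tot n : ℂ) ^ N * a n)
      (openOrthant d) :=
  ((IsSmoothOp.laguerreOp.iterate N).congr (extendZero_lagCont 0 ha)).trans
    (iterate_laguerreOp_lagSeries ha N)

end Series

/-! ### Functions with polynomially bounded derivatives -/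

section Tame
variable {d : ℕ}

theorem pderiv_comm (i j : Fin d) {F : (Fin d → ℝ) → ℂ} (hF : SmoothOrthant F) :
    Set.EqOn (pderiv i (pderiv j F)) (pderiv j (pderiv i F)) (openOrthant d) := by
  intro x hx
  have hc : ContDiffAt ℝ ∞ F x := ContDiffOn.contDiffAt hF (isOpen_openOrthant.mem_nhds hx)
  have hd : DifferentiableAt ℝ (fderiv ℝ F) x :=
    ((hF.fderiv_of_isOpen (m := ∞) isOpen_openOrthant (by simp)).contDiffAt
      (isOpen_openOrthant.mem_nhds hx)).differentiableAt (by simp)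
  have hs := hc.isSymmSndFDerivAt (by simpa using WithTop.coe_le_coe.2 (le_top (a := (2 : ℕ∞))))
  have e : ∀ i j : Fin d, pderiv i (pderiv j F) x =
      fderiv ℝ (fderiv ℝ F) x (Pi.single i 1) (Pi.single j 1) := by
    intro i j
    have h := (hd.hasFDerivAt.clm_apply (hasFDerivAt_const (Pi.single j 1) x)).fderiv
    change fderiv ℝ (fun y => fderiv ℝ F y (Pi.single j 1)) x (Pi.single i 1) = _
    rw [h]; simp
  rw [e, e, hs.eq]

theorem pderiv_iterate_comm (i j : Fin d) (q : ℕ) {F : (Fin d → ℝ) → ℂ} (hF : SmoothOrthant F) :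
    Set.EqOn (pderiv j ((pderiv i)^[q] F)) ((pderiv i)^[q] (pderiv j F)) (openOrthant d) := by
  induction q with
  | zero => exact fun x _ => rfl
  | succ q ih =>
    rw [Function.iterate_succ_apply', Function.iterate_succ_apply']
    exact (pderiv_comm j i (((IsSmoothOp.pderiv i).iterate q).smooth hF)).trans
      ((IsSmoothOp.pderiv i).congr ih)

theorem isSmoothOp_foldr_iterate (q : Fin d → ℕ) (l : List (Fin d)) :
    IsSmoothOp fun F => l.foldr (fun j G => (pderiv j)^[q j] G) F := by
  induction l with
  | nil => exact IsSmoothOp.id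
  | cons j l ih => exact ((IsSmoothOp.pderiv j).iterate (q j)).comp ih

theorem multiDeriv_zero (F : (Fin d → ℝ) → ℂ) : multiDeriv 0 F = F := by
  have : ∀ l : List (Fin d), l.foldr (fun j G => (pderiv j)^[(0 : Fin d → ℕ) j] G) F = F := by
    intro l
    induction l with
    | nil => rfl
    | cons j l ih => rw [List.foldr_cons, ih]; rfl
  exact this _

/-- `multiDeriv` differentiates in a fixed order of the coordinates. By symmetry of second
derivatives the new `∂_j` can be moved inwards to the block of the coordinate `j`, which occurs
exactly once in the list. -/
theorem pderiv_multiDeriv (q : Fin d → ℕ) (j : Fin d) {F : (Fin d → ℝ) → ℂ}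
    (hF : SmoothOrthant F) :
    Set.EqOn (pderiv j (multiDeriv q F)) (multiDeriv (q + Pi.single j 1) F) (openOrthant d) := by
  have h0 : ∀ l : List (Fin d), j ∉ l →
      l.foldr (fun i G => (pderiv i)^[(q + Pi.single j 1 : Fin d → ℕ) i] G) F =
        l.foldr (fun i G => (pderiv i)^[q i] G) F := by
    intro l hl
    induction l with
    | nil => rfl
    | cons i l ih =>
      rw [List.mem_cons, not_or] at hl
      rw [List.foldr_cons, List.foldr_cons, ih hl.2, Pi.add_apply,
        Pi.single_eq_of_ne (Ne.symm hl.1), add_zero]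
  have h1 : ∀ l : List (Fin d), l.Nodup → j ∈ l →
      Set.EqOn (pderiv j (l.foldr (fun i G => (pderiv i)^[q i] G) F))
        (l.foldr (fun i G => (pderiv i)^[(q + Pi.single j 1 : Fin d → ℕ) i] G) F) (openOrthant d) := by
    intro l hn hl
    induction l with
    | nil => simp at hl
    | cons i l ih =>
      rw [List.nodup_cons] at hn
      rw [List.foldr_cons, List.foldr_cons]
      rcases eq_or_ne j i with rfl | hij
      · rw [h0 l hn.1, Pi.add_apply, Pi.single_eq_same, Function.iterate_succ_apply']
        exact fun x _ => rfl
      · have hl' : j ∈ l := (List.mem_cons.1 hl).resolve_left hij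
        refine (pderiv_iterate_comm i j (q i) ((isSmoothOp_foldr_iterate q l).smooth hF)).trans ?_
        rw [Pi.add_apply, Pi.single_eq_of_ne hij.symm, add_zero]
        exact ((IsSmoothOp.pderiv i).iterate _).congr (ih hn.2 hl')
  exact h1 _ (List.nodup_finRange d) (List.mem_finRange j)

/-- The functions that are smooth on the open orthant and have polynomially bounded
derivatives. -/
structure Tame (F : (Fin d → ℝ) → ℂ) : Prop where
  smooth : SmoothOrthant F
  bound : ∀ l : List (Fin d), ∃ C : ℝ, ∃ m : ℕ, ∀ x ∈ openOrthant d,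
    ‖l.foldr pderiv F x‖ ≤ C * growth x ^ m

theorem isSmoothOp_foldr (l : List (Fin d)) : IsSmoothOp fun F => l.foldr pderiv F := by
  induction l with
  | nil => exact IsSmoothOp.id
  | cons j l ih => exact (IsSmoothOp.pderiv j).comp ih

theorem growth_pos {x : Fin d → ℝ} (hx : x ∈ openOrthant d) : 0 < growth x :=
  zero_lt_one.trans_le (one_le_growth (openOrthant_subset_closedOrthant hx))

theorem bound_add {F G : (Fin d → ℝ) → ℂ}
    (hF : ∃ C : ℝ, ∃ m : ℕ, ∀ x ∈ openOrthant d, ‖F x‖ ≤ C * growth x ^ m)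
    (hG : ∃ C : ℝ, ∃ m : ℕ, ∀ x ∈ openOrthant d, ‖G x‖ ≤ C * growth x ^ m) :
    ∃ C : ℝ, ∃ m : ℕ, ∀ x ∈ openOrthant d, ‖F x + G x‖ ≤ C * growth x ^ m := by
  obtain ⟨A, m, hA⟩ := hF
  obtain ⟨B, k, hB⟩ := hG
  refine ⟨|A| + |B|, m + k, fun x hx => (norm_add_le _ _).trans ?_⟩
  have h1 := one_le_growth (openOrthant_subset_closedOrthant hx)
  rw [add_mul]
  refine add_le_add ((hA x hx).trans ?_) ((hB x hx).trans ?_)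
  · calc A * growth x ^ m ≤ |A| * growth x ^ m := by gcongr; exact le_abs_self A
      _ ≤ |A| * growth x ^ (m + k) :=
        mul_le_mul_of_nonneg_left (pow_le_pow_right₀ h1 (by omega)) (abs_nonneg A)
  · calc B * growth x ^ k ≤ |B| * growth x ^ k := by gcongr; exact le_abs_self B
      _ ≤ |B| * growth x ^ (m + k) :=
        mul_le_mul_of_nonneg_left (pow_le_pow_right₀ h1 (by omega)) (abs_nonneg B)

theorem Tame.congr {F G : (Fin d → ℝ) → ℂ} (hF : Tame F) (h : Set.EqOn G F (openOrthant d)) :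
    Tame G where
  smooth := ContDiffOn.congr hF.smooth h
  bound l := by
    obtain ⟨C, m, hC⟩ := hF.bound l
    exact ⟨C, m, fun x hx => by rw [(isSmoothOp_foldr l).congr h hx]; exact hC x hx⟩

theorem Tame.add {F G : (Fin d → ℝ) → ℂ} (hF : Tame F) (hG : Tame G) : Tame (F + G) where
  smooth := ContDiffOn.add hF.smooth hG.smooth
  bound l := by
    obtain ⟨C, m, h⟩ := bound_add (hF.bound l) (hG.bound l)
    exact ⟨C, m, fun x hx => by
      rw [(isSmoothOp_foldr l).add hF.smooth hG.smooth hx]; exact h x hx⟩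

theorem Tame.smul (c : ℂ) {F : (Fin d → ℝ) → ℂ} (hF : Tame F) : Tame (c • F) where
  smooth := ContDiffOn.const_smul c hF.smooth
  bound l := by
    obtain ⟨C, m, h⟩ := hF.bound l
    refine ⟨‖c‖ * C, m, fun x hx => ?_⟩
    rw [(isSmoothOp_foldr l).smul c hF.smooth hx, Pi.smul_apply, norm_smul, mul_assoc]
    exact mul_le_mul_of_nonneg_left (h x hx) (norm_nonneg c)

theorem Tame.zero : Tame (0 : (Fin d → ℝ) → ℂ) where
  smooth := contDiffOn_const
  bound l := ⟨0, 0, fun x hx => by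
    have := (isSmoothOp_foldr l).smul (F := 0) 0 contDiffOn_const hx
    rw [zero_smul, zero_smul] at this
    rw [this]; simp⟩

theorem Tame.sum {ι : Type*} (s : Finset ι) {F : ι → (Fin d → ℝ) → ℂ} (hF : ∀ i, Tame (F i)) :
    Tame (∑ i ∈ s, F i) := by
  classical
  induction s using Finset.induction_on with
  | empty => exact Tame.zero
  | insert i s hi ih => rw [Finset.sum_insert hi]; exact (hF i).add ih

theorem Tame.pderiv {F : (Fin d → ℝ) → ℂ} (hF : Tame F) (j : Fin d) : Tame (pderiv j F) where
  smooth := (IsSmoothOp.pderiv j).smooth hF.smooth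
  bound l := by
    have := hF.bound (l ++ [j])
    rwa [List.foldr_append] at this

theorem smoothOrthant_coord_mul (j : Fin d) {F : (Fin d → ℝ) → ℂ} (hF : SmoothOrthant F) :
    SmoothOrthant fun y => (y j : ℂ) * F y :=
  ContDiffOn.mul (projC j).contDiff.contDiffOn hF

theorem one_add_coord_le_growth {x : Fin d → ℝ} (hx : x ∈ closedOrthant d) (j : Fin d) :
    1 + x j ≤ growth x := by
  rw [growth, ← Finset.mul_prod_erase _ _ (Finset.mem_univ j)]
  refine le_mul_of_one_le_right (by linarith [hx j]) ?_
  have : ∏ _i ∈ Finset.univ.erase j, (1 : ℝ) ≤ ∏ i ∈ Finset.univ.erase j, (1 + x i) :=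
    Finset.prod_le_prod (fun _ _ => zero_le_one) fun i _ => by linarith [hx i]
  simpa using this

theorem coord_le_growth {x : Fin d → ℝ} (hx : x ∈ openOrthant d) (j : Fin d) :
    x j ≤ growth x := by
  linarith [one_add_coord_le_growth (openOrthant_subset_closedOrthant hx) j]

/-- Peel off the innermost derivative: `∂_i (x_j F) = δ_{ij} F + x_j ∂_i F`, where `F` and `∂_i F`
are again tame. For this the induction has to range over all `F`. -/
theorem Tame.coord_mul (j : Fin d) {F : (Fin d → ℝ) → ℂ} (hF : Tame F) :
    Tame fun y => (y j : ℂ) * F y where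
  smooth := smoothOrthant_coord_mul j hF.smooth
  bound l := by
    induction l using List.reverseRecOn generalizing F with
    | nil =>
      obtain ⟨C, m, h⟩ := hF.bound []
      refine ⟨C, m + 1, fun x hx => ?_⟩
      have hC := (norm_nonneg _).trans (h x hx)
      simp only [List.foldr_nil] at h ⊢
      rw [norm_mul, Complex.norm_real, Real.norm_eq_abs, abs_of_pos (hx j), pow_succ, ← mul_assoc,
        mul_comm]
      have := (hx j).le
      have := coord_le_growth hx j
      gcongr
      exact h x hx
    | append_singleton l i ih =>
      have e : Set.EqOn (Pilipovic.pderiv i fun y => (y j : ℂ) * F y)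
          ((if i = j then (1 : ℂ) else 0) • F + fun y => (y j : ℂ) * Pilipovic.pderiv i F y)
          (openOrthant d) := by
        intro x hx
        rw [pderiv_coord_mul i j (hF.smooth.differentiableAt hx)]
        split_ifs <;> simp
      have h1 : Tame ((if i = j then (1 : ℂ) else 0) • F) := hF.smul _
      obtain ⟨C, m, h⟩ := bound_add (h1.bound l) (ih (hF.pderiv i))
      refine ⟨C, m, fun x hx => ?_⟩
      rw [List.foldr_append, List.foldr_cons, List.foldr_nil, (isSmoothOp_foldr l).congr e hx,
        (isSmoothOp_foldr l).add h1.smooth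
          (smoothOrthant_coord_mul j (hF.pderiv i).smooth) hx]
      exact h x hx

theorem Tame.laguerreTerm (j : Fin d) {F : (Fin d → ℝ) → ℂ} (hF : Tame F) :
    Tame (laguerreTerm j F) := by
  have h := (((hF.pderiv j).coord_mul j).pderiv j).add (((hF.coord_mul j).smul (-1 / 4)).add
    (hF.smul (1 / 2)))
  refine h.congr fun x _ => ?_
  simp only [Pilipovic.laguerreTerm, Pi.add_apply, Pi.smul_apply, smul_eq_mul]
  ring

theorem Tame.laguerreOp {F : (Fin d → ℝ) → ℂ} (hF : Tame F) : Tame (laguerreOp F) := by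
  refine ((Tame.sum Finset.univ fun j => hF.laguerreTerm j).smul (-1)).congr fun x _ => ?_
  rw [laguerreOp_eq_sum, Pi.smul_apply, Finset.sum_apply, smul_eq_mul, neg_one_mul]

/-- This closure property is the reason for working with tame functions: no decay of `E^N f` has to
be tracked, because the Laguerre functions paired with it supply all the decay. -/
theorem Tame.iterate_laguerreOp {F : (Fin d → ℝ) → ℂ} (hF : Tame F) (N : ℕ) :
    Tame (Pilipovic.laguerreOp^[N] F) := by
  induction N with
  | zero => exact hF
  | succ N ih => rw [Function.iterate_succ_apply']; exact ih.laguerreOp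

theorem tame_of_mem_schwartzOrthant {f : C(closedOrthant d, ℂ)} (hf : f ∈ schwartzOrthant d) :
    Tame (extendZero f) where
  smooth := hf.1
  bound l := by
    have : Set.EqOn (l.foldr pderiv (extendZero f))
        (multiDeriv (l.map fun j => Pi.single j 1).sum (extendZero f)) (openOrthant d) := by
      induction l with
      | nil =>
        intro x _
        rw [List.map_nil, List.sum_nil, multiDeriv_zero, List.foldr_nil]
      | cons j l ih =>
        refine ((IsSmoothOp.pderiv j).congr ih).trans ?_
        rw [List.map_cons, List.sum_cons, add_comm]
        exact pderiv_multiDeriv _ j hf.1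
    obtain ⟨C, hC⟩ := hf.2.2 (l.map fun j => Pi.single j 1).sum 0
    refine ⟨C, 0, fun x hx => ?_⟩
    rw [this hx]
    simpa using hC x hx

theorem tame_lagSeries {a : (Fin d → ℕ) → ℂ} (ha : Rapid a) (p : Fin d → ℕ) :
    Tame (lagSeries p a) where
  smooth := smoothOrthant_lagSeries p ha
  bound l := by
    have : Set.EqOn (l.foldr pderiv (lagSeries p a))
        (lagSeries (p + (l.map fun j => Pi.single j 1).sum) a) (openOrthant d) := by
      induction l with
      | nil =>
        rw [List.map_nil, List.sum_nil, add_zero]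
        exact fun x _ => rfl
      | cons j l ih =>
        refine ((IsSmoothOp.pderiv j).congr ih).trans ?_
        rw [List.map_cons, List.sum_cons, add_comm (Pi.single j 1), ← add_assoc]
        exact pderiv_lagSeries _ ha j
    obtain ⟨C, hC, m, h⟩ := exists_bound_lagSeries 0 (p + (l.map fun j => Pi.single j 1).sum)
    refine ⟨C * ∑' n, ‖a n‖ * (1 + (tot n : ℝ)) ^ m, 0, fun x hx => ?_⟩
    rw [this hx]
    simpa using h a ha x (openOrthant_subset_closedOrthant hx)

/-- From `(1 + t)² ≤ 2 (1 + t²)`, `growth²` is at most `2^d ∏ (1 + x_i²)`. Expanding this product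
leaves monomials with exponents `0` and `2`, each controlled by one Schwartz seminorm. -/
theorem exists_growth_sq_bound {f : C(closedOrthant d, ℂ)} (hf : f ∈ schwartzOrthant d) :
    ∃ C : ℝ, ∀ x ∈ openOrthant d, growth x ^ 2 * ‖extendZero f x‖ ≤ C := by
  have h0 : ∀ k : Fin d → ℕ, ∃ C : ℝ, ∀ x ∈ openOrthant d,
      (∏ i, x i ^ k i) * ‖extendZero f x‖ ≤ C := by
    intro k
    obtain ⟨C, hC⟩ := hf.2.2 0 k
    refine ⟨C, fun x hx => ?_⟩
    have := hC x hx
    rwa [multiDeriv_zero] at this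
  choose C hC using h0
  refine ⟨2 ^ d * ∑ s ∈ (Finset.univ : Finset (Fin d)).powerset, C (fun i => if i ∈ s then 2 else 0),
    fun x hx => ?_⟩
  have h1 : growth x ^ 2 ≤ 2 ^ d * ∏ i, (1 + x i ^ 2) := by
    have : (2 : ℝ) ^ d = ∏ _i : Fin d, 2 := by simp
    rw [growth, ← Finset.prod_pow, this, ← Finset.prod_mul_distrib]
    exact Finset.prod_le_prod (fun i _ => sq_nonneg _) fun i _ => by nlinarith [sq_nonneg (1 - x i)]
  calc growth x ^ 2 * ‖extendZero f x‖ ≤ (2 ^ d * ∏ i, (1 + x i ^ 2)) * ‖extendZero f x‖ := by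
        gcongr
    _ = 2 ^ d * ∑ s ∈ (Finset.univ : Finset (Fin d)).powerset,
        (∏ i, x i ^ (if i ∈ s then 2 else 0)) * ‖extendZero f x‖ := by
      rw [Finset.prod_one_add, mul_assoc, Finset.sum_mul]
      congr 1
      refine Finset.sum_congr rfl fun s _ => ?_
      congr 1
      rw [← Finset.prod_subset (Finset.subset_univ s)]
      · exact Finset.prod_congr rfl fun i hi => by rw [if_pos hi]
      · intro i _ hi; rw [if_neg hi, pow_zero]
    _ ≤ _ := by
      gcongr with s hs
      exact hC _ x hx

end Tame

/-! ### Integration by parts on the orthant -/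

section Integration
variable {d : ℕ}

variable (d) in
/-- Lebesgue measure on the open orthant. -/
abbrev orthantMeasure : Measure (Fin d → ℝ) := volume.restrict (openOrthant d)

theorem orthantMeasure_eq_pi :
    orthantMeasure d = Measure.pi fun _ => (volume : Measure ℝ).restrict (Set.Ioi 0) := by
  have : openOrthant d = Set.univ.pi fun _ => Set.Ioi 0 := by ext; simp [openOrthant]
  rw [orthantMeasure, this, volume_pi, Measure.restrict_pi_pi]

theorem integrableOn_one_add_sq_inv :
    IntegrableOn (fun x : ℝ => ((1 + x) ^ 2)⁻¹) (Set.Ioi 0) := by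
  have h := integrableOn_add_rpow_Ioi_of_lt (a := -2) (c := 0) (m := 1) (by norm_num) (by norm_num)
  refine h.congr_fun (fun x hx => ?_) measurableSet_Ioi
  have : (0 : ℝ) ≤ x + 1 := by linarith [hx.out]
  simp only
  rw [Real.rpow_neg this, add_comm]
  norm_num

theorem integrable_growth_sq_inv :
    Integrable (fun x : Fin d → ℝ => (growth x ^ 2)⁻¹) (orthantMeasure d) := by
  have h : Integrable (fun x : Fin d → ℝ => ∏ i, ((1 + x i) ^ 2)⁻¹) (orthantMeasure d) := by
    rw [orthantMeasure_eq_pi]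
    exact Integrable.fintype_prod (f := fun _ t => ((1 + t) ^ 2)⁻¹) fun i =>
      integrableOn_one_add_sq_inv
  refine h.congr (Eventually.of_forall fun x => ?_)
  simp only [growth]
  rw [Finset.prod_inv_distrib, Finset.prod_pow]

theorem integrable_of_growth_bound {F : (Fin d → ℝ) → ℂ} (hF : ContinuousOn F (openOrthant d))
    {C : ℝ} (hC : ∀ x ∈ openOrthant d, growth x ^ 2 * ‖F x‖ ≤ C) :
    Integrable F (orthantMeasure d) := by
  refine (integrable_growth_sq_inv.const_mul C).mono'
    (hF.aestronglyMeasurable isOpen_openOrthant.measurableSet)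
    (ae_restrict_of_forall_mem isOpen_openOrthant.measurableSet fun x hx => ?_)
  rw [← div_eq_mul_inv, le_div_iff₀' (pow_pos (growth_pos hx) 2)]
  exact hC x hx

/-- The bound makes `g` vanish both at `0`, through the factor `t`, and at infinity, through `(1 +
t)²`. In the applications the factor `t` is the coefficient `x_j` of the Laguerre operator. -/
theorem integral_Ioi_eq_zero_of_hasDerivAt {V : Type*} [NormedAddCommGroup V] [NormedSpace ℝ V]
    [CompleteSpace V] {g g' : ℝ → V}
    (hg : ∀ t, 0 < t → HasDerivAt g (g' t) t) (hi : IntegrableOn g' (Set.Ioi 0)) {C : ℝ}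
    (hC : ∀ t, 0 < t → (1 + t) ^ 2 * ‖g t‖ ≤ C * t) : ∫ t in Set.Ioi 0, g' t = 0 := by
  -- Nothing is assumed about `g` at the endpoint, so it is replaced by `0` there, which is its
  -- limit from the right.
  set G : ℝ → V := fun t => if 0 < t then g t else 0 with hG
  have hC0 : 0 ≤ C := by
    have := (by positivity : (0 : ℝ) ≤ (1 + 1) ^ 2 * ‖g 1‖).trans (hC 1 one_pos)
    linarith
  have b1 : ∀ t, 0 ≤ t → ‖G t‖ ≤ C * t / (1 + t) ^ 2 := by
    intro t ht
    rw [le_div_iff₀' (by positivity)]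
    simp only [hG]
    split_ifs with h
    · exact hC t h
    · rw [norm_zero, mul_zero]; positivity
  have h0 : ContinuousWithinAt G (Set.Ici 0) 0 := by
    have e : G 0 = 0 := by simp [hG]
    rw [ContinuousWithinAt, e]
    have ht : Tendsto (fun t : ℝ => C * t) (𝓝[≥] 0) (𝓝 0) := by
      have : Continuous fun t : ℝ => C * t := by fun_prop
      simpa using (this.tendsto 0).mono_left (nhdsWithin_le_nhds (s := Set.Ici (0 : ℝ)))
    refine squeeze_zero_norm' ?_ ht
    filter_upwards [self_mem_nhdsWithin] with t ht
    refine (b1 t ht).trans (div_le_self (mul_nonneg hC0 ht) ?_)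
    nlinarith [ht.out]
  have h1 : Tendsto G atTop (𝓝 0) := by
    have ht : Tendsto (fun t : ℝ => C * t⁻¹) atTop (𝓝 0) := by
      simpa using tendsto_inv_atTop_zero.const_mul C
    refine squeeze_zero_norm' ?_ ht
    filter_upwards [eventually_gt_atTop 0] with t ht
    refine (b1 t ht.le).trans ?_
    rw [div_le_iff₀ (by positivity)]
    have : C * t⁻¹ * (1 + t) ^ 2 = C * t + (C * t⁻¹ + 2 * C) := by field_simp; ring
    rw [this]
    have : 0 ≤ C * t⁻¹ := by positivity
    linarith
  have := integral_Ioi_of_hasDerivAt_of_tendsto h0 (f' := g') (fun t ht => by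
    refine (hg t ht).congr_of_eventuallyEq ?_
    filter_upwards [lt_mem_nhds ht] with s hs
    simp only [hG, if_pos hs]) hi h1
  rw [this]; simp [hG]

/-- Fubini: integrate first in the `j`-th variable, where the one-dimensional statement applies on
almost every line. -/
theorem integral_pderiv_eq_zero (j : Fin d) {G : (Fin d → ℝ) → ℂ} (hG : SmoothOrthant G) {C : ℝ}
    (hb : ∀ x ∈ openOrthant d, growth x ^ 2 * ‖G x‖ ≤ C * x j)
    (hb' : ∀ x ∈ openOrthant d, growth x ^ 2 * ‖pderiv j G x‖ ≤ C) :
    ∫ x, pderiv j G x ∂orthantMeasure d = 0 := by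
  have hi := integrable_of_growth_bound
    (ContDiffOn.continuousOn ((IsSmoothOp.pderiv j).smooth hG)) hb'
  obtain ⟨m, rfl⟩ : ∃ m, d = m + 1 := ⟨d - 1, by have := j.pos; omega⟩
  rw [orthantMeasure_eq_pi] at hi ⊢
  have hmp := (measurePreserving_piFinSuccAbove
    (fun _ : Fin (m + 1) => (volume : Measure ℝ).restrict (Set.Ioi 0)) j).symm
  rw [← hmp.integral_comp' (g := pderiv j G)]
  have hi' := (hmp.integrable_comp_emb (MeasurableEquiv.measurableEmbedding _)).2 hi
  refine (integral_prod_symm _ hi').trans ?_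
  refine integral_eq_zero_of_ae ?_
  have hpos : ∀ᵐ y : Fin m → ℝ ∂(Measure.pi fun _ => (volume : Measure ℝ).restrict (Set.Ioi 0)),
      y ∈ openOrthant m := by
    rw [← orthantMeasure_eq_pi]
    exact ae_restrict_mem isOpen_openOrthant.measurableSet
  filter_upwards [hi'.prod_left_ae, hpos] with y hy hy0
  have hmem : ∀ t, 0 < t → Fin.insertNth (α := fun _ => ℝ) j t y ∈ openOrthant (m + 1) := by
    intro t ht i
    refine Fin.succAboveCases j ?_ (fun k => ?_) i
    · simpa using ht
    · simpa using hy0 k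
  refine integral_Ioi_eq_zero_of_hasDerivAt (g := fun t => G (Fin.insertNth (α := fun _ => ℝ) j t y))
    (C := C) (fun t ht => ?_) hy fun t ht => ?_
  · have h1 := (hG.differentiableAt (hmem t ht)).hasFDerivAt
    have h2 : HasDerivAt (fun s => Fin.insertNth (α := fun _ => ℝ) j s y) (Pi.single j 1) t := by
      have := hasDerivAt_update (Fin.insertNth (α := fun _ => ℝ) j 0 y) j t
      exact this.congr_of_eventuallyEq (Eventually.of_forall fun s => by
        simp [Fin.update_insertNth])
    exact h1.comp_hasDerivAt t h2
  · have h1 := hb _ (hmem t ht)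
    rw [Fin.insertNth_apply_same] at h1
    refine le_trans ?_ h1
    have := one_add_coord_le_growth (openOrthant_subset_closedOrthant (hmem t ht)) j
    rw [Fin.insertNth_apply_same] at this
    gcongr

theorem rapid_single (n : Fin d → ℕ) : Rapid (Pi.single n (1 : ℂ)) := fun k =>
  summable_of_ne_finset_zero (s := {n}) fun m hm => by
    rw [Pi.single_eq_of_ne (by simpa using hm)]; simp

theorem lagSeries_single (p n : Fin d → ℕ) (x : Fin d → ℝ) :
    lagSeries p (Pi.single n 1) x = lagFun p n x := by
  rw [lagSeries, tsum_eq_single n]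
  · simp
  · intro m hm; rw [Pi.single_eq_of_ne hm, zero_mul]

/-- The growth exponent `m` of `F` is absorbed by asking for `k + m` powers of decay from the
Laguerre series. -/
theorem Tame.exists_mul_bound {F : (Fin d → ℝ) → ℂ} (hF : Tame F) (p : Fin d → ℕ)
    {a : (Fin d → ℕ) → ℂ} (ha : Rapid a) (k : ℕ) :
    ∃ C : ℝ, ∀ x ∈ openOrthant d, growth x ^ k * ‖F x * lagSeries p a x‖ ≤ C := by
  obtain ⟨A, m, hA⟩ := hF.bound []
  obtain ⟨B, hB, r, h⟩ := exists_bound_lagSeries (k + m) p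
  refine ⟨|A| * (B * ∑' n, ‖a n‖ * (1 + (tot n : ℝ)) ^ r), fun x hx => ?_⟩
  have h1 := h a ha x (openOrthant_subset_closedOrthant hx)
  have h2 := hA x hx
  have h3 := growth_pos hx
  rw [List.foldr_nil] at h2
  calc growth x ^ k * ‖F x * lagSeries p a x‖
      = growth x ^ k * (‖F x‖ * ‖lagSeries p a x‖) := by rw [norm_mul]
    _ ≤ growth x ^ k * ((|A| * growth x ^ m) * ‖lagSeries p a x‖) := by
      gcongr
      exact h2.trans (by gcongr; exact le_abs_self A)
    _ = |A| * (growth x ^ (k + m) * ‖lagSeries p a x‖) := by ring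
    _ ≤ _ := by gcongr

theorem integrable_tame_mul {F : (Fin d → ℝ) → ℂ} (hF : Tame F) (p : Fin d → ℕ)
    {a : (Fin d → ℕ) → ℂ} (ha : Rapid a) :
    Integrable (fun x => F x * lagSeries p a x) (orthantMeasure d) := by
  obtain ⟨C, hC⟩ := hF.exists_mul_bound p ha 2
  exact integrable_of_growth_bound ((ContDiffOn.continuousOn hF.smooth).mul
    (ContDiffOn.continuousOn (smoothOrthant_lagSeries p ha))) hC

theorem pderiv_mul (j : Fin d) {F G : (Fin d → ℝ) → ℂ} {x : Fin d → ℝ}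
    (hF : DifferentiableAt ℝ F x) (hG : DifferentiableAt ℝ G x) :
    pderiv j (fun y => F y * G y) x = pderiv j F x * G x + F x * pderiv j G x := by
  have h := hF.hasFDerivAt.mul hG.hasFDerivAt
  have h' : HasFDerivAt (fun y => F y * G y) _ x := h
  rw [pderiv, h'.fderiv, pderiv, pderiv]
  simp; ring

/-- Green's identity. Let `u` be the Laguerre function and `W = (∂_j F) u - F ∂_j u`. By the
equation for `u`, `∂_j (x_j W)` equals `laguerreTerm j F * u + n_j F u`, and its integral is zero
because of the factor `x_j` and the decay of `u`. -/
theorem integral_laguerreTerm_mul {F : (Fin d → ℝ) → ℂ} (hF : Tame F) (n : Fin d → ℕ)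
    (j : Fin d) : ∫ x, laguerreTerm j F x * (lagFun 0 n x : ℂ) ∂orthantMeasure d =
      -(n j : ℂ) * ∫ x, F x * (lagFun 0 n x : ℂ) ∂orthantMeasure d := by
  have ha := rapid_single n
  set a : (Fin d → ℕ) → ℂ := Pi.single n 1
  have e0 : ∀ x, (lagFun 0 n x : ℂ) = lagSeries 0 a x := fun x => (lagSeries_single 0 n x).symm
  simp only [e0]
  set u := lagSeries 0 a
  set u' := lagSeries (0 + Pi.single j 1) a
  have su : SmoothOrthant u := smoothOrthant_lagSeries 0 ha
  have su' : SmoothOrthant u' := smoothOrthant_lagSeries _ ha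
  set W : (Fin d → ℝ) → ℂ := fun y => pderiv j F y * u y - F y * u' y
  have sW : SmoothOrthant W := ContDiffOn.sub (ContDiffOn.mul (hF.pderiv j).smooth su)
    (ContDiffOn.mul hF.smooth su')
  have key : Set.EqOn (pderiv j fun y => (y j : ℂ) * W y)
      (fun x => laguerreTerm j F x * u x + (n j : ℂ) * (F x * u x)) (openOrthant d) := by
    intro x hx
    have dF := hF.smooth.differentiableAt hx
    have dF' := (hF.pderiv j).smooth.differentiableAt hx
    have du := su.differentiableAt hx
    have du' := su'.differentiableAt hx
    have e1 : pderiv j W x = (pderiv j (pderiv j F) x * u x + pderiv j F x * pderiv j u x)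
        - (pderiv j F x * u' x + F x * pderiv j u' x) := by
      rw [← pderiv_mul j dF' du, ← pderiv_mul j dF du']
      have := (dF'.mul du).hasFDerivAt.sub (dF.mul du').hasFDerivAt
      have h' : HasFDerivAt W _ x := this
      rw [pderiv, h'.fderiv]; rfl
    have hode := congrArg (fun t : ℝ => (t : ℂ)) (lagFun_ode n x j)
    push_cast at hode
    have eu : pderiv j u x = u' x := pderiv_lagSeries 0 ha j hx
    have eu' : pderiv j u' x = (lagFun (0 + Pi.single j 2) n x : ℂ) := by
      rw [← lagSeries_single, show (2 : ℕ) = 1 + 1 from rfl, Pi.single_add, ← add_assoc]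
      exact pderiv_lagSeries _ ha j hx
    have eu0 : (lagFun (0 + Pi.single j 1) n x : ℂ) = u' x := (lagSeries_single _ n x).symm
    rw [← eu', e0 x, eu0] at hode
    rw [pderiv_coord_mul j j (sW.differentiableAt hx), if_pos rfl, e1, eu]
    simp only [W]
    rw [laguerreTerm_eq j hF.smooth hx]
    linear_combination -F x * hode
  obtain ⟨C1, hC1⟩ := (hF.pderiv j).exists_mul_bound 0 ha 2
  obtain ⟨C2, hC2⟩ := hF.exists_mul_bound (0 + Pi.single j 1) ha 2
  obtain ⟨C3, hC3⟩ := (hF.laguerreTerm j).exists_mul_bound 0 ha 2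
  obtain ⟨C4, hC4⟩ := (hF.smul (n j : ℂ)).exists_mul_bound 0 ha 2
  have hz := integral_pderiv_eq_zero j (smoothOrthant_coord_mul j sW)
    (C := max (C1 + C2) (C3 + C4)) (fun x hx => by
      rw [norm_mul, Complex.norm_real, Real.norm_eq_abs, abs_of_pos (hx j), mul_left_comm, mul_comm]
      refine mul_le_mul_of_nonneg_right ?_ (hx j).le
      refine le_trans ?_ (le_max_left _ _)
      refine le_trans ?_ (add_le_add (hC1 x hx) (hC2 x hx))
      rw [← mul_add]
      have := growth_pos hx
      gcongr
      exact norm_sub_le _ _) fun x hx => by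
      rw [key hx]
      refine le_trans ?_ (le_max_right _ _)
      refine le_trans ?_ (add_le_add (hC3 x hx) (hC4 x hx))
      rw [← mul_add]
      have := growth_pos hx
      gcongr
      refine (norm_add_le _ _).trans (le_of_eq ?_)
      rw [Pi.smul_apply, smul_eq_mul, mul_assoc]
  rw [setIntegral_congr_fun isOpen_openOrthant.measurableSet key,
    integral_add (integrable_tame_mul (hF.laguerreTerm j) 0 ha)
      ((integrable_tame_mul hF 0 ha).const_mul _), integral_const_mul] at hz
  linear_combination hz

theorem integral_laguerreOp_mul {F : (Fin d → ℝ) → ℂ} (hF : Tame F) (n : Fin d → ℕ) :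
    ∫ x, laguerreOp F x * (lagFun 0 n x : ℂ) ∂orthantMeasure d =
      (tot n : ℂ) * ∫ x, F x * (lagFun 0 n x : ℂ) ∂orthantMeasure d := by
  have e : ∀ x, laguerreOp F x * (lagFun 0 n x : ℂ) =
      -∑ j, laguerreTerm j F x * (lagFun 0 n x : ℂ) := fun x => by
    rw [laguerreOp_eq_sum, neg_mul, Finset.sum_mul]
  simp only [e]
  rw [integral_neg, integral_finsetSum]
  · rw [Finset.sum_congr rfl fun j _ => integral_laguerreTerm_mul hF n j, ← Finset.sum_mul]
    push_cast
    rw [Finset.sum_neg_distrib]; ring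
  · intro j _
    have := integrable_tame_mul (hF.laguerreTerm j) 0 (rapid_single n)
    simpa only [lagSeries_single] using this

theorem integral_iterate_laguerreOp_mul {F : (Fin d → ℝ) → ℂ} (hF : Tame F) (n : Fin d → ℕ)
    (N : ℕ) : ∫ x, (laguerreOp^[N] F) x * (lagFun 0 n x : ℂ) ∂orthantMeasure d =
      (tot n : ℂ) ^ N * ∫ x, F x * (lagFun 0 n x : ℂ) ∂orthantMeasure d := by
  induction N with
  | zero => simp
  | succ N ih =>
    rw [Function.iterate_succ_apply', integral_laguerreOp_mul (hF.iterate_laguerreOp N), ih]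
    ring

end Integration

/-! ### Orthonormality and Laguerre coefficients -/

section Orthonormal

theorem exists_bound_lagD_mul (p q m n : ℕ) : ∃ C : ℝ, ∀ x : ℝ, 0 ≤ x →
    (1 + x) ^ 2 * |lagD p m x * lagD q n x| ≤ C := by
  obtain ⟨A, hA, r, h1⟩ := exists_bound_lagD 2 p
  obtain ⟨B, hB, s, h2⟩ := exists_bound_lagD 0 q
  refine ⟨(A * (1 + m) ^ r) * (B * (1 + n) ^ s), fun x hx => ?_⟩
  have h3 := h2 n x hx
  rw [pow_zero, one_mul] at h3
  rw [abs_mul, ← mul_assoc]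
  exact mul_le_mul (h1 m x hx) h3 (abs_nonneg _) (by positivity)

theorem continuous_lagD (p n : ℕ) : Continuous (lagD p n) :=
  continuous_iff_continuousAt.2 fun x => (hasDerivAt_lagD p n x).continuousAt

theorem integrableOn_lagD_mul (p q m n : ℕ) :
    IntegrableOn (fun x => lagD p m x * lagD q n x) (Set.Ioi 0) := by
  obtain ⟨C, hC⟩ := exists_bound_lagD_mul p q m n
  refine (integrableOn_one_add_sq_inv.const_mul C).mono'
    ((continuous_lagD p m).mul (continuous_lagD q n)).aestronglyMeasurable
    (ae_restrict_of_forall_mem measurableSet_Ioi fun x hx => ?_)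
  have : 0 < 1 + x := by linarith [hx.out]
  rw [← div_eq_mul_inv, le_div_iff₀' (by positivity)]
  exact hC x hx.out.le

/-- `x` times the Wronskian of the two functions has derivative `(n - m) ℓ_m ℓ_n` and vanishes at
both ends of the half-line. -/
theorem integral_lagD_mul_of_ne {m n : ℕ} (h : m ≠ n) :
    ∫ x in Set.Ioi 0, lagD 0 m x * lagD 0 n x = 0 := by
  obtain ⟨A, hA⟩ := exists_bound_lagD_mul 1 0 m n
  obtain ⟨B, hB⟩ := exists_bound_lagD_mul 0 1 m n
  have h0 := integral_Ioi_eq_zero_of_hasDerivAt (C := A + B)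
    (g := fun x => x * (lagD 1 m x * lagD 0 n x - lagD 0 m x * lagD 1 n x))
    (g' := fun x => ((n : ℝ) - m) * (lagD 0 m x * lagD 0 n x)) (fun x _ => by
      refine ((hasDerivAt_id x).mul (((hasDerivAt_lagD 1 m x).mul (hasDerivAt_lagD 0 n x)).sub
        ((hasDerivAt_lagD 0 m x).mul (hasDerivAt_lagD 1 n x)))).congr_deriv ?_
      have h1 := lagD_ode m x
      have h2 := lagD_ode n x
      simp only [id, Pi.mul_apply, Pi.sub_apply, zero_add]
      norm_num
      linear_combination lagD 0 n x * h1 - lagD 0 m x * h2)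
    ((integrableOn_lagD_mul 0 0 m n).const_mul _) fun x hx => by
      rw [norm_mul, Real.norm_eq_abs, Real.norm_eq_abs, abs_of_pos hx, mul_left_comm, mul_comm]
      refine mul_le_mul_of_nonneg_right ?_ hx.le
      refine le_trans ?_ (add_le_add (hA x hx.le) (hB x hx.le))
      rw [← mul_add]
      gcongr
      exact abs_sub _ _
  rw [integral_const_mul, mul_eq_zero, sub_eq_zero] at h0
  exact h0.resolve_left fun e => h (by exact_mod_cast e.symm)

/-- Integrating `(ℓ_n²)' = 2 ℓ_n' ℓ_n` gives `-ℓ_n(0)² = -1`. As `ℓ_n' = -ℓ_n/2` minus functions of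
lower index, orthogonality leaves `-∫ ℓ_n²` on the other side. -/
theorem integral_lagD_sq (n : ℕ) : ∫ x in Set.Ioi 0, lagD 0 n x * lagD 0 n x = 1 := by
  obtain ⟨A, hA⟩ := exists_bound_lagD_mul 0 0 n n
  have ht : Tendsto (fun x => lagD 0 n x * lagD 0 n x) atTop (𝓝 0) := by
    have ht : Tendsto (fun t : ℝ => A * t⁻¹) atTop (𝓝 0) := by
      simpa using tendsto_inv_atTop_zero.const_mul A
    refine squeeze_zero_norm' ?_ ht
    filter_upwards [eventually_gt_atTop 0] with t ht
    rw [← div_eq_mul_inv, le_div_iff₀' ht]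
    refine le_trans ?_ (hA t ht.le)
    rw [Real.norm_eq_abs]
    gcongr
    nlinarith
  have hi : IntegrableOn (fun x => 2 * (lagD 1 n x * lagD 0 n x)) (Set.Ioi 0) :=
    (integrableOn_lagD_mul 1 0 n n).const_mul 2
  have h1 := integral_Ioi_of_hasDerivAt_of_tendsto' (a := 0)
    (f' := fun x => 2 * (lagD 1 n x * lagD 0 n x)) (fun x _ =>
      ((hasDerivAt_lagD 0 n x).mul (hasDerivAt_lagD 0 n x)).congr_deriv (by ring)) hi ht
  have e0 : lagD 0 n 0 = 1 := by simp [lagD, eval_lagPoly_zero]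
  rw [integral_const_mul, Pi.mul_apply, e0] at h1
  have e1 : ∀ x, lagD 1 n x * lagD 0 n x = -(1 / 2) * (lagD 0 n x * lagD 0 n x) -
      ∑ i ∈ Finset.range n, lagD 0 i x * lagD 0 n x := fun x => by
    rw [← Finset.sum_mul]
    change (-lagD 0 n x / 2 - ∑ i ∈ Finset.range n, lagD 0 i x) * lagD 0 n x = _
    ring
  simp only [e1] at h1
  rw [integral_sub ((integrableOn_lagD_mul 0 0 n n).const_mul _)
    (integrable_finsetSum _ fun i _ => integrableOn_lagD_mul 0 0 i n),
    integral_finsetSum _ fun i _ => integrableOn_lagD_mul 0 0 i n, integral_const_mul,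
    Finset.sum_eq_zero fun i hi => integral_lagD_mul_of_ne (Finset.mem_range.1 hi).ne] at h1
  linarith

variable {d : ℕ}

theorem integral_lagFun_mul (m n : Fin d → ℕ) :
    ∫ x, lagFun 0 m x * lagFun 0 n x ∂orthantMeasure d = if m = n then 1 else 0 := by
  simp only [lagFun, ← Finset.prod_mul_distrib]
  rw [orthantMeasure_eq_pi, integral_fintype_prod_eq_prod
    (f := fun i t => lagD ((0 : Fin d → ℕ) i) (m i) t * lagD ((0 : Fin d → ℕ) i) (n i) t)]
  split_ifs with h
  · subst h
    exact Finset.prod_eq_one fun i _ => integral_lagD_sq _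
  · obtain ⟨i, hi⟩ := Function.ne_iff.1 h
    exact Finset.prod_eq_zero (Finset.mem_univ i) (integral_lagD_mul_of_ne hi)

theorem continuousOn_lagFun (p n : Fin d → ℕ) (s : Set (Fin d → ℝ)) :
    ContinuousOn (fun x => (lagFun p n x : ℂ)) s := by
  have : Continuous (lagFun p n) :=
    continuous_finsetProd _ fun i _ => (continuous_lagD _ _).comp (continuous_apply i)
  exact (Complex.continuous_ofReal.comp this).continuousOn

theorem exists_growth_sq_bound_lagFun (n : Fin d → ℕ) :
    ∃ C : ℝ, ∀ x ∈ openOrthant d, growth x ^ 2 * ‖(lagFun 0 n x : ℂ)‖ ≤ C := by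
  obtain ⟨C, _, m, h⟩ := exists_bound_lagFun 2 (0 : Fin d → ℕ)
  exact ⟨_, fun x hx => by
    rw [Complex.norm_real, Real.norm_eq_abs]
    exact h n x (openOrthant_subset_closedOrthant hx)⟩

theorem integral_norm_lagFun_sq (n : Fin d → ℕ) :
    ∫ x, ‖(lagFun 0 n x : ℂ)‖ ^ 2 ∂orthantMeasure d = 1 := by
  have := integral_lagFun_mul n n
  rw [if_pos rfl] at this
  rw [← this]
  refine integral_congr_ae (Eventually.of_forall fun x => ?_)
  simp only [Complex.norm_real, Real.norm_eq_abs, sq_abs]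
  ring

theorem norm_integral_mul_lagFun_le {F : (Fin d → ℝ) → ℂ} (hF : MemLp F 2 (orthantMeasure d))
    (n : Fin d → ℕ) : ‖∫ x, F x * (lagFun 0 n x : ℂ) ∂orthantMeasure d‖ ≤ l2Norm F := by
  have hm : AEStronglyMeasurable (fun x => (lagFun 0 n x : ℂ)) (orthantMeasure d) :=
    (continuousOn_lagFun 0 n _).aestronglyMeasurable isOpen_openOrthant.measurableSet
  have hl : MemLp (fun x => (lagFun 0 n x : ℂ)) 2 (orthantMeasure d) := by
    rw [memLp_two_iff_integrable_sq_norm hm]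
    -- A non-integrable function has Bochner integral `0`, whereas this integral is `1`.
    by_contra hc
    have := integral_norm_lagFun_sq n
    rw [integral_undef hc] at this
    exact zero_ne_one this
  have e2 : ENNReal.ofReal 2 = 2 := by simp
  have h1 := integral_mul_norm_le_Lp_mul_Lq (μ := orthantMeasure d) Real.HolderConjugate.two_two
    (by rw [e2]; exact hF) (by rw [e2]; exact hl)
  have h2 : l2Norm F = (∫ x, ‖F x‖ ^ (2 : ℝ) ∂orthantMeasure d) ^ (1 / (2 : ℝ)) := by
    rw [l2Norm, hF.eLpNorm_eq_integral_rpow_norm (by norm_num) (by norm_num), ENNReal.toReal_ofReal]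
    · norm_num
    · exact Real.rpow_nonneg (integral_nonneg fun x => by positivity) _
  have h3 : ∫ x, ‖(lagFun 0 n x : ℂ)‖ ^ (2 : ℝ) ∂orthantMeasure d = 1 := by
    rw [← integral_norm_lagFun_sq n]
    norm_num
  rw [h3, Real.one_rpow, mul_one, ← h2] at h1
  refine (norm_integral_le_integral_norm _).trans (le_trans (le_of_eq ?_) h1)
  simp only [norm_mul]

/-- Sum and integral may be interchanged, since `g` is integrable and the Laguerre functions are
bounded polynomially in the index. -/
theorem integral_mul_lagSeries {g : (Fin d → ℝ) → ℂ} (hg : ContinuousOn g (openOrthant d)) {C : ℝ}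
    (hC : ∀ x ∈ openOrthant d, growth x ^ 2 * ‖g x‖ ≤ C) {a : (Fin d → ℕ) → ℂ} (ha : Rapid a) :
    ∫ x, g x * lagSeries 0 a x ∂orthantMeasure d =
      ∑' n, a n * ∫ x, g x * (lagFun 0 n x : ℂ) ∂orthantMeasure d := by
  obtain ⟨K, hK, m, h⟩ := exists_bound_lagFun' (0 : Fin d → ℕ)
  have hgi := integrable_of_growth_bound hg hC
  have hb : ∀ n x, x ∈ openOrthant d → ‖a n * (g x * (lagFun 0 n x : ℂ))‖ ≤
      K * (‖a n‖ * (1 + (tot n : ℝ)) ^ m) * ‖g x‖ := by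
    intro n x hx
    rw [mul_left_comm, norm_mul, mul_comm]
    gcongr
    exact norm_term_le _ (h n x (openOrthant_subset_closedOrthant hx))
  have hb' : ∀ n, ∀ᵐ x ∂orthantMeasure d, ‖a n * (g x * (lagFun 0 n x : ℂ))‖ ≤
      K * (‖a n‖ * (1 + (tot n : ℝ)) ^ m) * ‖g x‖ := fun n =>
    ae_restrict_of_forall_mem isOpen_openOrthant.measurableSet (hb n)
  have hint : ∀ n, Integrable (fun x => a n * (g x * (lagFun 0 n x : ℂ))) (orthantMeasure d) :=
    fun n => (hgi.norm.const_mul _).mono' ((continuousOn_const.mul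
      (hg.mul (continuousOn_lagFun 0 n _))).aestronglyMeasurable isOpen_openOrthant.measurableSet)
      (hb' n)
  have hs : Summable fun n => ∫ x, ‖a n * (g x * (lagFun 0 n x : ℂ))‖ ∂orthantMeasure d := by
    refine Summable.of_nonneg_of_le (fun n => integral_nonneg fun x => norm_nonneg _) (fun n => ?_)
      (((ha m).mul_left K).mul_right (∫ x, ‖g x‖ ∂orthantMeasure d))
    rw [← integral_const_mul]
    exact integral_mono_ae (hint n).norm (hgi.norm.const_mul _) (hb' n)
  have h2 := hasSum_integral_of_summable_integral_norm hint hs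
  simp only [integral_const_mul] at h2
  rw [h2.tsum_eq]
  refine integral_congr_ae (Eventually.of_forall fun x => ?_)
  simp only [lagSeries]
  rw [← tsum_mul_left]
  exact tsum_congr fun n => by ring

theorem integral_lagSeries_mul_lagFun {a : (Fin d → ℕ) → ℂ} (ha : Rapid a) (n : Fin d → ℕ) :
    ∫ x, lagSeries 0 a x * (lagFun 0 n x : ℂ) ∂orthantMeasure d = a n := by
  obtain ⟨C, hC⟩ := exists_growth_sq_bound_lagFun n
  have h := integral_mul_lagSeries (continuousOn_lagFun 0 n _) hC ha
  simp only [mul_comm (lagSeries 0 a _)]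
  rw [h, tsum_eq_single n]
  · have := congrArg (fun t : ℝ => (t : ℂ)) (integral_lagFun_mul n n)
    simp only [if_true] at this
    rw [← integral_complex_ofReal] at this
    push_cast at this
    rw [this, mul_one]
  · intro m hm
    have := congrArg (fun t : ℝ => (t : ℂ)) (integral_lagFun_mul n m)
    simp only [if_neg hm.symm] at this
    rw [← integral_complex_ofReal] at this
    push_cast at this
    rw [this, mul_zero]

end Orthonormal

/-! ### Exponentials determine an integrable function -/

section Completeness
variable {d : ℕ}

theorem isClosed_closedOrthant : IsClosed (closedOrthant d) := by
  have : closedOrthant d = ⋂ i, {x | 0 ≤ x i} := by ext; simp [closedOrthant]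
  rw [this]
  exact isClosed_iInter fun i => isClosed_le continuous_const (continuous_apply i)

theorem abs_exp_neg_sum_le (k : Fin d → ℕ) (x : closedOrthant d) :
    ‖Real.exp (-∑ i, (k i : ℝ) * x.1 i)‖ ≤ 1 := by
  rw [Real.norm_eq_abs, Real.abs_exp, Real.exp_le_one_iff]
  exact neg_nonpos.2 (Finset.sum_nonneg fun i _ => mul_nonneg (Nat.cast_nonneg _) (x.2 i))

/-- The function `exp (-(k · x))` on the closed orthant. -/
def expOrthant (k : Fin d → ℕ) : BoundedContinuousFunction (closedOrthant d) ℝ :=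
  BoundedContinuousFunction.ofNormedAddCommGroup (fun x => Real.exp (-∑ i, (k i : ℝ) * x.1 i))
    (Real.continuous_exp.comp (continuous_finsetSum _ fun i _ => continuous_const.mul
      ((continuous_apply i).comp continuous_subtype_val)).neg) 1 (abs_exp_neg_sum_le k)

theorem expOrthant_apply (k : Fin d → ℕ) (x : closedOrthant d) :
    expOrthant k x = Real.exp (-∑ i, (k i : ℝ) * x.1 i) := rfl

theorem expOrthant_add (k l : Fin d → ℕ) :
    expOrthant (k + l) = expOrthant k * expOrthant l := by
  ext x
  rw [BoundedContinuousFunction.mul_apply, expOrthant_apply, expOrthant_apply, expOrthant_apply,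
    ← Real.exp_add, ← neg_add, ← Finset.sum_add_distrib]
  congr 2
  refine Finset.sum_congr rfl fun i _ => ?_
  rw [Pi.add_apply]; push_cast; ring

theorem expOrthant_zero : expOrthant (0 : Fin d → ℕ) = 1 := by
  ext x
  rw [expOrthant_apply]; simp

variable (d) in
/-- The algebra generated by the functions `exp (-(k · x))`. -/
def expAlgebra : StarSubalgebra ℝ (BoundedContinuousFunction (closedOrthant d) ℝ) where
  toSubalgebra := Algebra.adjoin ℝ (Set.range expOrthant)
  star_mem' := fun {a} ha => by
    have : star a = a := by ext x; simp
    rw [this]; exact ha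

/-- Products of the functions `e^{-k·x}` are again of this form, so the algebra they generate is
just their linear span, and vanishing integrals only need to be checked on the exponentials. -/
theorem mem_span_of_mem_expAlgebra {g : BoundedContinuousFunction (closedOrthant d) ℝ}
    (hg : g ∈ expAlgebra d) : g ∈ Submodule.span ℝ (Set.range (expOrthant (d := d))) := by
  have h : g ∈ Subalgebra.toSubmodule (Algebra.adjoin ℝ (Set.range (expOrthant (d := d)))) := hg
  rw [Algebra.adjoin_eq_span] at h
  refine Submodule.span_mono ?_ h
  intro u hu
  induction hu using Submonoid.closure_induction with
  | mem u hu => exact hu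
  | one => exact ⟨0, expOrthant_zero⟩
  | mul u v _ _ hu hv =>
    obtain ⟨k, rfl⟩ := hu
    obtain ⟨l, rfl⟩ := hv
    exact ⟨k + l, expOrthant_add k l⟩

theorem separatesPoints_expAlgebra :
    ((expAlgebra d).map (BoundedContinuousFunction.toContinuousMapStarₐ ℝ)).SeparatesPoints := by
  intro x y hxy
  obtain ⟨i, hi⟩ := Function.ne_iff.1 (fun h => hxy (Subtype.ext h))
  refine ⟨expOrthant (Pi.single i 1), ⟨_, ⟨expOrthant (Pi.single i 1), ?_, rfl⟩, rfl⟩, ?_⟩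
  · exact Algebra.subset_adjoin ⟨_, rfl⟩
  · rw [expOrthant_apply, expOrthant_apply, Ne, Real.exp_eq_exp, neg_inj]
    simpa [Pi.single_apply] using hi

/-- The measures with densities `f⁺` and `f⁻` are finite and have equal integrals against an algebra
of bounded continuous functions that separates points. On a Polish space they must coincide, so `f⁺
= f⁻` almost everywhere, and hence both vanish. -/
theorem ae_eq_zero_of_integral_mul_expOrthant {ρ : Measure (closedOrthant d)} {f : closedOrthant d → ℝ} (hf : Integrable f ρ)
    (h : ∀ k : Fin d → ℕ, ∫ x, f x * expOrthant k x ∂ρ = 0) : f =ᵐ[ρ] 0 := by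
  have : PolishSpace (closedOrthant d) := isClosed_closedOrthant.polishSpace
  set P := ρ.withDensity fun x => ENNReal.ofReal (f x) with hP
  set P' := ρ.withDensity fun x => ENNReal.ofReal (-f x) with hP'
  have : IsFiniteMeasure P := isFiniteMeasure_withDensity_ofReal hf.2
  have : IsFiniteMeasure P' := isFiniteMeasure_withDensity_ofReal hf.neg.2
  have m1 : AEMeasurable (fun x => ENNReal.ofReal (f x)) ρ := hf.1.aemeasurable.ennreal_ofReal
  have m2 : AEMeasurable (fun x => ENNReal.ofReal (-f x)) ρ :=
    hf.1.aemeasurable.neg.ennreal_ofReal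
  have heq : ∀ k, ∫ x, expOrthant (d := d) k x ∂P = ∫ x, expOrthant (d := d) k x ∂P' := by
    intro k
    rw [hP, hP', integral_withDensity_eq_integral_toReal_smul₀ m1 (by simp),
      integral_withDensity_eq_integral_toReal_smul₀ m2 (by simp), ← sub_eq_zero]
    simp only [ENNReal.toReal_ofReal', smul_eq_mul]
    have hb : ∀ᵐ x ∂ρ, ‖expOrthant k x‖ ≤ 1 := Eventually.of_forall (abs_exp_neg_sum_le k)
    have hm : AEStronglyMeasurable (expOrthant (d := d) k) ρ :=
      (expOrthant k).continuous.aestronglyMeasurable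
    rw [← integral_sub (hf.pos_part.mul_bdd hm hb) (hf.neg_part.mul_bdd hm hb)]
    refine Eq.trans (integral_congr_ae ?_) (h k)
    refine Eventually.of_forall fun x => ?_
    simp only
    rw [← sub_mul]
    congr 1
    rcases le_total 0 (f x) with h0 | h0
    · rw [max_eq_left h0, max_eq_right (by linarith), sub_zero]
    · rw [max_eq_right h0, max_eq_left (by linarith)]; ring
  have hPP : P = P' := by
    have hspan : ∀ g ∈ Submodule.span ℝ (Set.range (expOrthant (d := d))),
        ∫ x, g x ∂P = ∫ x, g x ∂P' := by
      intro g hg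
      induction hg using Submodule.span_induction with
      | mem g hg =>
        obtain ⟨k, rfl⟩ := hg
        exact heq k
      | zero => simp
      | add u v _ _ h1 h2 =>
        simp only [BoundedContinuousFunction.add_apply]
        rw [integral_add (u.integrable P) (v.integrable P),
          integral_add (u.integrable P') (v.integrable P'), h1, h2]
      | smul c u _ h1 =>
        simp only [BoundedContinuousFunction.smul_apply]
        rw [integral_smul, integral_smul, h1]
    exact ext_of_forall_mem_subalgebra_integral_eq_of_polish separatesPoints_expAlgebra
      (𝕜 := ℝ) fun g hg => hspan g (mem_span_of_mem_expAlgebra hg)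
  rw [hP, hP', withDensity_eq_iff m1 m2 (by
    rw [← setLIntegral_univ, ← withDensity_apply _ MeasurableSet.univ]; exact measure_ne_top P _)] at hPP
  filter_upwards [hPP] with x hx
  rcases le_total 0 (f x) with h0 | h0
  · rw [ENNReal.ofReal_of_nonpos (by linarith : -f x ≤ 0), ENNReal.ofReal_eq_zero] at hx
    exact le_antisymm hx h0
  · rw [ENNReal.ofReal_of_nonpos h0, eq_comm, ENNReal.ofReal_eq_zero] at hx
    have : 0 ≤ f x := by linarith
    exact le_antisymm h0 this

end Completeness

/-! ### Completeness of the Laguerre functions and reconstruction from coefficients -/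

section Reconstruction
variable {d : ℕ}

theorem ae_eq_zero_of_integral_mul_exp {f : (Fin d → ℝ) → ℝ} (hf : Integrable f (orthantMeasure d))
    (h : ∀ k : Fin d → ℕ, ∫ x, f x * Real.exp (-∑ i, (k i : ℝ) * x i) ∂orthantMeasure d = 0) :
    f =ᵐ[orthantMeasure d] 0 := by
  have he : MeasurableEmbedding (Subtype.val : closedOrthant d → Fin d → ℝ) :=
    MeasurableEmbedding.subtype_coe isClosed_closedOrthant.measurableSet
  have hmap : ((orthantMeasure d).comap (Subtype.val : closedOrthant d → Fin d → ℝ)).map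
      Subtype.val = orthantMeasure d := by
    rw [he.map_comap, Subtype.range_coe, orthantMeasure,
      Measure.restrict_restrict isClosed_closedOrthant.measurableSet,
      Set.inter_eq_self_of_subset_right openOrthant_subset_closedOrthant]
  rw [← hmap, EventuallyEq, he.ae_map_iff]
  rw [← hmap, he.integrable_map_iff] at hf
  refine ae_eq_zero_of_integral_mul_expOrthant hf fun k => ?_
  have := h k
  rw [← hmap, he.integral_map] at this
  exact this

/-- On a box the sum of the products is the product of the partial sums. The boxes are cofinal among
finite sets, so summability identifies the limit. -/
theorem hasSum_pi_prod {f : Fin d → ℕ → ℝ} {s : Fin d → ℝ} (hf : ∀ i, HasSum (f i) (s i))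
    (hs : Summable fun n : Fin d → ℕ => ∏ i, f i (n i)) :
    HasSum (fun n : Fin d → ℕ => ∏ i, f i (n i)) (∏ i, s i) := by
  have h1 : Tendsto (fun M : ℕ => Fintype.piFinset fun _ : Fin d => Finset.range M) atTop atTop := by
    refine tendsto_atTop_finset_of_monotone (fun M N h => Fintype.piFinset_subset _ _ fun _ =>
      Finset.range_subset_range.2 h) fun n => ⟨tot n + 1, ?_⟩
    rw [Fintype.mem_piFinset]
    exact fun i => Finset.mem_range.2 (Nat.lt_succ_of_le
      (Finset.single_le_sum (fun _ _ => Nat.zero_le _) (Finset.mem_univ i)))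
  have h2 := hs.hasSum.comp h1
  have h3 : Tendsto (fun M : ℕ => ∏ i, ∑ k ∈ Finset.range M, f i k) atTop (𝓝 (∏ i, s i)) :=
    tendsto_finsetProd _ fun i _ => (hf i).tendsto_sum_nat
  have h4 : ∏ i, s i = ∑' n : Fin d → ℕ, ∏ i, f i (n i) := by
    refine tendsto_nhds_unique h3 (h2.congr fun M => ?_)
    rw [Finset.prod_univ_sum]; rfl
  rw [h4]
  exact hs.hasSum

theorem exists_pow_le_exp (k : ℕ) {h s : ℝ} (hh : 0 < h) (hs : 0 < s) :
    ∃ C : ℝ, 0 ≤ C ∧ ∀ m : ℕ, (1 + (m : ℝ)) ^ k ≤ C * Real.exp (h * (m : ℝ) ^ s) := by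
  have ht : Tendsto (fun m : ℕ => ((m : ℝ) ^ s) ^ ((k : ℕ) / s : ℝ) *
      Real.exp (-h * (m : ℝ) ^ s)) atTop (𝓝 0) :=
    (tendsto_rpow_mul_exp_neg_mul_atTop_nhds_zero _ h hh).comp
      ((tendsto_rpow_atTop hs).comp tendsto_natCast_atTop_atTop)
  obtain ⟨B, hB⟩ := ht.bddAbove_range
  refine ⟨max 1 (2 ^ k * B), le_max_of_le_left zero_le_one, fun m => ?_⟩
  rw [← div_le_iff₀ (Real.exp_pos _), div_eq_mul_inv, ← Real.exp_neg]
  rcases Nat.eq_zero_or_pos m with rfl | hm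
  · refine le_max_of_le_left ?_
    simp [Real.zero_rpow hs.ne']
  · refine le_max_of_le_right ?_
    have hB' := hB ⟨m, rfl⟩
    simp only at hB'
    rw [← Real.rpow_mul (Nat.cast_nonneg m), mul_div_cancel₀ _ hs.ne', Real.rpow_natCast,
      neg_mul] at hB'
    have hm' : (1 : ℝ) ≤ m := by exact_mod_cast hm
    calc (1 + (m : ℝ)) ^ k * Real.exp (-(h * (m : ℝ) ^ s))
        ≤ (2 * (m : ℝ)) ^ k * Real.exp (-(h * (m : ℝ) ^ s)) := by
          gcongr; linarith
      _ = 2 ^ k * ((m : ℝ) ^ k * Real.exp (-(h * (m : ℝ) ^ s))) := by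
          rw [mul_pow]; ring
      _ ≤ _ := by gcongr

theorem rapid_of_le_exp {h s C : ℝ} (hh : 0 < h) (hs : 0 < s) {a : (Fin d → ℕ) → ℂ}
    (ha : ∀ n, ‖a n‖ ≤ C * Real.exp (-(h * (tot n : ℝ) ^ s))) : Rapid a := by
  intro k
  obtain ⟨B, hB0, hB⟩ := exists_pow_le_exp k (half_pos hh) hs
  refine Summable.of_nonneg_of_le (fun n => by positivity) (fun n => ?_)
    ((summable_exp_neg (half_pos hh) hs).mul_left (C * B))
  calc ‖a n‖ * (1 + (tot n : ℝ)) ^ k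
      ≤ (C * Real.exp (-(h * (tot n : ℝ) ^ s))) * (B * Real.exp (h / 2 * (tot n : ℝ) ^ s)) :=
        mul_le_mul (ha n) (hB _) (by positivity) ((norm_nonneg _).trans (ha n))
    _ = C * B * (Real.exp (-(h * (tot n : ℝ) ^ s)) * Real.exp (h / 2 * (tot n : ℝ) ^ s)) := by ring
    _ = _ := by rw [← Real.exp_add]; congr 2; ring

/-- The geometric families whose Laguerre series are exponentials. -/
def geomSeq (k n : Fin d → ℕ) : ℝ := ∏ i, ((k i : ℝ) / (1 + k i)) ^ n i

theorem rapid_geomSeq (k : Fin d → ℕ) : Rapid fun n => (geomSeq k n : ℂ) := by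
  have h0 : (0 : ℝ) < 1 / (1 + (tot k : ℝ)) := by positivity
  refine rapid_of_le_exp (C := 1) h0 zero_lt_one fun n => ?_
  rw [Complex.norm_real, Real.norm_eq_abs, one_mul, geomSeq, Finset.abs_prod, Real.rpow_one]
  have e : Real.exp (-(1 / (1 + (tot k : ℝ)) * (tot n : ℝ))) =
      ∏ i, Real.exp (-(1 / (1 + (tot k : ℝ)))) ^ n i := by
    rw [Finset.prod_pow_eq_pow_sum, ← Real.exp_nat_mul]
    congr 1; ring
  rw [e]
  refine Finset.prod_le_prod (fun i _ => abs_nonneg _) fun i _ => ?_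
  have hk : (k i : ℝ) ≤ (tot k : ℕ) := by
    exact_mod_cast Finset.single_le_sum (fun _ _ => Nat.zero_le _) (Finset.mem_univ i)
  rw [abs_of_nonneg (by positivity)]
  refine pow_le_pow_left₀ (by positivity) ?_ _
  refine le_trans ?_ (Real.add_one_le_exp _)
  have h1 : (k i : ℝ) / (1 + k i) = 1 - 1 / (1 + k i) := by field_simp; ring
  have h2 : 1 / (1 + (tot k : ℝ)) ≤ 1 / (1 + (k i : ℝ)) := by gcongr
  linarith

/-- The choice `t = k/(1+k)` in the generating function makes `t/(1-t) = k` and `1/(1-t) = 1 + k`.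
-/
theorem lagSeries_geomSeq (k : Fin d → ℕ) {x : Fin d → ℝ} (hx : x ∈ closedOrthant d) :
    lagSeries 0 (fun n => (geomSeq k n : ℂ)) x =
      (((∏ i, (1 + (k i : ℝ))) * Real.exp (-∑ i, (k i : ℝ) * x i) *
        Real.exp (-∑ i, x i / 2) : ℝ) : ℂ) := by
  have hs := summable_lagSeries 0 (rapid_geomSeq k) hx
  have e1 : ∀ n, (geomSeq k n : ℂ) * (lagFun 0 n x : ℂ) =
      ((∏ i, ((k i : ℝ) / (1 + k i)) ^ n i * lagD 0 (n i) (x i) : ℝ) : ℂ) := by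
    intro n
    rw [Finset.prod_mul_distrib, Complex.ofReal_mul]; rfl
  simp only [e1] at hs
  have h1 : ∀ i, HasSum (fun n : ℕ => ((k i : ℝ) / (1 + k i)) ^ n * lagD 0 n (x i))
      ((1 + k i) * Real.exp (-((k i : ℝ) * x i)) * Real.exp (-(x i / 2))) := by
    intro i
    have h := hasSum_lagD_generating (x i) (t := (k i : ℝ) / (1 + k i)) (by positivity)
      (by rw [div_lt_one (by positivity)]; linarith)
    have e2 : 1 - (k i : ℝ) / (1 + k i) = (1 + (k i : ℝ))⁻¹ := by field_simp; ring
    have e3 : (k i : ℝ) / (1 + k i) / (1 + (k i : ℝ))⁻¹ = k i := by field_simp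
    rw [e2, e3, inv_inv, neg_div] at h
    rwa [show -((k i : ℝ) * x i) = -x i * k i by ring]
  have h2 := hasSum_pi_prod h1 (Complex.summable_ofReal.1 hs)
  rw [lagSeries, tsum_congr e1, ← Complex.ofReal_tsum, h2.tsum_eq]
  congr 1
  rw [Finset.prod_mul_distrib, Finset.prod_mul_distrib, ← Real.exp_sum, ← Real.exp_sum,
    Finset.sum_neg_distrib, Finset.sum_neg_distrib]

/-- Integrating `g` against the series of `lagSeries_geomSeq` shows that `g e^{-Σ x_i/2}` is
orthogonal to every `e^{-k·x}`. It is therefore zero almost everywhere, and `g` is zero on the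
orthant by continuity. -/
theorem eqOn_zero_of_integral_lagFun_eq_zero {g : (Fin d → ℝ) → ℂ}
    (hg : ContinuousOn g (openOrthant d)) {C : ℝ}
    (hC : ∀ x ∈ openOrthant d, growth x ^ 2 * ‖g x‖ ≤ C)
    (h : ∀ n, ∫ x, g x * (lagFun 0 n x : ℂ) ∂orthantMeasure d = 0) :
    Set.EqOn g 0 (openOrthant d) := by
  set w : (Fin d → ℝ) → ℝ := fun x => Real.exp (-∑ i, x i / 2) with hw
  have hwc : Continuous w := by
    simp only [hw]
    exact Real.continuous_exp.comp (continuous_finsetSum _ fun i _ =>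
      (continuous_apply i).div_const 2).neg
  have hm : MeasurableSet (openOrthant d) := isOpen_openOrthant.measurableSet
  have hwb : ∀ x ∈ openOrthant d, ‖(w x : ℂ)‖ ≤ 1 := fun x hx => by
    rw [Complex.norm_real, Real.norm_eq_abs, Real.abs_exp, Real.exp_le_one_iff]
    exact neg_nonpos.2 (Finset.sum_nonneg fun i _ => div_nonneg (hx i).le zero_le_two)
  have hG : Integrable (fun x => g x * (w x : ℂ)) (orthantMeasure d) :=
    (integrable_of_growth_bound hg hC).mul_bdd
      (Complex.continuous_ofReal.comp hwc).aestronglyMeasurable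
      (ae_restrict_of_forall_mem hm hwb)
  have h1 : ∀ k : Fin d → ℕ, ∫ x, (g x * (w x : ℂ)) *
      (Real.exp (-∑ i, (k i : ℝ) * x i) : ℂ) ∂orthantMeasure d = 0 := by
    intro k
    have h2 := integral_mul_lagSeries hg hC (rapid_geomSeq k)
    simp only [h, mul_zero, tsum_zero] at h2
    rw [setIntegral_congr_fun hm fun x hx => congrArg (g x * ·)
      (lagSeries_geomSeq k (openOrthant_subset_closedOrthant hx))] at h2
    have hp : ((∏ i, (1 + (k i : ℝ)) : ℝ) : ℂ) ≠ 0 := by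
      rw [Complex.ofReal_ne_zero]
      exact Finset.prod_ne_zero_iff.2 fun i _ => by positivity
    refine (mul_eq_zero.1 (Eq.trans ?_ h2)).resolve_left hp
    rw [← integral_const_mul]
    refine integral_congr_ae (Eventually.of_forall fun x => ?_)
    simp only [Complex.ofReal_mul, hw]
    ring
  -- The uniqueness result concerns real functions; it is applied to the real and the imaginary
  -- part.
  have h3 : ∀ L : ℂ →L[ℝ] ℝ, (fun x => L (g x * (w x : ℂ))) =ᵐ[orthantMeasure d] 0 := by
    intro L
    refine ae_eq_zero_of_integral_mul_exp (L.integrable_comp hG) fun k => ?_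
    have hk : Continuous fun x : Fin d → ℝ => Real.exp (-∑ i, (k i : ℝ) * x i) :=
      Real.continuous_exp.comp (continuous_finsetSum _ fun i _ =>
        continuous_const.mul (continuous_apply i)).neg
    have hi : Integrable (fun x => (g x * (w x : ℂ)) *
        (Real.exp (-∑ i, (k i : ℝ) * x i) : ℂ)) (orthantMeasure d) := by
      refine hG.mul_bdd (c := 1) (Complex.continuous_ofReal.comp hk).aestronglyMeasurable
        (ae_restrict_of_forall_mem hm fun x hx => ?_)
      rw [Complex.norm_real]
      exact abs_exp_neg_sum_le k ⟨x, openOrthant_subset_closedOrthant hx⟩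
    have h4 := L.integral_comp_comm hi
    rw [h1 k, map_zero] at h4
    rw [← h4]
    refine integral_congr_ae (Eventually.of_forall fun x => ?_)
    simp only
    rw [mul_comm (g x * (w x : ℂ)) (Complex.ofReal _), ← Complex.real_smul, map_smul, smul_eq_mul,
      mul_comm]
  have h5 : g =ᵐ[orthantMeasure d] 0 := by
    filter_upwards [h3 Complex.reCLM, h3 Complex.imCLM] with x h1 h2
    have : g x * (w x : ℂ) = 0 := Complex.ext h1 h2
    exact (mul_eq_zero.1 this).resolve_right (by
      exact Complex.ofReal_ne_zero.2 (Real.exp_pos _).ne')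
  exact Measure.eqOn_of_ae_eq h5 hg continuousOn_const
    (by rw [isOpen_openOrthant.interior_eq]; exact subset_closure)

/-- The Laguerre coefficients of a function on the orthant. -/
def lagCoef (f : C(closedOrthant d, ℂ)) (n : Fin d → ℕ) : ℂ :=
  ∫ x, extendZero f x * (lagFun 0 n x : ℂ) ∂orthantMeasure d

/-- The difference of `f` and its Laguerre series is orthogonal to all Laguerre functions, so it
vanishes on the open orthant, which is dense in the closed one. -/
theorem eq_lagCont_of_mem_schwartzOrthant {f : C(closedOrthant d, ℂ)} (hf : f ∈ schwartzOrthant d)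
    (ha : Rapid (lagCoef f)) : f = lagCont 0 (lagCoef f) ha := by
  obtain ⟨A, hA⟩ := exists_growth_sq_bound hf
  obtain ⟨B, hB0, m, hB⟩ := exists_bound_lagSeries 2 (0 : Fin d → ℕ)
  have hs := smoothOrthant_lagSeries 0 ha
  have h := eqOn_zero_of_integral_lagFun_eq_zero
    (g := fun x => extendZero f x - lagSeries 0 (lagCoef f) x)
    (C := A + B * ∑' n, ‖lagCoef f n‖ * (1 + (tot n : ℝ)) ^ m)
    ((ContDiffOn.continuousOn hf.1).sub (ContDiffOn.continuousOn hs)) (fun x hx => by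
      refine le_trans ?_ (add_le_add (hA x hx)
        (hB _ ha x (openOrthant_subset_closedOrthant hx)))
      rw [← mul_add]
      have := growth_pos hx
      gcongr
      exact norm_sub_le _ _) fun n => by
    have h1 := integrable_tame_mul (tame_of_mem_schwartzOrthant hf) 0 (rapid_single n)
    have h2 := integrable_tame_mul (tame_lagSeries ha 0) 0 (rapid_single n)
    simp only [lagSeries_single] at h1 h2
    simp only [sub_mul]
    rw [integral_sub h1 h2, integral_lagSeries_mul_lagFun ha, lagCoef, sub_self]
  have hc := Continuous.ext_on dense_openOrthant_subtype f.continuous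
    (lagCont 0 (lagCoef f) ha).continuous fun y hy => by
      rw [← extendZero_apply f y]
      exact sub_eq_zero.1 (h hy)
  exact ContinuousMap.ext fun x => congrFun hc x

/-- Moving `E^N` to the Laguerre function produces the factor `|n|^N`; Cauchy–Schwarz with a
function of norm one does the rest. -/
theorem norm_lagCoef_mul_le {f : C(closedOrthant d, ℂ)} (hf : f ∈ schwartzOrthant d) (N : ℕ)
    (hN : MemLp (laguerrePow N f) 2 (orthantMeasure d)) (n : Fin d → ℕ) :
    ‖lagCoef f n‖ * (tot n : ℝ) ^ N ≤ l2Norm (laguerrePow N f) := by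
  have h1 := norm_integral_mul_lagFun_le hN n
  rw [laguerrePow, integral_iterate_laguerreOp_mul (tame_of_mem_schwartzOrthant hf), norm_mul,
    norm_pow, Complex.norm_natCast, mul_comm] at h1
  exact h1

theorem lagCoef_add {f g : C(closedOrthant d, ℂ)} (hf : f ∈ schwartzOrthant d)
    (hg : g ∈ schwartzOrthant d) : lagCoef (f + g) = lagCoef f + lagCoef g := by
  funext n
  have h1 := integrable_tame_mul (tame_of_mem_schwartzOrthant hf) 0 (rapid_single n)
  have h2 := integrable_tame_mul (tame_of_mem_schwartzOrthant hg) 0 (rapid_single n)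
  simp only [lagSeries_single] at h1 h2
  have h0 : extendZero ⇑(f + g) = extendZero f + extendZero g := extendZero_add f g
  rw [lagCoef, h0, Pi.add_apply, lagCoef, lagCoef, ← integral_add h1 h2]
  simp only [Pi.add_apply, add_mul]

theorem lagCoef_smul (c : ℂ) (f : C(closedOrthant d, ℂ)) : lagCoef (c • f) = c • lagCoef f := by
  funext n
  have h0 : extendZero ⇑(c • f) = c • extendZero f := extendZero_smul c f
  rw [lagCoef, h0, Pi.smul_apply, lagCoef, smul_eq_mul, ← integral_const_mul]
  simp only [Pi.smul_apply, smul_eq_mul, mul_assoc]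

end Reconstruction

/-! ### Locally convex inductive limits -/

section IndLim
variable {V : Type*} [AddCommGroup V] [Module ℂ V] {ι : Type*} {F : ι → Type*}
  [∀ i, SeminormedAddCommGroup (F i)] [∀ i, NormedSpace ℂ (F i)]

theorem indLimTopology_isTopologicalAddGroup (j : ∀ i, F i →ₗ[ℂ] V) :
    @IsTopologicalAddGroup V (indLimTopology j) _ := topologicalAddGroup_sInf fun _ h => h.1

theorem indLimTopology_continuousSMul (j : ∀ i, F i →ₗ[ℂ] V) :
    @ContinuousSMul ℂ V _ _ (indLimTopology j) := continuousSMul_sInf fun _ h => h.2.1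

theorem indLimTopology_locallyConvexSpace (j : ∀ i, F i →ₗ[ℂ] V) :
    @LocallyConvexSpace ℝ V _ _ _ _ (indLimTopology j) := LocallyConvexSpace.sInf fun _ h => h.2.2.1

theorem indLimTopology_continuous (j : ∀ i, F i →ₗ[ℂ] V) (i : ι) :
    @Continuous _ _ _ (indLimTopology j) (j i) :=
  continuous_sInf_rng.2 fun _ h => h.2.2.2 i

/-- A linear map between inductive limits is continuous if it maps each step boundedly into some
step. -/
theorem continuous_indLimTopology {W : Type*} [AddCommGroup W] [Module ℂ W] {κ : Type*}
    {G : κ → Type*} [∀ i, SeminormedAddCommGroup (G i)] [∀ i, NormedSpace ℂ (G i)]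
    (j : ∀ i, F i →ₗ[ℂ] V) (l : ∀ i, G i →ₗ[ℂ] W) (T : V →ₗ[ℂ] W)
    (h : ∀ i, ∃ k, ∃ C : ℝ, ∀ x : F i, ∃ y : G k, T (j i x) = l k y ∧ ‖y‖ ≤ C * ‖x‖) :
    @Continuous V W (indLimTopology j) (indLimTopology l) T := by
  let tW : TopologicalSpace W := indLimTopology l
  have : IsTopologicalAddGroup W := indLimTopology_isTopologicalAddGroup l
  have : ContinuousSMul ℂ W := indLimTopology_continuousSMul l
  have : LocallyConvexSpace ℝ W := indLimTopology_locallyConvexSpace l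
  rw [continuous_iff_le_induced]
  -- The topology pulled back from `W` along `T` is one of the competing topologies on `V`, so the
  -- finest of them is finer than it, and this is the continuity of `T`.
  refine sInf_le ⟨topologicalAddGroup_induced T, continuousSMul_induced T,
    LocallyConvexSpace.induced (T.restrictScalars ℝ), fun i => ?_⟩
  refine continuous_induced_rng.2 ?_
  obtain ⟨k, C, hC⟩ := h i
  refine continuous_of_continuousAt_zero (T.comp (j i)) ?_
  rw [ContinuousAt, map_zero]
  intro U hU
  have h0 : l k ⁻¹' U ∈ 𝓝 (0 : G k) :=
    (indLimTopology_continuous l k).continuousAt (by rwa [map_zero])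
  obtain ⟨ε, hε, hb⟩ := Metric.mem_nhds_iff.1 h0
  refine Filter.mem_map.2 (Metric.mem_nhds_iff.2 ⟨ε / (|C| + 1), by positivity, fun x hx => ?_⟩)
  obtain ⟨y, hy, hyC⟩ := hC x
  have hx' : ‖x‖ < ε / (|C| + 1) := by simpa using hx
  have hy' : y ∈ Metric.ball (0 : G k) ε := by
    rw [mem_ball_zero_iff]
    rw [lt_div_iff₀ (by positivity)] at hx'
    refine lt_of_le_of_lt (hyC.trans ?_) hx'
    rw [mul_comm]
    exact mul_le_mul_of_nonneg_left ((le_abs_self C).trans (by linarith)) (norm_nonneg x)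
  have := hb hy'
  change T (j i x) ∈ U
  rw [hy]; exact this

end IndLim

/-! ### The isomorphism with the sequence space -/

section Estimates
variable {d : ℕ}

/-- Powers with exponent `1/α` turn the hypothesis into `A^{1/α} y^N ≤ E^{1/α} N!` with `y =
(t/h)^{1/α}`. Dividing by `2^N N!` and summing over `N` gives `A^{1/α} e^{y/2} ≤ 2 E^{1/α}`; the
power `α` of this is the claim, whence the constants `2^α` and `α/(2 h^{1/α})`. -/
theorem le_exp_of_mul_pow_le {α h : ℝ} (hα : 0 < α) (hh : 0 < h) {A E t : ℝ} (hA : 0 ≤ A)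
    (hE : 0 ≤ E) (ht : 0 ≤ t) (H : ∀ N : ℕ, A * t ^ N ≤ E * (h ^ N * (N ! : ℝ) ^ α)) :
    A ≤ 2 ^ α * E * Real.exp (-(α / (2 * h ^ (1 / α)) * t ^ (1 / α))) := by
  set y := t ^ (1 / α) / h ^ (1 / α) with hy
  have hy0 : 0 ≤ y := by positivity
  set B := A ^ (1 / α) with hB
  set D := E ^ (1 / α) with hD
  have hB0 : 0 ≤ B := by positivity
  have hD0 : 0 ≤ D := by positivity
  have key : ∀ N : ℕ, B * y ^ N ≤ D * N ! := by
    intro N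
    have hp := Real.rpow_le_rpow (by positivity) (H N) (by positivity : 0 ≤ 1 / α)
    rw [Real.mul_rpow hA (by positivity), Real.mul_rpow hE (by positivity),
      Real.mul_rpow (by positivity) (by positivity), ← Real.rpow_mul (by positivity),
      mul_one_div_cancel hα.ne', Real.rpow_one, ← Real.rpow_natCast t, ← Real.rpow_natCast h,
      ← Real.rpow_mul ht, ← Real.rpow_mul hh.le, mul_comm (N : ℝ), Real.rpow_mul ht,
      Real.rpow_mul hh.le, Real.rpow_natCast, Real.rpow_natCast] at hp
    have hh' : 0 < (h ^ (1 / α)) ^ N := by positivity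
    rw [hy, div_pow, mul_div_assoc', div_le_iff₀ hh']
    linarith
  have hsum : B * Real.exp (y / 2) ≤ 2 * D := by
    have h1 : HasSum (fun N : ℕ => (y / 2) ^ N / N !) (Real.exp (y / 2)) := by
      rw [Real.exp_eq_exp_ℝ]; exact NormedSpace.expSeries_div_hasSum_exp (y / 2)
    have h2 : HasSum (fun N : ℕ => (1 / 2 : ℝ) ^ N) 2 := hasSum_geometric_two
    have := hasSum_le (fun N => ?_) (h1.mul_left B) (h2.mul_left D)
    · linarith
    · have hf : (0 : ℝ) < N ! := by positivity
      rw [div_pow, one_div, inv_pow]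
      have := key N
      calc B * (y ^ N / 2 ^ N / N !) = (B * y ^ N) * ((2 ^ N)⁻¹ / N !) := by ring
        _ ≤ (D * N !) * ((2 ^ N)⁻¹ / N !) := by gcongr
        _ = _ := by field_simp
  have h3 : B ≤ 2 * D * Real.exp (-(y / 2)) := by
    rw [Real.exp_neg, ← div_eq_mul_inv, le_div_iff₀ (Real.exp_pos _)]
    exact hsum
  have h4 := Real.rpow_le_rpow hB0 h3 hα.le
  rw [Real.mul_rpow (by positivity) (Real.exp_pos _).le, Real.mul_rpow zero_le_two hD0, hB, hD,
    ← Real.rpow_mul hA, ← Real.rpow_mul hE, one_div_mul_cancel hα.ne', Real.rpow_one,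
    Real.rpow_one, ← Real.exp_mul] at h4
  refine h4.trans (le_of_eq ?_)
  congr 2
  rw [hy]; field_simp

/-- The converse estimate: it is the power `α` of `s^N / N! ≤ e^s` with `s = (k/α) t^{1/α}`. -/
theorem pow_mul_exp_le {α k : ℝ} (hα : 0 < α) (hk : 0 < k) {t : ℝ} (ht : 0 ≤ t) (N : ℕ) :
    t ^ N * Real.exp (-(k * t ^ (1 / α))) ≤ ((α / k) ^ α) ^ N * (N ! : ℝ) ^ α := by
  set y := t ^ (1 / α) with hy
  have hy0 : 0 ≤ y := by positivity
  have h1 : (k / α * y) ^ N / N ! ≤ Real.exp (k / α * y) :=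
    Real.pow_div_factorial_le_exp _ (by positivity) N
  rw [div_le_iff₀ (by positivity)] at h1
  have h2 : y ^ N * Real.exp (-(k / α * y)) ≤ (α / k) ^ N * N ! := by
    rw [Real.exp_neg, ← div_eq_mul_inv, div_le_iff₀ (Real.exp_pos _)]
    calc y ^ N = (α / k) ^ N * (k / α * y) ^ N := by
          rw [← mul_pow]; congr 1; field_simp
      _ ≤ (α / k) ^ N * (Real.exp (k / α * y) * N !) := by gcongr
      _ = _ := by ring
  have h3 := Real.rpow_le_rpow (by positivity) h2 hα.le
  rw [Real.mul_rpow (by positivity) (Real.exp_pos _).le, Real.mul_rpow (by positivity)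
    (by positivity), ← Real.exp_mul] at h3
  have e1 : ∀ z : ℝ, 0 ≤ z → (z ^ N) ^ α = (z ^ α) ^ N := fun z hz => by
    rw [← Real.rpow_natCast, ← Real.rpow_mul hz, mul_comm, Real.rpow_mul hz, Real.rpow_natCast]
  rw [e1 y hy0, e1 _ (by positivity), hy, ← Real.rpow_mul ht, one_div_mul_cancel hα.ne',
    Real.rpow_one] at h3
  refine le_trans (le_of_eq ?_) h3
  congr 2
  rw [← hy]
  field_simp

theorem weight_half (α h : ℝ) (n : Fin d → ℕ) :
    weight (α / 2) h n = Real.exp (h * (tot n : ℝ) ^ (1 / α)) := by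
  rw [weight, mul_div_cancel₀ _ two_ne_zero]

theorem mul_weight_le_iff {α h c A : ℝ} (n : Fin d → ℕ) :
    c * weight (α / 2) h n ≤ A ↔ c ≤ A * Real.exp (-(h * (tot n : ℝ) ^ (1 / α))) := by
  rw [weight_half, Real.exp_neg, ← div_eq_mul_inv, le_div_iff₀ (Real.exp_pos _)]

theorem SeqStep.norm_apply_le {α h : ℝ} (a : SeqStep d (α / 2) h) (n : Fin d → ℕ) :
    ‖a.1 n‖ ≤ ‖a‖ * Real.exp (-(h * (tot n : ℝ) ^ (1 / α))) :=
  (mul_weight_le_iff n).1 (le_ciSup a.2 n)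

theorem mem_seqStepSubmodule_of_le {α h A : ℝ} {a : (Fin d → ℕ) → ℂ}
    (ha : ∀ n, ‖a n‖ ≤ A * Real.exp (-(h * (tot n : ℝ) ^ (1 / α)))) :
    a ∈ seqStepSubmodule d (α / 2) h :=
  ⟨A, by rintro _ ⟨n, rfl⟩; exact (mul_weight_le_iff n).2 (ha n)⟩

theorem SeqStep.norm_le_of_le {α h A : ℝ} (a : SeqStep d (α / 2) h)
    (ha : ∀ n, ‖a.1 n‖ ≤ A * Real.exp (-(h * (tot n : ℝ) ^ (1 / α)))) : ‖a‖ ≤ A :=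
  ciSup_le fun n => (mul_weight_le_iff n).2 (ha n)

theorem rapid_of_mem_seqSubmodule {α : ℝ} (hα : 0 < α) {a : (Fin d → ℕ) → ℂ}
    (ha : a ∈ seqSubmodule d (α / 2)) : Rapid a := by
  obtain ⟨h, ha⟩ := ha
  exact rapid_of_le_exp h.2 (one_div_pos.2 hα) fun n =>
    SeqStep.norm_apply_le (⟨a, ha⟩ : SeqStep d (α / 2) h) n

theorem PStep.l2Norm_le {α : ℝ} {h : PosReal} (f : PStep d α h) (N : ℕ) :
    l2Norm (laguerrePow N f.1) ≤ ‖f‖ * ((h : ℝ) ^ N * (N ! : ℝ) ^ α) := by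
  rw [← div_le_iff₀ (etaDenom_pos α h N)]
  exact le_ciSup f.2.2.2 N

theorem PStep.norm_lagCoef_le {α : ℝ} (hα : 0 < α) {h : PosReal} (f : PStep d α h)
    (n : Fin d → ℕ) : ‖lagCoef f.1 n‖ ≤ 2 ^ α * ‖f‖ *
      Real.exp (-(α / (2 * (h : ℝ) ^ (1 / α)) * (tot n : ℝ) ^ (1 / α))) :=
  le_exp_of_mul_pow_le hα h.2 (norm_nonneg _) (norm_nonneg _) (Nat.cast_nonneg _) fun N =>
    (norm_lagCoef_mul_le f.2.1 N (f.2.2.1 N) n).trans (f.l2Norm_le N)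

/-- The map taking a function to its Laguerre coefficients. -/
def coefMap {α : ℝ} (hα : 0 < α) : PSpace d α →ₗ[ℂ] SeqSpace d (α / 2) where
  toFun f := ⟨lagCoef f.1, by
    obtain ⟨h, hf⟩ := f.2
    refine ⟨⟨α / (2 * (h : ℝ) ^ (1 / α)), ?_⟩, mem_seqStepSubmodule_of_le
      (PStep.norm_lagCoef_le hα (⟨f.1, hf⟩ : PStep d α h))⟩
    have := Real.rpow_pos_of_pos h.2 (1 / α)
    positivity⟩
  map_add' f g := by
    obtain ⟨h, hf⟩ := f.2
    obtain ⟨k, hg⟩ := g.2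
    exact Subtype.ext (lagCoef_add hf.1 hg.1)
  map_smul' c f := Subtype.ext (lagCoef_smul c f.1)

theorem continuous_coefMap {α : ℝ} (hα : 0 < α) : Continuous (coefMap (d := d) hα) := by
  refine continuous_indLimTopology (PStep.incl d α) (SeqStep.incl d (α / 2)) _ fun h => ?_
  have hp := Real.rpow_pos_of_pos h.2 (1 / α)
  refine ⟨⟨α / (2 * (h : ℝ) ^ (1 / α)), by positivity⟩, 2 ^ α, fun f =>
    ⟨⟨lagCoef f.1, mem_seqStepSubmodule_of_le (f.norm_lagCoef_le hα)⟩, rfl, ?_⟩⟩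
  exact SeqStep.norm_le_of_le _ (f.norm_lagCoef_le hα)

theorem memLp_growth_sq_inv :
    MemLp (fun x : Fin d → ℝ => (growth x ^ 2)⁻¹) 2 (orthantMeasure d) := by
  have hm := (integrable_growth_sq_inv (d := d)).1
  rw [memLp_two_iff_integrable_sq hm]
  refine integrable_growth_sq_inv.mono' (hm.pow 2)
    (ae_restrict_of_forall_mem isOpen_openOrthant.measurableSet fun x hx => ?_)
  have h1 := one_le_growth (openOrthant_subset_closedOrthant hx)
  have h2 : (growth x ^ 2)⁻¹ ≤ 1 := inv_le_one_of_one_le₀ (one_le_pow₀ h1)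
  have h3 : 0 ≤ (growth x ^ 2)⁻¹ := by positivity
  rw [Real.norm_eq_abs, abs_of_nonneg (sq_nonneg _), sq]
  exact mul_le_of_le_one_left h3 h2

theorem memLp_and_l2Norm_le {F : (Fin d → ℝ) → ℂ} (hF : ContinuousOn F (openOrthant d))
    {C : ℝ} (hC0 : 0 ≤ C) (hC : ∀ x ∈ openOrthant d, growth x ^ 2 * ‖F x‖ ≤ C) :
    MemLp F 2 (orthantMeasure d) ∧ l2Norm F ≤ C *
      (eLpNorm (fun x : Fin d → ℝ => (growth x ^ 2)⁻¹) 2 (orthantMeasure d)).toReal := by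
  have hm := hF.aestronglyMeasurable isOpen_openOrthant.measurableSet (μ := volume)
  have hb : ∀ᵐ x ∂orthantMeasure d, ‖F x‖ ≤ C * ‖(growth x ^ 2)⁻¹‖ :=
    ae_restrict_of_forall_mem isOpen_openOrthant.measurableSet fun x hx => by
      have := growth_pos hx
      rw [Real.norm_eq_abs, abs_of_pos (by positivity), ← div_eq_mul_inv,
        le_div_iff₀' (by positivity)]
      exact hC x hx
  refine ⟨memLp_growth_sq_inv.of_le_mul hm hb, ?_⟩
  have h1 := eLpNorm_le_mul_eLpNorm_of_ae_le_mul hb 2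
  have h2 := ENNReal.toReal_mono (ENNReal.mul_ne_top ENNReal.ofReal_ne_top
    memLp_growth_sq_inv.eLpNorm_ne_top) h1
  rw [ENNReal.toReal_mul, ENNReal.toReal_ofReal hC0] at h2
  exact h2

/-- The decay `e^{-k |n|^{1/α}}` is split into halves. One absorbs the factor `|n|^N` coming from
`E^N` and fixes `h`; the other makes the series converge. Both `h` and `K` depend on `k` but not on
the sequence, as continuity requires. -/
theorem lagCont_mem_pStepSubmodule {α k : ℝ} (hα : 0 < α) (hk : 0 < k) :
    ∃ h : PosReal, ∃ K : ℝ, ∀ (a : (Fin d → ℕ) → ℂ) (ha : Rapid a) (A : ℝ),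
      (∀ n, ‖a n‖ ≤ A * Real.exp (-(k * (tot n : ℝ) ^ (1 / α)))) →
      lagCont 0 a ha ∈ pStepSubmodule d α h ∧ ∀ N, etaTerm α h (lagCont 0 a ha) N ≤ K * A := by
  obtain ⟨C, hC0, m, hC⟩ := exists_bound_lagSeries 2 (0 : Fin d → ℕ)
  have hk2 := half_pos hk
  set h : PosReal := ⟨(α / (k / 2)) ^ α, by positivity⟩ with hh
  have hr : Rapid fun n : Fin d → ℕ => (Real.exp (-(k / 2 * (tot n : ℝ) ^ (1 / α))) : ℂ) :=
    rapid_of_le_exp (C := 1) hk2 (one_div_pos.2 hα) fun n => by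
      rw [Complex.norm_real, Real.norm_eq_abs, Real.abs_exp, one_mul]
  have hs := hr m
  simp only [Complex.norm_real, Real.norm_eq_abs, Real.abs_exp] at hs
  set S := ∑' n : Fin d → ℕ, Real.exp (-(k / 2 * (tot n : ℝ) ^ (1 / α))) * (1 + (tot n : ℝ)) ^ m
  set L := (eLpNorm (fun x : Fin d → ℝ => (growth x ^ 2)⁻¹) 2 (orthantMeasure d)).toReal
  refine ⟨h, C * S * L, fun a ha A hA => ?_⟩
  have hA0 : 0 ≤ A := by
    have := (norm_nonneg _).trans (hA 0)
    exact nonneg_of_mul_nonneg_left this (Real.exp_pos _)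
  have hS0 : 0 ≤ S := tsum_nonneg fun n => by positivity
  have b1 : ∀ N : ℕ, ∑' n, ‖(tot n : ℂ) ^ N * a n‖ * (1 + (tot n : ℝ)) ^ m ≤
      A * ((h : ℝ) ^ N * (N ! : ℝ) ^ α) * S := by
    intro N
    rw [← tsum_mul_left]
    refine (ha.tot_pow_mul N m).tsum_le_tsum (fun n => ?_) (hs.mul_left _)
    rw [← mul_assoc]
    gcongr
    rw [norm_mul, norm_pow, Complex.norm_natCast]
    have h1 := pow_mul_exp_le hα hk2 (Nat.cast_nonneg (tot n)) N (t := (tot n : ℝ))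
    have e : Real.exp (-(k * (tot n : ℝ) ^ (1 / α))) =
        Real.exp (-(k / 2 * (tot n : ℝ) ^ (1 / α))) *
          Real.exp (-(k / 2 * (tot n : ℝ) ^ (1 / α))) := by
      rw [← Real.exp_add]; congr 1; ring
    calc (tot n : ℝ) ^ N * ‖a n‖
        ≤ (tot n : ℝ) ^ N * (A * Real.exp (-(k * (tot n : ℝ) ^ (1 / α)))) := by
          gcongr; exact hA n
      _ = A * ((tot n : ℝ) ^ N * Real.exp (-(k / 2 * (tot n : ℝ) ^ (1 / α)))) *
          Real.exp (-(k / 2 * (tot n : ℝ) ^ (1 / α))) := by rw [e]; ring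
      _ ≤ A * ((h : ℝ) ^ N * (N ! : ℝ) ^ α) *
          Real.exp (-(k / 2 * (tot n : ℝ) ^ (1 / α))) := by gcongr
  have b2 : ∀ N : ℕ, MemLp (laguerrePow N (lagCont 0 a ha)) 2 (orthantMeasure d) ∧
      l2Norm (laguerrePow N (lagCont 0 a ha)) ≤
        (C * (A * ((h : ℝ) ^ N * (N ! : ℝ) ^ α) * S)) * L := by
    intro N
    have e := laguerrePow_lagCont ha N
    have hd := etaDenom_pos α h N
    refine memLp_and_l2Norm_le ((ContDiffOn.continuousOn
      (smoothOrthant_lagSeries 0 (ha.tot_pow_mul N))).congr e) (by positivity) fun x hx => ?_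
    rw [e hx]
    refine (hC _ (ha.tot_pow_mul N) x (openOrthant_subset_closedOrthant hx)).trans ?_
    gcongr
    exact b1 N
  have b3 : ∀ N, etaTerm α h (lagCont 0 a ha) N ≤ C * S * L * A := fun N => by
    rw [etaTerm, div_le_iff₀ (etaDenom_pos α h N)]
    exact (b2 N).2.trans (le_of_eq (by ring))
  exact ⟨⟨lagCont_mem_schwartzOrthant ha, fun N => (b2 N).1, _, by rintro _ ⟨N, rfl⟩; exact b3 N⟩, b3⟩

/-- The map taking a sequence to the Laguerre series with these coefficients. -/
def lagMap {α : ℝ} (hα : 0 < α) : SeqSpace d (α / 2) →ₗ[ℂ] PSpace d α where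
  toFun a := ⟨lagCont 0 a.1 (rapid_of_mem_seqSubmodule hα a.2), by
    obtain ⟨k, hk⟩ := a.2
    obtain ⟨h, K, H⟩ := lagCont_mem_pStepSubmodule (d := d) hα k.2
    exact ⟨h, (H _ _ _ fun n => SeqStep.norm_apply_le (⟨a.1, hk⟩ : SeqStep d (α / 2) k) n).1⟩⟩
  map_add' a b := Subtype.ext (ContinuousMap.ext fun x => by
    have h1 := summable_lagSeries 0 (rapid_of_mem_seqSubmodule hα a.2) x.2
    have h2 := summable_lagSeries 0 (rapid_of_mem_seqSubmodule hα b.2) x.2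
    refine Eq.trans (tsum_congr fun n => ?_) (h1.tsum_add h2)
    exact add_mul _ _ _)
  map_smul' c a := Subtype.ext (ContinuousMap.ext fun x => by
    refine Eq.trans (tsum_congr fun n => ?_) tsum_mul_left
    exact mul_assoc _ _ _)

theorem continuous_lagMap {α : ℝ} (hα : 0 < α) : Continuous (lagMap (d := d) hα) := by
  refine continuous_indLimTopology (SeqStep.incl d (α / 2)) (PStep.incl d α) _ fun k => ?_
  obtain ⟨h, K, H⟩ := lagCont_mem_pStepSubmodule (d := d) hα k.2
  refine ⟨h, K, fun a => ?_⟩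
  have ha := rapid_of_mem_seqSubmodule hα ⟨k, a.2⟩
  exact ⟨⟨lagCont 0 a.1 ha, (H _ ha _ a.norm_apply_le).1⟩, rfl,
    ciSup_le (H _ ha _ a.norm_apply_le).2⟩

theorem lagMap_coefMap {α : ℝ} (hα : 0 < α) (f : PSpace d α) : lagMap hα (coefMap hα f) = f := by
  obtain ⟨h, hf⟩ := f.2
  exact Subtype.ext (eq_lagCont_of_mem_schwartzOrthant hf.1
    (rapid_of_mem_seqSubmodule hα (coefMap hα f).2)).symm

end Estimates

/-! ### Change of basis between Laguerre functions and even Hermite functions -/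

section Connection

/-- The recurrence satisfied by Laguerre polynomials of parameter `a - 1` at the point `x`. -/
def LagRec (a x : ℝ) (f : ℕ → ℝ) : Prop :=
  f 1 = (a - x) * f 0 ∧
    ∀ n : ℕ, (n + 2) * f (n + 2) = (2 * n + 2 + a - x) * f (n + 1) - (n + a) * f n

theorem LagRec.ext {a x : ℝ} {f g : ℕ → ℝ} (hf : LagRec a x f) (hg : LagRec a x g)
    (h0 : f 0 = g 0) : f = g := by
  have : ∀ n, f n = g n ∧ f (n + 1) = g (n + 1) := by
    intro n
    induction n with
    | zero => exact ⟨h0, by rw [hf.1, hg.1, h0]⟩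
    | succ n ih =>
      refine ⟨ih.2, ?_⟩
      have h : (n : ℝ) + 2 ≠ 0 := by positivity
      refine mul_left_cancel₀ h ?_
      rw [show n + 1 + 1 = n + 2 from rfl, hf.2, hg.2, ih.1, ih.2]
  exact funext fun n => (this n).1

theorem constantCoeff_derivative (F : PowerSeries ℝ) :
    PowerSeries.constantCoeff (PowerSeries.derivative ℝ F) = PowerSeries.coeff 1 F := by
  rw [← PowerSeries.coeff_zero_eq_constantCoeff_apply, PowerSeries.coeff_derivative]
  simp

/-- The equation is that of the generating function `(1-z)^{-a} e^{-xz/(1-z)}` of the Laguerre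
polynomials of parameter `a - 1`. Only formal power series are used, and the coefficients are
compared one by one. -/
theorem lagRec_iff (a x : ℝ) (f : ℕ → ℝ) : LagRec a x f ↔
    (1 - PowerSeries.X) ^ 2 * PowerSeries.derivative ℝ (PowerSeries.mk f) =
      (PowerSeries.C a * (1 - PowerSeries.X) - PowerSeries.C x) * PowerSeries.mk f := by
  set F := PowerSeries.mk f with hF
  have e1 : (1 - PowerSeries.X) ^ 2 * PowerSeries.derivative ℝ F =
      PowerSeries.derivative ℝ F - PowerSeries.X * (PowerSeries.C 2 * PowerSeries.derivative ℝ F)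
        + PowerSeries.X * (PowerSeries.X * PowerSeries.derivative ℝ F) := by
    have : (PowerSeries.C (2 : ℝ)) = 2 := map_ofNat _ 2
    rw [this]; ring
  have e2 : (PowerSeries.C a * (1 - PowerSeries.X) - PowerSeries.C x) * F =
      PowerSeries.C (a - x) * F - PowerSeries.X * (PowerSeries.C a * F) := by
    rw [map_sub]; ring
  obtain ⟨c, hc⟩ : ∃ c, c = a - x := ⟨_, rfl⟩
  rw [e1, e2, PowerSeries.ext_iff, LagRec, ← hc]
  constructor
  · rintro ⟨h1, h2⟩ n
    rcases n with _ | _ | n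
    · simp [hF, constantCoeff_derivative, h1]
    · have := h2 0
      simp [hF, constantCoeff_derivative, PowerSeries.coeff_derivative,
        PowerSeries.coeff_succ_X_mul] at this ⊢
      linear_combination this - f 1 * hc
    · have := h2 (n + 1)
      simp [hF, PowerSeries.coeff_derivative, PowerSeries.coeff_succ_X_mul] at this ⊢
      linear_combination this - f (n + 2) * hc
  · intro h
    refine ⟨by simpa [hF, constantCoeff_derivative] using h 0, fun n => ?_⟩
    have := h (n + 1)
    rcases n with _ | n
    · simp [hF, constantCoeff_derivative, PowerSeries.coeff_derivative,
        PowerSeries.coeff_succ_X_mul] at this ⊢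
      linear_combination this + f 1 * hc
    · simp [hF, PowerSeries.coeff_derivative, PowerSeries.coeff_succ_X_mul] at this ⊢
      linear_combination this + f (n + 2) * hc

/-- The Taylor coefficients of `(1 - z) ^ (-b)`. -/
def binomCoef (b : ℝ) : ℕ → ℝ
  | 0 => 1
  | k + 1 => (k + b) / (k + 1) * binomCoef b k

/-- Each ratio `(k+b)/(k+1)` of consecutive coefficients has absolute value at most one. Applied
with `b = ±1/2`, this keeps the change of basis bounded up to normalization. -/
theorem abs_binomCoef_le {b : ℝ} (hb : |b| ≤ 1) (k : ℕ) : |binomCoef b k| ≤ 1 := by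
  induction k with
  | zero => simp [binomCoef]
  | succ k ih =>
    rw [binomCoef, abs_mul, abs_div]
    refine mul_le_one₀ ?_ (abs_nonneg _) ih
    rw [abs_of_nonneg (by positivity : (0 : ℝ) ≤ k + 1), div_le_one (by positivity)]
    refine (abs_add_le _ _).trans ?_
    rw [Nat.abs_cast]
    linarith

theorem derivative_binomCoef (b : ℝ) :
    (1 - PowerSeries.X) * PowerSeries.derivative ℝ (PowerSeries.mk (binomCoef b)) =
      PowerSeries.C b * PowerSeries.mk (binomCoef b) := by
  rw [sub_mul, one_mul]
  ext n
  rcases n with _ | n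
  · simp [constantCoeff_derivative, binomCoef]
  · have e : ((n : ℝ) + 1 + 1) * binomCoef b (n + 2) = (n + 1 + b) * binomCoef b (n + 1) := by
      rw [binomCoef]; push_cast; field_simp
    simp [PowerSeries.coeff_derivative, PowerSeries.coeff_succ_X_mul]
    linear_combination e

/-- Multiplying the generating function by `(1-z)^{-b}` raises the parameter from `a` to `a + b`; on
coefficients this is a Cauchy product. -/
theorem LagRec.convolution {a x : ℝ} {f : ℕ → ℝ} (hf : LagRec a x f) (b : ℝ) :
    LagRec (a + b) x fun n => ∑ j ∈ Finset.range (n + 1), binomCoef b (n - j) * f j := by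
  have e : PowerSeries.mk (fun n => ∑ j ∈ Finset.range (n + 1), binomCoef b (n - j) * f j) =
      PowerSeries.mk f * PowerSeries.mk (binomCoef b) := by
    ext n
    rw [PowerSeries.coeff_mk, PowerSeries.coeff_mul]
    simp only [PowerSeries.coeff_mk]
    rw [Finset.Nat.sum_antidiagonal_eq_sum_range_succ (fun i j => f i * binomCoef b j)]
    exact Finset.sum_congr rfl fun j _ => mul_comm _ _
  rw [lagRec_iff, e]
  have h1 := (lagRec_iff a x f).1 hf
  have h2 := derivative_binomCoef b
  rw [Derivation.leibniz, smul_eq_mul, smul_eq_mul, map_add]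
  linear_combination PowerSeries.mk (binomCoef b) * h1 +
    (1 - PowerSeries.X) * PowerSeries.mk f * h2

/-- The even Hermite functions, normalized as Laguerre functions of parameter `-1/2` in `t ^ 2`. -/
def evenHermite (t : ℝ) (i : ℕ) : ℝ := (-1) ^ i / (4 ^ i * i !) * hermiteAux (2 * i) t

theorem hermiteAux_zero (t : ℝ) : hermiteAux 0 t = Real.exp (-t ^ 2 / 2) := by
  simp [hermiteAux, hermitePoly, ← Real.exp_add]

theorem hermiteAux_one (t : ℝ) : hermiteAux 1 t = 2 * t * hermiteAux 0 t := by
  have h : HasDerivAt (hermiteAux 0) (-t * hermiteAux 0 t) t := by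
    have e : hermiteAux 0 = fun t : ℝ => Real.exp (-t ^ 2 / 2) := funext hermiteAux_zero
    rw [e]
    refine (((hasDerivAt_pow 2 t).neg).div_const 2).exp.congr_deriv ?_
    simp only [Pi.neg_apply]; push_cast; ring
  have := h.unique (hasDerivAt_hermiteAux 0 t)
  rw [zero_add] at this
  linear_combination this

theorem lagRec_evenHermite (t : ℝ) : LagRec (1 / 2) (t ^ 2) (evenHermite t) := by
  constructor
  · have h := hermiteAux_rec 0 t
    simp only [zero_add, Nat.cast_zero, hermiteAux_one] at h
    simp only [evenHermite, mul_one, mul_zero, h]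
    norm_num
    ring
  · intro n
    have h4 := hermiteAux_rec (2 * n + 2) t
    have h3 := hermiteAux_rec (2 * n + 1) t
    have h2 := hermiteAux_rec (2 * n) t
    push_cast at h2 h3 h4
    -- Eliminating the odd indices from three consecutive Hermite recurrences leaves a recurrence in
    -- even indices.
    have key : hermiteAux (2 * n + 2 + 2) t = (4 * t ^ 2 - 8 * n - 10) * hermiteAux (2 * n + 2) t
        - 8 * (n + 1) * (2 * n + 1) * hermiteAux (2 * n) t := by
      rw [show 2 * n + 1 + 2 = 2 * n + 2 + 1 by ring, show 2 * n + 1 + 1 = 2 * n + 2 by ring] at h3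
      linear_combination h4 + 2 * t * h3 + (4 * (n : ℝ) + 4) * h2
    simp only [evenHermite]
    rw [show 2 * (n + 2) = 2 * n + 2 + 2 by ring, show 2 * (n + 1) = 2 * n + 2 by ring, key,
      Nat.factorial_succ (n + 1), Nat.factorial_succ n]
    push_cast
    field_simp
    ring

theorem lagRec_lagD (x : ℝ) : LagRec 1 x fun n => lagD 0 n x :=
  ⟨lagD_zero_one x, fun n => by rw [lagD_three_term]; ring⟩

theorem lagD_sq_eq_sum (n : ℕ) (t : ℝ) : lagD 0 n (t ^ 2) =
    ∑ j ∈ Finset.range (n + 1), binomCoef (1 / 2) (n - j) * evenHermite t j := by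
  have h := (lagRec_evenHermite t).convolution (1 / 2)
  rw [show (1 / 2 : ℝ) + 1 / 2 = 1 by norm_num] at h
  refine congrFun ((lagRec_lagD (t ^ 2)).ext h ?_) n
  simp [lagD_zero_zero, evenHermite, hermiteAux_zero, binomCoef, neg_div]

theorem evenHermite_eq_sum (n : ℕ) (t : ℝ) : evenHermite t n =
    ∑ j ∈ Finset.range (n + 1), binomCoef (-1 / 2) (n - j) * lagD 0 j (t ^ 2) := by
  have h := (lagRec_lagD (t ^ 2)).convolution (-1 / 2)
  rw [show (1 : ℝ) + -1 / 2 = 1 / 2 by norm_num] at h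
  refine congrFun ((lagRec_evenHermite t).ext h ?_) n
  simp [lagD_zero_zero, evenHermite, hermiteAux_zero, binomCoef, neg_div]

/-- The ratio of `h_{2i}` and the function `evenHermite`. -/
def evenRatio (i : ℕ) : ℝ :=
  (Real.sqrt (2 ^ (2 * i) * (2 * i)! * Real.sqrt Real.pi))⁻¹ * ((-1) ^ i * (4 ^ i * i !))

theorem evenRatio_ne_zero (i : ℕ) : evenRatio i ≠ 0 := by
  rw [evenRatio]; positivity

theorem hermiteFun₁_two_mul (i : ℕ) (t : ℝ) :
    hermiteFun₁ (2 * i) t = evenRatio i * evenHermite t i := by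
  rw [hermiteFun₁, evenRatio, evenHermite, hermiteAux]
  have : ((-1 : ℝ) ^ i) * (-1) ^ i = 1 := by rw [← mul_pow]; norm_num
  field_simp
  linear_combination (-hermitePoly (2 * i) t) * this

/-- This reduces the size of `evenRatio` to that of the central binomial coefficient, which lies
between `4^i / (2i+1)` and `4^i`. Hence `evenRatio` and its inverse have at most linear growth. -/
theorem evenRatio_sq (i : ℕ) :
    evenRatio i ^ 2 * (i.centralBinom * Real.sqrt Real.pi) = 4 ^ i := by
  have h : i.centralBinom * i ! * i ! = (2 * i)! := by
    have := Nat.choose_mul_factorial_mul_factorial (show i ≤ 2 * i by omega)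
    rwa [show 2 * i - i = i by omega, ← Nat.centralBinom_eq_two_mul_choose] at this
  have h' : (i.centralBinom : ℝ) * i ! * i ! = (2 * i)! := by exact_mod_cast h
  have e1 : ((-1 : ℝ) ^ i) ^ 2 = 1 := by rw [← pow_mul, mul_comm, pow_mul]; norm_num
  have e2 : (2 : ℝ) ^ (2 * i) = 4 ^ i := by rw [pow_mul]; norm_num
  rw [evenRatio, mul_pow, inv_pow, Real.sq_sqrt (by positivity), mul_pow, e1, e2, ← h']
  have : (0 : ℝ) < i.centralBinom := by exact_mod_cast i.centralBinom_pos
  field_simp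

theorem abs_evenRatio_le (i : ℕ) : |evenRatio i| ≤ 2 * (1 + i) := by
  refine abs_le_of_sq_le_sq ?_ (by positivity)
  have h := evenRatio_sq i
  have h1 : (4 : ℝ) ^ i ≤ (2 * i + 1) * i.centralBinom := by
    exact_mod_cast Nat.four_pow_le_two_mul_add_one_mul_central_binom i
  have hc : (0 : ℝ) < i.centralBinom := by exact_mod_cast i.centralBinom_pos
  have hpi : 1 ≤ Real.sqrt Real.pi := by
    rw [Real.one_le_sqrt]; linarith [Real.pi_gt_three]
  have h2 : evenRatio i ^ 2 * i.centralBinom ≤ (2 * i + 1) * i.centralBinom := by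
    refine le_trans ?_ h1
    rw [← h, ← mul_assoc]
    exact le_mul_of_one_le_right (by positivity) hpi
  have h3 := le_of_mul_le_mul_right h2 hc
  nlinarith [(Nat.cast_nonneg i : (0 : ℝ) ≤ i)]

theorem abs_evenRatio_inv_le (i : ℕ) : |(evenRatio i)⁻¹| ≤ 2 := by
  refine abs_le_of_sq_le_sq ?_ (by norm_num)
  have h := evenRatio_sq i
  have h0 : 0 < evenRatio i ^ 2 := by
    have := evenRatio_ne_zero i
    positivity
  have h1 : (i.centralBinom : ℝ) ≤ 4 ^ i := by
    have := Nat.choose_le_two_pow (2 * i) i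
    rw [← Nat.centralBinom_eq_two_mul_choose, pow_mul] at this
    exact_mod_cast this
  have hpi : Real.sqrt Real.pi ≤ 4 := by
    rw [Real.sqrt_le_iff]; constructor <;> linarith [Real.pi_lt_four]
  rw [inv_pow, inv_le_comm₀ h0 (by norm_num)]
  have h2 : (4 : ℝ) ^ i ≤ evenRatio i ^ 2 * (4 ^ i * 4) := by
    calc (4 : ℝ) ^ i = evenRatio i ^ 2 * (i.centralBinom * Real.sqrt Real.pi) := h.symm
      _ ≤ evenRatio i ^ 2 * (4 ^ i * 4) := by gcongr
  have h4 : (0 : ℝ) < 4 ^ i := by positivity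
  have : (4 : ℝ) ^ i * 1 ≤ 4 ^ i * (evenRatio i ^ 2 * 4) := by linarith
  have := le_of_mul_le_mul_left this h4
  linarith

theorem lagD_sq_eq_sum_hermite (n : ℕ) (t : ℝ) : lagD 0 n (t ^ 2) = ∑ j ∈ Finset.range (n + 1),
    (binomCoef (1 / 2) (n - j) * (evenRatio j)⁻¹) * hermiteFun₁ (2 * j) t := by
  rw [lagD_sq_eq_sum]
  refine Finset.sum_congr rfl fun j _ => ?_
  rw [hermiteFun₁_two_mul]
  have := evenRatio_ne_zero j
  field_simp

/-- The normalizing factor is that of index `n`, written as `j + (n - j)` so that the coefficient is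
a kernel in the pair `(j, n - j)`, as `tsum_upperSum_mul` requires. -/
theorem hermiteFun₁_two_mul_eq_sum (n : ℕ) (t : ℝ) :
    hermiteFun₁ (2 * n) t = ∑ j ∈ Finset.range (n + 1),
      (binomCoef (-1 / 2) (n - j) * evenRatio (j + (n - j))) * lagD 0 j (t ^ 2) := by
  rw [hermiteFun₁_two_mul, evenHermite_eq_sum, Finset.mul_sum]
  refine Finset.sum_congr rfl fun j hj => ?_
  rw [Nat.add_sub_cancel' (Nat.lt_succ_iff.1 (Finset.mem_range.1 hj))]
  ring

end Connection

/-! ### Operators on the sequence spaces -/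

section Operators
variable {d : ℕ}

/-- The bound `|a_n| ≤ A exp (-h |n| ^ s)`. -/
def Decay (s h A : ℝ) (a : (Fin d → ℕ) → ℂ) : Prop :=
  ∀ n, ‖a n‖ ≤ A * Real.exp (-(h * (tot n : ℝ) ^ s))

theorem Decay.nonneg {s h A : ℝ} {a : (Fin d → ℕ) → ℂ} (ha : Decay s h A a) : 0 ≤ A :=
  nonneg_of_mul_nonneg_left ((norm_nonneg _).trans (ha 0)) (Real.exp_pos _)

theorem exists_decay {α : ℝ} (a : SeqSpace d (α / 2)) :
    ∃ h : PosReal, ∃ A, Decay (1 / α) h A a.1 := by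
  obtain ⟨h, ha⟩ := a.2
  exact ⟨h, _, SeqStep.norm_apply_le (⟨a.1, ha⟩ : SeqStep d (α / 2) h)⟩

/-- The map of sequence spaces given by an operator that preserves exponential decay. -/
def seqMap {α : ℝ} (T : ((Fin d → ℕ) → ℂ) → (Fin d → ℕ) → ℂ)
    (hadd : ∀ a b : SeqSpace d (α / 2), T (a.1 + b.1) = T a.1 + T b.1)
    (hsmul : ∀ (c : ℂ) (a : (Fin d → ℕ) → ℂ), T (c • a) = c • T a)
    (hT : ∀ h : PosReal, ∃ k : PosReal, ∃ C : ℝ, ∀ a A, Decay (1 / α) h A a →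
      Decay (1 / α) k (C * A) (T a)) : SeqSpace d (α / 2) →ₗ[ℂ] SeqSpace d (α / 2) where
  toFun a := ⟨T a.1, by
    obtain ⟨h, A, ha⟩ := exists_decay a
    obtain ⟨k, C, H⟩ := hT h
    exact ⟨k, mem_seqStepSubmodule_of_le (H _ _ ha)⟩⟩
  map_add' a b := Subtype.ext (hadd a b)
  map_smul' c a := Subtype.ext (hsmul c a.1)

theorem continuous_seqMap {α : ℝ} (T : ((Fin d → ℕ) → ℂ) → (Fin d → ℕ) → ℂ)
    (hadd : ∀ a b : SeqSpace d (α / 2), T (a.1 + b.1) = T a.1 + T b.1)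
    (hsmul : ∀ (c : ℂ) (a : (Fin d → ℕ) → ℂ), T (c • a) = c • T a)
    (hT : ∀ h : PosReal, ∃ k : PosReal, ∃ C : ℝ, ∀ a A, Decay (1 / α) h A a →
      Decay (1 / α) k (C * A) (T a)) : Continuous (seqMap T hadd hsmul hT) := by
  refine continuous_indLimTopology (SeqStep.incl d (α / 2)) (SeqStep.incl d (α / 2)) _ fun h => ?_
  obtain ⟨k, C, H⟩ := hT h
  refine ⟨k, C, fun a => ⟨⟨T a.1, mem_seqStepSubmodule_of_le (H _ _ a.norm_apply_le)⟩, rfl, ?_⟩⟩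
  exact SeqStep.norm_le_of_le _ (H _ _ a.norm_apply_le)

/-- Linear growth of an integral kernel. -/
def LinearGrowth (A : ℕ → ℕ → ℝ) : Prop := ∀ j k : ℕ, |A j k| ≤ 2 * (1 + (j + k : ℕ))

theorem LinearGrowth.abs_prod_le {A : ℕ → ℕ → ℝ} (hA : LinearGrowth A) (m k : Fin d → ℕ) :
    |∏ i, A (m i) (k i)| ≤ 2 ^ d * (1 + (tot (m + k) : ℝ)) ^ d := by
  rw [Finset.abs_prod, ← mul_pow]
  calc ∏ i, |A (m i) (k i)| ≤ ∏ _i : Fin d, 2 * (1 + (tot (m + k) : ℝ)) := by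
        refine Finset.prod_le_prod (fun i _ => abs_nonneg _) fun i _ => (hA _ _).trans ?_
        have : m i + k i ≤ tot (m + k) :=
          Finset.single_le_sum (f := fun i => (m + k) i) (fun _ _ => Nat.zero_le _)
            (Finset.mem_univ i)
        gcongr
    _ = _ := by simp

/-- The sum `∑ₖ a_{m+k} ∏ᵢ A mᵢ kᵢ`. -/
def upperSum (A : ℕ → ℕ → ℝ) (a : (Fin d → ℕ) → ℂ) (m : Fin d → ℕ) : ℂ :=
  ∑' k, a (m + k) * ((∏ i, A (m i) (k i) : ℝ) : ℂ)

/-- Half of the rate `h` absorbs the polynomial growth of the kernel. The other half is shared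
equally between `m` and `k`, since `|m + k|` is at least `|m|` and at least `|k|`: one quarter gives
the decay of the result, the other the convergence of the sum. -/
theorem LinearGrowth.exists_norm_le {A : ℕ → ℕ → ℝ} (hA : LinearGrowth A) (d : ℕ) {s h : ℝ}
    (hs : 0 < s) (hh : 0 < h) : ∃ C, 0 ≤ C ∧ ∀ (a : (Fin d → ℕ) → ℂ) (B : ℝ), Decay s h B a →
      ∀ m k, ‖a (m + k) * ((∏ i, A (m i) (k i) : ℝ) : ℂ)‖ ≤
        C * B * Real.exp (-(h / 4 * (tot m : ℝ) ^ s)) * Real.exp (-(h / 4 * (tot k : ℝ) ^ s)) := by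
  obtain ⟨C, hC0, hC⟩ := exists_pow_le_exp d (half_pos hh) hs
  refine ⟨2 ^ d * C, by positivity, fun a B ha m k => ?_⟩
  have hB := ha.nonneg
  have h1 : (tot m : ℝ) ^ s ≤ (tot (m + k) : ℝ) ^ s := by
    have : tot m ≤ tot (m + k) := Finset.sum_le_sum fun i _ => Nat.le_add_right _ _
    gcongr
  have h2 : (tot k : ℝ) ^ s ≤ (tot (m + k) : ℝ) ^ s := by
    have : tot k ≤ tot (m + k) := Finset.sum_le_sum fun i _ => Nat.le_add_left _ _
    gcongr
  rw [norm_mul, Complex.norm_real, Real.norm_eq_abs]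
  calc _ ≤ (B * Real.exp (-(h * (tot (m + k) : ℝ) ^ s))) *
        (2 ^ d * (C * Real.exp (h / 2 * (tot (m + k) : ℝ) ^ s))) := by
        refine mul_le_mul (ha _) ((hA.abs_prod_le m k).trans ?_) (abs_nonneg _) (by positivity)
        gcongr
        exact hC _
    _ = 2 ^ d * C * B * Real.exp (-(h / 2 * (tot (m + k) : ℝ) ^ s)) := by
        have e : Real.exp (-(h / 2 * (tot (m + k) : ℝ) ^ s)) =
            Real.exp (-(h * (tot (m + k) : ℝ) ^ s)) * Real.exp (h / 2 * (tot (m + k) : ℝ) ^ s) := by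
          rw [← Real.exp_add]; congr 1; ring
        rw [e]; ring
    _ ≤ 2 ^ d * C * B * Real.exp (-(h / 4 * (tot m : ℝ) ^ s) + -(h / 4 * (tot k : ℝ) ^ s)) := by
        gcongr
        nlinarith
    _ = _ := by rw [Real.exp_add]; ring

theorem LinearGrowth.summable_upperSum {A : ℕ → ℕ → ℝ} (hA : LinearGrowth A) {s h B : ℝ}
    (hs : 0 < s) (hh : 0 < h) {a : (Fin d → ℕ) → ℂ} (ha : Decay s h B a) (m : Fin d → ℕ) :
    Summable fun k => a (m + k) * ((∏ i, A (m i) (k i) : ℝ) : ℂ) := by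
  obtain ⟨C, -, hC⟩ := hA.exists_norm_le d hs hh
  exact Summable.of_norm_bounded ((summable_exp_neg (by positivity : 0 < h / 4) hs).mul_left _)
    (hC a B ha m)

theorem LinearGrowth.decay_upperSum {A : ℕ → ℕ → ℝ} (hA : LinearGrowth A) (d : ℕ) {s : ℝ}
    (hs : 0 < s) (h : PosReal) : ∃ k : PosReal, ∃ C : ℝ, ∀ (a : (Fin d → ℕ) → ℂ) (B : ℝ),
      Decay s h B a → Decay s k (C * B) (upperSum A a) := by
  obtain ⟨C, -, hC⟩ := hA.exists_norm_le d hs h.2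
  have h4 : 0 < (h : ℝ) / 4 := by have := h.2; positivity
  refine ⟨⟨h / 4, h4⟩,
    C * ∑' k : Fin d → ℕ, Real.exp (-((h : ℝ) / 4 * (tot k : ℝ) ^ s)), fun a B ha m => ?_⟩
  refine (tsum_of_norm_bounded ((summable_exp_neg h4 hs).mul_left _).hasSum (hC a B ha m)).trans
    (le_of_eq ?_)
  rw [tsum_mul_left]
  ring

/-- The operator `upperSum` on the sequence spaces. -/
def upperSumMap {A : ℕ → ℕ → ℝ} (hA : LinearGrowth A) {α : ℝ} (hα : 0 < α) :
    SeqSpace d (α / 2) →ₗ[ℂ] SeqSpace d (α / 2) :=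
  seqMap (upperSum A)
    (fun a b => by
      obtain ⟨h, B, ha⟩ := exists_decay a
      obtain ⟨k, C, hb⟩ := exists_decay b
      funext m
      refine Eq.trans (tsum_congr fun n => ?_)
        ((hA.summable_upperSum (one_div_pos.2 hα) h.2 ha m).tsum_add
          (hA.summable_upperSum (one_div_pos.2 hα) k.2 hb m))
      exact add_mul _ _ _)
    (fun c a => funext fun m => Eq.trans (tsum_congr fun n => mul_assoc _ _ _) tsum_mul_left)
    (hA.decay_upperSum d (one_div_pos.2 hα))

theorem continuous_upperSumMap {A : ℕ → ℕ → ℝ} (hA : LinearGrowth A) {α : ℝ} (hα : 0 < α) :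
    Continuous (upperSumMap (d := d) hA hα) := continuous_seqMap _ _ _ _

/-- Insert the expansion of `p` in terms of `q` into `∑ a_n p_n` and regroup the absolutely
convergent double series by `n = m + k`. -/
theorem tsum_upperSum_mul {A : ℕ → ℕ → ℝ} (hA : LinearGrowth A) {s h B : ℝ}
    (hs : 0 < s) (hh : 0 < h) {a : (Fin d → ℕ) → ℂ} (ha : Decay s h B a) {p q : Fin d → ℕ → ℝ}
    (hpq : ∀ i n, p i n = ∑ j ∈ Finset.range (n + 1), A j (n - j) * q i j)
    {K : ℝ} {r : ℕ} (hq : ∀ m : Fin d → ℕ, |∏ i, q i (m i)| ≤ K * (1 + (tot m : ℝ)) ^ r) :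
    ∑' m, upperSum A a m * ((∏ i, q i (m i) : ℝ) : ℂ) =
      ∑' n, a n * ((∏ i, p i (n i) : ℝ) : ℂ) := by
  obtain ⟨C, hC0, hC⟩ := hA.exists_norm_le d hs hh
  have hB := ha.nonneg
  have h4 : 0 < h / 4 := by positivity
  set F : (Fin d → ℕ) × (Fin d → ℕ) → ℂ := fun z =>
    a (z.1 + z.2) * ((∏ i, A (z.1 i) (z.2 i) : ℝ) : ℂ) * ((∏ i, q i (z.1 i) : ℝ) : ℂ) with hF
  have hr : Summable fun m : Fin d → ℕ =>
      Real.exp (-(h / 4 * (tot m : ℝ) ^ s)) * (1 + (tot m : ℝ)) ^ r := by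
    have := rapid_of_le_exp (d := d) (C := 1)
      (a := fun n => (Real.exp (-(h / 4 * (tot n : ℝ) ^ s)) : ℂ)) h4 hs fun n => by
        rw [Complex.norm_real, Real.norm_eq_abs, Real.abs_exp, one_mul]
    simpa only [Complex.norm_real, Real.norm_eq_abs, Real.abs_exp] using this r
  have hsum : Summable F := by
    refine Summable.of_norm_bounded
      ((hr.mul_of_nonneg (summable_exp_neg (d := d) h4 hs) (fun m => by positivity)
        fun k => (Real.exp_pos _).le).mul_left (C * B * K)) fun z => ?_
    rw [hF, norm_mul, Complex.norm_real _, Real.norm_eq_abs]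
    refine (mul_le_mul (hC a B ha z.1 z.2) (hq z.1) (abs_nonneg _) (by positivity)).trans
      (le_of_eq (by ring))
  have e1 : ∑' m, upperSum A a m * ((∏ i, q i (m i) : ℝ) : ℂ) = ∑' z, F z := by
    rw [hsum.tsum_prod]
    exact tsum_congr fun m => tsum_mul_right.symm
  rw [e1, ← (hsum.hasSum.tsum_fiberwise fun z => z.1 + z.2).tsum_eq]
  refine tsum_congr fun n => ?_
  -- The pairs with sum `n` are the `(m, n - m)` with `m ≤ n` in every coordinate, where the
  -- truncated subtraction is exact.
  have hfib : (fun z : (Fin d → ℕ) × (Fin d → ℕ) => z.1 + z.2) ⁻¹' {n} =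
      ↑((Fintype.piFinset fun i => Finset.range (n i + 1)).image fun m => (m, n - m)) := by
    ext ⟨m, k⟩
    simp only [Set.mem_preimage, Set.mem_singleton_iff, Finset.coe_image, Set.mem_image,
      Finset.mem_coe, Fintype.mem_piFinset, Finset.mem_range, Prod.mk.injEq]
    constructor
    · rintro rfl
      exact ⟨m, fun i => by simp, rfl, by simp⟩
    · rintro ⟨m', hm, rfl, rfl⟩
      funext i
      exact Nat.add_sub_cancel' (Nat.lt_succ_iff.1 (hm i))
  rw [tsum_congr_set_coe F hfib, Finset.tsum_subtype',
    Finset.sum_image fun m _ m' _ e => congrArg Prod.fst e, Finset.prod_congr rfl fun i _ => hpq i (n i),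
    Finset.prod_univ_sum, Complex.ofReal_sum, Finset.mul_sum]
  refine Finset.sum_congr rfl fun m hm => ?_
  have : m + (n - m) = n := funext fun i =>
    Nat.add_sub_cancel' (Nat.lt_succ_iff.1 (Finset.mem_range.1 (Fintype.mem_piFinset.1 hm i)))
  rw [hF, Finset.prod_mul_distrib, Complex.ofReal_mul, ← mul_assoc]
  simp only [this]
  rfl

/-- The sequence supported on the even multiindices with `b_{2n} = a_n`. -/
def dilate (a : (Fin d → ℕ) → ℂ) (n : Fin d → ℕ) : ℂ :=
  if ∀ i, Even (n i) then a fun i => n i / 2 else 0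

theorem decay_dilate {s : ℝ} (h : PosReal) : ∃ k : PosReal, ∃ C : ℝ,
    ∀ (a : (Fin d → ℕ) → ℂ) (A : ℝ), Decay s h A a → Decay s k (C * A) (dilate a) := by
  have hh := h.2
  refine ⟨⟨h / 2 ^ s, by positivity⟩, 1, fun a A ha n => ?_⟩
  have hA := ha.nonneg
  rw [dilate]
  split_ifs with he
  · refine (ha _).trans (le_of_eq ?_)
    have e : ((tot fun i => n i / 2 : ℕ) : ℝ) = tot n / 2 := by
      rw [eq_div_iff two_ne_zero]
      have : (tot fun i => n i / 2) * 2 = tot n := by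
        rw [tot, Finset.sum_mul]
        exact Finset.sum_congr rfl fun i _ => Nat.div_mul_cancel (he i).two_dvd
      exact_mod_cast this
    rw [e, Real.div_rpow (Nat.cast_nonneg _) zero_le_two, one_mul]
    congr 3
    ring
  · rw [norm_zero]; positivity

/-- The operator `dilate` on the sequence spaces. -/
def dilateMap {α : ℝ} : SeqSpace d (α / 2) →ₗ[ℂ] SeqSpace d (α / 2) :=
  seqMap dilate
    (fun a b => funext fun n => by simp only [dilate, Pi.add_apply]; split_ifs <;> simp)
    (fun c a => funext fun n => by simp only [dilate, Pi.smul_apply]; split_ifs <;> simp)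
    decay_dilate

theorem continuous_dilateMap {α : ℝ} : Continuous (dilateMap (d := d) (α := α)) :=
  continuous_seqMap _ _ _ _

theorem tsum_dilate (a : (Fin d → ℕ) → ℂ) (u : (Fin d → ℕ) → ℂ) :
    ∑' n, dilate a n * u n = ∑' m, a m * u fun i => 2 * m i := by
  have hinj : Function.Injective fun (m : Fin d → ℕ) (i : Fin d) => 2 * m i := fun m m' e =>
    funext fun i => by have := congrFun e i; dsimp only at this; omega
  refine Eq.trans (hinj.tsum_eq ?_).symm (tsum_congr fun m => ?_)
  · intro n hn
    have he : ∀ i, Even (n i) := by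
      by_contra hc
      exact hn (by simp only [dilate, if_neg hc, zero_mul])
    exact ⟨fun i => n i / 2, funext fun i => Nat.mul_div_cancel' (he i).two_dvd⟩
  · rw [dilate, if_pos fun i => even_two_mul _]
    simp

/-- The sequence `a_{2n}`. -/
def contract (a : (Fin d → ℕ) → ℂ) (n : Fin d → ℕ) : ℂ := a fun i => 2 * n i

theorem decay_contract {s : ℝ} (hs : 0 < s) (h : PosReal) : ∃ k : PosReal, ∃ C : ℝ,
    ∀ (a : (Fin d → ℕ) → ℂ) (A : ℝ), Decay s h A a → Decay s k (C * A) (contract a) := by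
  have hh := h.2
  refine ⟨h, 1, fun a A ha n => (ha _).trans ?_⟩
  have hA := ha.nonneg
  have : tot n ≤ tot fun i => 2 * n i := Finset.sum_le_sum fun i _ => by omega
  rw [one_mul]
  gcongr

/-- The operator `contract` on the sequence spaces. -/
def contractMap {α : ℝ} (hα : 0 < α) : SeqSpace d (α / 2) →ₗ[ℂ] SeqSpace d (α / 2) :=
  seqMap contract (fun _ _ => rfl) (fun _ _ => rfl) (decay_contract (one_div_pos.2 hα))

theorem continuous_contractMap {α : ℝ} (hα : 0 < α) : Continuous (contractMap (d := d) hα) :=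
  continuous_seqMap _ _ _ _

end Operators

/-! ### Composition with `v` and its inverse -/

section Main
variable {d : ℕ}

/-- The kernel expressing Laguerre functions in terms of Hermite functions. -/
def laguerreToHermite (j k : ℕ) : ℝ := binomCoef (1 / 2) k * (evenRatio j)⁻¹

/-- The kernel expressing Hermite functions in terms of Laguerre functions. -/
def hermiteToLaguerre (j k : ℕ) : ℝ := binomCoef (-1 / 2) k * evenRatio (j + k)

theorem linearGrowth_laguerreToHermite : LinearGrowth laguerreToHermite := fun j k => by
  rw [laguerreToHermite, abs_mul]
  have h1 := abs_binomCoef_le (b := 1 / 2) (by norm_num [abs_le]) k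
  refine (mul_le_mul h1 (abs_evenRatio_inv_le j) (abs_nonneg _) zero_le_one).trans ?_
  have : (0 : ℝ) ≤ (j + k : ℕ) := Nat.cast_nonneg _
  linarith

theorem linearGrowth_hermiteToLaguerre : LinearGrowth hermiteToLaguerre := fun j k => by
  rw [hermiteToLaguerre, abs_mul]
  have h1 := abs_binomCoef_le (b := -1 / 2) (by norm_num [abs_le]) k
  exact (mul_le_mul h1 (abs_evenRatio_le (j + k)) (abs_nonneg _) zero_le_one).trans
    (one_mul _).le

theorem hermiteFun₁_neg (n : ℕ) (t : ℝ) : hermiteFun₁ n (-t) = (-1) ^ n * hermiteFun₁ n t := by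
  have h := iteratedDeriv_comp_neg n (fun t : ℝ => Real.exp (-t ^ 2)) t
  simp only [neg_sq, smul_eq_mul] at h
  have e : ((-1 : ℝ) ^ n) * (-1) ^ n = 1 := by rw [← mul_pow]; norm_num
  rw [hermiteFun₁, hermiteFun₁, hermitePoly, hermitePoly, neg_sq, h]
  linear_combination (-((Real.sqrt (2 ^ n * n ! * Real.sqrt Real.pi))⁻¹ * Real.exp (-t ^ 2 / 2) *
    ((-1) ^ n * Real.exp (t ^ 2) *
      iteratedDeriv n (fun t : ℝ => Real.exp (-t ^ 2)) (-t)))) * e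

theorem hermiteFun_update_neg (n : Fin d → ℕ) (x : Fin d → ℝ) (j : Fin d) :
    hermiteFun n (Function.update x j (-x j)) = (-1) ^ n j * hermiteFun n x := by
  rw [hermiteFun, hermiteFun, ← Finset.mul_prod_erase _ _ (Finset.mem_univ j),
    ← Finset.mul_prod_erase _ (fun i => hermiteFun₁ (n i) (x i)) (Finset.mem_univ j),
    Function.update_self, hermiteFun₁_neg, mul_assoc]
  congr 2
  refine Finset.prod_congr rfl fun i hi => ?_
  rw [Function.update_of_ne (Finset.ne_of_mem_erase hi)]

/-- Averaging the series over the reflection in `x_j` cancels the terms with `n_j` odd and keeps the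
others. Doing this for one coordinate after another removes all odd indices without appealing to
uniqueness of the coefficients. -/
theorem tsum_even_of_even {β : ℝ} (hβ : 0 < β) (b : SeqSpace d β)
    (hb : ∀ (x : Fin d → ℝ) (j : Fin d), hermiteSeries d β hβ b (Function.update x j (-x j)) =
      hermiteSeries d β hβ b x) (S : Finset (Fin d)) (x : Fin d → ℝ) :
    ∑' n, (if ∀ j ∈ S, Even (n j) then b.1 n else 0) * (hermiteFun n x : ℂ) =
      hermiteSeries d β hβ b x := by
  induction S using Finset.induction_on generalizing x with
  | empty => simp [hermiteSeries]
  | insert j S hj ih =>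
    have hs : ∀ x, Summable fun n =>
        (if ∀ j ∈ S, Even (n j) then b.1 n else 0) * (hermiteFun n x : ℂ) := fun x =>
      Summable.of_norm_bounded (summable_hermite hβ b x).norm fun n => by
        split_ifs
        · exact le_rfl
        · rw [zero_mul, norm_zero]; exact norm_nonneg _
    have h2 : hermiteSeries d β hβ b x = (1 / 2 : ℂ) * (hermiteSeries d β hβ b x +
        hermiteSeries d β hβ b (Function.update x j (-x j))) := by rw [hb]; ring
    rw [h2, ← ih x, ← ih (Function.update x j (-x j)), ← (hs _).tsum_add (hs _), ← tsum_mul_left]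
    refine tsum_congr fun n => ?_
    rw [hermiteFun_update_neg]
    simp only [Finset.forall_mem_insert]
    push_cast
    rcases Nat.even_or_odd (n j) with he | ho
    · rw [he.neg_one_pow]
      simp only [he, true_and]
      ring
    · rw [ho.neg_one_pow, if_neg fun h => (Nat.not_even_iff_odd.2 ho) h.1]
      ring

theorem tsum_contract_of_even {β : ℝ} (hβ : 0 < β) (b : SeqSpace d β)
    (hb : ∀ (x : Fin d → ℝ) (j : Fin d), hermiteSeries d β hβ b (Function.update x j (-x j)) =
      hermiteSeries d β hβ b x) (x : Fin d → ℝ) :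
    ∑' m, contract b.1 m * (hermiteFun (fun i => 2 * m i) x : ℂ) = hermiteSeries d β hβ b x := by
  rw [← tsum_even_of_even hβ b hb Finset.univ x,
    ← tsum_dilate (contract b.1) fun n => (hermiteFun n x : ℂ)]
  refine tsum_congr fun n => ?_
  simp only [dilate, Finset.mem_univ, true_implies, contract]
  split_ifs with h
  · rw [show (fun i => 2 * (n i / 2)) = n from
      funext fun i => Nat.mul_div_cancel' (h i).two_dvd]
  · rfl

variable {α : ℝ} (hα : 0 < α)

/-- The Hermite coefficients of `f ∘ v`. -/
def toHermite : PSpace d α →ₗ[ℂ] SeqSpace d (α / 2) :=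
  dilateMap ∘ₗ upperSumMap linearGrowth_laguerreToHermite hα ∘ₗ coefMap hα

theorem continuous_toHermite : Continuous (toHermite (d := d) hα) :=
  continuous_dilateMap.comp
    ((continuous_upperSumMap linearGrowth_laguerreToHermite hα).comp (continuous_coefMap hα))

theorem hermiteSeries_toHermite (f : PSpace d α) (x : Fin d → ℝ) :
    hermiteSeries d (α / 2) (half_pos hα) (toHermite hα f) x = f (vMap x) := by
  obtain ⟨K, hK⟩ := exists_bound_hermiteFun x
  obtain ⟨h, B, ha⟩ := exists_decay (coefMap hα f)
  have h1 := tsum_upperSum_mul linearGrowth_laguerreToHermite (one_div_pos.2 hα) h.2 ha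
    (p := fun i n => lagD 0 n (x i ^ 2)) (q := fun i n => hermiteFun₁ (2 * n) (x i)) (K := K)
    (r := 0) (fun i n => lagD_sq_eq_sum_hermite n (x i)) fun m => by
      have := hK fun i => 2 * m i
      rwa [Complex.norm_real, Real.norm_eq_abs, ← mul_one K, ← pow_zero (1 + (tot m : ℝ))] at this
  have h2 := congrArg (fun f : PSpace d α => f (vMap x)) (lagMap_coefMap hα f)
  exact (tsum_dilate _ _).trans (h1.trans h2)

/-- The function `f` for which `f ∘ v` is the even part of the Hermite series. -/
def fromHermite : SeqSpace d (α / 2) →ₗ[ℂ] PSpace d α :=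
  lagMap hα ∘ₗ upperSumMap linearGrowth_hermiteToLaguerre hα ∘ₗ contractMap hα

theorem continuous_fromHermite : Continuous (fromHermite (d := d) hα) :=
  (continuous_lagMap hα).comp
    ((continuous_upperSumMap linearGrowth_hermiteToLaguerre hα).comp (continuous_contractMap hα))

/-- The change of basis always yields `∑ b_{2m} h_{2m}`; evenness enters only to identify this with
the full series. -/
theorem fromHermite_vMap (b : SeqSpace d (α / 2))
    (hb : ∀ (x : Fin d → ℝ) (j : Fin d),
      hermiteSeries d (α / 2) (half_pos hα) b (Function.update x j (-x j)) =
        hermiteSeries d (α / 2) (half_pos hα) b x) (x : Fin d → ℝ) :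
    fromHermite hα b (vMap x) = hermiteSeries d (α / 2) (half_pos hα) b x := by
  obtain ⟨C, -, r, hC⟩ := exists_bound_lagFun' (0 : Fin d → ℕ)
  obtain ⟨h, B, ha⟩ := exists_decay (contractMap hα b)
  have h1 := tsum_upperSum_mul linearGrowth_hermiteToLaguerre (one_div_pos.2 hα) h.2 ha
    (p := fun i n => hermiteFun₁ (2 * n) (x i)) (q := fun i n => lagD 0 n (x i ^ 2)) (K := C)
    (r := r) (fun i n => hermiteFun₁_two_mul_eq_sum n (x i)) fun m => hC m _ (vMap x).2
  exact h1.trans (tsum_contract_of_even (half_pos hα) b hb x)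

theorem vMap_wMap (y : closedOrthant d) : vMap (wMap y).1 = y :=
  Subtype.ext (funext fun i => Real.sq_sqrt (y.2 i))

/-- `v` maps onto the closed orthant, with `w` as a right inverse. -/
theorem PSpace.ext_vMap {f g : PSpace d α} (h : ∀ x, f (vMap x) = g (vMap x)) : f = g :=
  Subtype.ext (ContinuousMap.ext fun y => by rw [← vMap_wMap y]; exact h _)

theorem update_vMap (x : Fin d → ℝ) (j : Fin d) : vMap (Function.update x j (-x j)) = vMap x :=
  Subtype.ext (funext fun i => by
    rcases eq_or_ne i j with rfl | hij
    · simp [vMap]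
    · simp [vMap, hij])

variable (d) in
/-- The quotient map onto the Pilipović space. -/
def hermiteMap : SeqSpace d (α / 2) →ₗ[ℂ] HermiteSpace d (α / 2) (half_pos hα) :=
  (hermiteSeries d (α / 2) (half_pos hα)).rangeRestrict

theorem continuous_hermiteMap : Continuous (hermiteMap d hα) := continuous_coinduced_rng

/-- The map `f ↦ f ∘ v`. -/
def compV : PSpace d α →ₗ[ℂ] hermiteEven d (α / 2) (half_pos hα) :=
  (hermiteMap d hα ∘ₗ toHermite hα).codRestrict _ fun f x j =>
    (hermiteSeries_toHermite hα f _).trans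
      ((congrArg _ (update_vMap x j)).trans (hermiteSeries_toHermite hα f x).symm)

theorem compV_apply (f : PSpace d α) (x : Fin d → ℝ) : (compV hα f).1 x = f (vMap x) :=
  hermiteSeries_toHermite hα f x

theorem continuous_compV : Continuous (compV (d := d) hα) :=
  ((continuous_hermiteMap hα).comp (continuous_toHermite hα)).subtype_mk _

/-- The map `ψ ↦ ψ ∘ w` on even functions. -/
def compW (ψ : HermiteSpace d (α / 2) (half_pos hα)) : PSpace d α :=
  fromHermite hα ψ.2.choose

/-- The chosen coefficients do not matter: two choices differ by a sequence whose Hermite series is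
zero, hence even, and `fromHermite` sends that sequence to a function vanishing after composition
with `v`. -/
theorem compW_hermiteMap (b : SeqSpace d (α / 2)) :
    compW hα (hermiteMap d hα b) = fromHermite hα b := by
  set c := (hermiteMap d hα b).2.choose with hc
  have h : hermiteSeries d (α / 2) (half_pos hα) c = hermiteSeries d (α / 2) (half_pos hα) b :=
    (hermiteMap d hα b).2.choose_spec
  have h0 : hermiteSeries d (α / 2) (half_pos hα) (c - b) = 0 := by rw [map_sub, h, sub_self]
  change fromHermite hα c = _
  rw [← sub_eq_zero, ← map_sub]
  refine PSpace.ext_vMap fun x => ?_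
  rw [fromHermite_vMap hα (c - b) fun x j => by rw [h0]; rfl, h0]
  rfl

/-- Continuity out of a coinduced topology is tested on sequences. This works on the whole Hermite
space, and the subspace topology on the even functions then only requires a restriction. -/
theorem continuous_compW : Continuous (compW (d := d) hα) :=
  continuous_coinduced_dom.2 ((continuous_fromHermite hα).congr fun b =>
    (compW_hermiteMap hα b).symm)

theorem compW_vMap (ψ : hermiteEven d (α / 2) (half_pos hα)) (x : Fin d → ℝ) :
    compW hα ψ.1 (vMap x) = ψ.1 x := by
  have h : hermiteSeries d (α / 2) (half_pos hα) ψ.1.2.choose = ψ.1.1 := ψ.1.2.choose_spec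
  rw [compW, fromHermite_vMap hα _ fun x j => by rw [h]; exact ψ.2 x j, h]

/-- The map `f ↦ f ∘ v` as an isomorphism of topological vector spaces. -/
def compVEquiv : PSpace d α ≃L[ℂ] hermiteEven d (α / 2) (half_pos hα) where
  toLinearEquiv :=
    { compV hα with
      invFun := fun ψ => compW hα ψ.1
      left_inv := fun f => PSpace.ext_vMap fun x =>
        (compW_vMap hα (compV hα f) x).trans (compV_apply hα f x)
      right_inv := fun ψ => Subtype.ext (Subtype.ext (funext fun x =>
        (compV_apply hα (compW hα ψ.1) x).trans (compW_vMap hα ψ x))) }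
  continuous_toFun := continuous_compV hα
  continuous_invFun := (continuous_compW hα).comp continuous_subtype_val

end Main

end
end Pilipovic

theorem mainTheorem5 (d : ℕ) (hd : 0 < d) (α : ℝ) (hα : 0 < α) :
    ∃ Φ : Pilipovic.PSpace d α ≃L[ℂ] Pilipovic.hermiteEven d (α / 2) (half_pos hα),
      (∀ (f : Pilipovic.PSpace d α) (x : Fin d → ℝ), (Φ f).1 x = f (Pilipovic.vMap x)) ∧
      (∀ (ψ : Pilipovic.hermiteEven d (α / 2) (half_pos hα)) (y : Pilipovic.closedOrthant d),
        (Φ.symm ψ) y = ψ.1 (Pilipovic.wMap y)) :=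
  ⟨Pilipovic.compVEquiv hα, Pilipovic.compV_apply hα, fun ψ y =>
    (congrArg (Pilipovic.compW hα ψ.1) (Pilipovic.vMap_wMap y)).symm.trans
      (Pilipovic.compW_vMap hα ψ _)⟩
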